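/- For $n\ge 1$ let $A_b(n)$ (resp. $A_{b'}(n)$) be the universal unital C*-algebra generated by the entries of a self-conjugate unitary matrix $U=(u_{ij})_{1\le i,j\le n}$ (i.e. $u_{ij}=u_{ij}^*$ and $U$ is unitary) whose entries sum up to $1$ (resp. to one and the same element) in every row and every column, and let $A_s(n)$ (resp. $A_{s'}(n)$) be defined in the same way with the additional relation that all $u_{ij}$ are partial isometries. For $A=A_b(n)$ or $A=A_s(n)$ let $\widetilde A$ be the sub-C*-algebra of the unital free product $A*C(S^1)$ generated by the elements $u_{ij}\cdot\mathrm{id}_{S^1}$, which form the fundamental matrix of $\widetilde A$; put $A_c(n)=\widetilde{A_b(n)}$ and $A_p(n)=\widetilde{A_s(n)}$. **Lemma.** Let $n\ge 1$ and $*\in\{b',s',c,p\}$. Then $A_*(n)$, with its fundamental matrix, is a compact matrix quantum group, and its fundamental corepresentation contains (as a direct summand) a one-dimensional unitary corepresentation $U_z\not\simeq 1$ with $U_z\boxtimes\overline{U_z}\simeq 1$. If $*\in\{b',s'\}$, then moreover $U_z\simeq\overline{U_z}$. **Consequences.** A *fusion set* is a set $S$ with an associative fusion $S\times S\to S\cup\{\emptyset\}$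 and an involution $s\mapsto\bar s$ such that $s_1\cdot s_2=\overline{s_3}\Leftrightarrow s_2\cdot s_3=\overline{s_1}$. Let $M$ be the free monoid on $S$, with $\overline{s_1\cdots s_k}=\overline{s_k}\cdots\overline{s_1}$ and with the fusion of two nonempty words that fuses the last letter of the first word with the first letter of the second (it is empty if these letters fuse to $\emptyset$ or if one of the words is empty). Let $\mathbb{Z}M$ be the free abelian group with basis $(a_w)_{w\in M}$, unit $a_\emptyset$ (for the empty word), conjugation $a_w^*=a_{\bar w}$ and product $$a_w\cdot a_{w'}=\sum_{w=xy,\;w'=\bar y z}(a_{xz}+a_{x\cdot z}),$$ where the term $a_{x\cdot z}$ is omitted if the fusion $x\cdot z$ is empty. The fusion ring of a compact quantum group is the Grothendieck ring of its finite-dimensional unitary corepresentations, with $\boxplus$ as sum, $\boxtimes$ as product and conjugation as involution; it is called a free fusion ring if it is isomorphic, as a ring with involution, to $\mathbb{Z}M$ for some fusion set. 1. For every fusion set and every $a\in\mathbb{Z}M$ with $a\ne\pm1$ one has $a\cdot a^*\ne 1$. 2. For all $n\ge 1$ and $*\in\{b',s',c,p\}$ the fusion ring of $A_*(n)$ is not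 a free fusion ring. 3. Call a compact matrix quantum group $(A,U)$ with $U$ of size $n$ *orthogonal free* if the morphism $A_o(n)\to A_s(n)$ mapping the entries of the fundamental matrix of $A_o(n)$ to those of $A_s(n)$ factorizes through $(A,U)$, where $A_o(n)$ is the universal unital C*-algebra generated by the entries of a self-conjugate unitary $n\times n$ matrix, and if every space of intertwiners between tensor products of copies of $U$ and $\overline U$ is spanned by maps $T_P$ given by partitions $P$ of the disjoint union $\{1,\dots,k\}\sqcup\{1,\dots,l\}$; here $T_P(e_{i_1}\otimes\dots\otimes e_{i_k})=\sum_{j}P(i,j)\,e_{j_1}\otimes\dots\otimes e_{j_l}$, with $P(i,j)=1$ if $P$ joins only points carrying equal indices and $P(i,j)=0$ otherwise. Then for $n\ge4$ both $A_{b'}(n)$ and $A_{s'}(n)$ are orthogonal free. Hence the Banica–Vergnioux conjecture, that for all $n\ge 4$ the fusion ring of every orthogonal free quantum group is a free fusion ring, is false. -/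

import Mathlib

open scoped TensorProduct

noncomputable section

namespace FreeQG

/-! ### Completions of star-algebras with respect to C*-seminorms -/

/-- A C*-seminorm on a unital complex star-algebra. -/
structure CStarSeminorm (R : Type) [Ring R] [StarRing R] [Algebra ℂ R] where
  toFun : R → ℝ
  add_le' : ∀ a b, toFun (a + b) ≤ toFun a + toFun b
  smul' : ∀ (c : ℂ) a, toFun (c • a) = ‖c‖ * toFun a
  mul_le' : ∀ a b, toFun (a * b) ≤ toFun a * toFun b
  star_mul_self' : ∀ a, toFun (star a * a) = toFun a * toFun a

namespace CStarSeminorm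

variable {R : Type} [Ring R] [StarRing R] [Algebra ℂ R] (p : CStarSeminorm R)

theorem map_zero' : p.toFun 0 = 0 := by simpa using p.smul' 0 0

theorem map_neg' (a : R) : p.toFun (-a) = p.toFun a := by simpa using p.smul' (-1) a

theorem nonneg' (a : R) : 0 ≤ p.toFun a := by
  have h := p.add_le' a (-a)
  rw [add_neg_cancel, p.map_zero', p.map_neg'] at h
  linarith

theorem le_star (a : R) : p.toFun a ≤ p.toFun (star a) := by
  have h := p.mul_le' (star a) a
  rw [p.star_mul_self'] at h
  by_contra hlt
  push Not at hlt
  have h0 := p.nonneg' (star a)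
  nlinarith

theorem map_star' (a : R) : p.toFun (star a) = p.toFun a :=
  le_antisymm (by simpa using p.le_star (star a)) (p.le_star a)

/-- The algebra `R`, carrying the seminorm `p`. -/
def Carrier (_p : CStarSeminorm R) : Type := R

instance : Ring p.Carrier := inferInstanceAs (Ring R)
instance : StarRing p.Carrier := inferInstanceAs (StarRing R)
instance : Algebra ℂ p.Carrier := inferInstanceAs (Algebra ℂ R)

instance : SeminormedAddCommGroup p.Carrier :=
  AddGroupSeminorm.toSeminormedAddCommGroup (E := p.Carrier)
    { toFun := p.toFun
      map_zero' := p.map_zero'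
      add_le' := p.add_le'
      neg' := p.map_neg' }

theorem norm_def (a : p.Carrier) : ‖a‖ = p.toFun a := rfl

instance : SeminormedRing p.Carrier :=
  { (inferInstance : Ring p.Carrier), (inferInstance : SeminormedAddCommGroup p.Carrier) with
    norm_mul_le := p.mul_le' }

instance : NormedAlgebra ℂ p.Carrier where
  norm_smul_le c a := (p.smul' c a).le

instance : NormedStarGroup p.Carrier where
  norm_star_le a := (p.map_star' a).le

/-- The C*-algebra obtained from `R` by dividing out the null space of `p` and completing. -/
def Compl : Type := UniformSpace.Completion p.Carrier

instance : NormedRing p.Compl := inferInstanceAs (NormedRing (UniformSpace.Completion p.Carrier))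
instance : CompleteSpace p.Compl :=
  inferInstanceAs (CompleteSpace (UniformSpace.Completion p.Carrier))
instance : Algebra ℂ p.Compl := inferInstanceAs (Algebra ℂ (UniformSpace.Completion p.Carrier))
instance : NormedAlgebra ℂ p.Compl where
  norm_smul_le c a := norm_smul_le (β := UniformSpace.Completion p.Carrier) c a

theorem uniformContinuous_star : UniformContinuous (star : p.Carrier → p.Carrier) :=
  (starNormedAddGroupHom (E := p.Carrier)).uniformContinuous

instance : Star p.Compl := ⟨UniformSpace.Completion.map (star : p.Carrier → p.Carrier)⟩

/-- The canonical map of `R` into its completion. -/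
def coe (a : R) : p.Compl := ((show p.Carrier from a : p.Carrier) : UniformSpace.Completion p.Carrier)

theorem continuous_star : Continuous (star : p.Compl → p.Compl) :=
  UniformSpace.Completion.continuous_map

theorem star_coe (a : R) : star (p.coe a) = p.coe (star a) :=
  UniformSpace.Completion.map_coe p.uniformContinuous_star a

theorem coe_add (a b : R) : p.coe (a + b) = p.coe a + p.coe b :=
  UniformSpace.Completion.coe_add (α := p.Carrier) a b

theorem coe_mul (a b : R) : p.coe (a * b) = p.coe a * p.coe b :=
  UniformSpace.Completion.coe_mul (α := p.Carrier) a b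

theorem coe_smul (c : ℂ) (a : R) : p.coe (c • a) = c • p.coe a :=
  UniformSpace.Completion.coe_smul (X := p.Carrier) c a

theorem norm_coe (a : R) : ‖p.coe a‖ = p.toFun a :=
  UniformSpace.Completion.norm_coe (E := p.Carrier) a

theorem denseRange_coe : DenseRange p.coe :=
  UniformSpace.Completion.denseRange_coe (α := p.Carrier)

instance : StarRing p.Compl where
  star_involutive x := by
    refine p.denseRange_coe.induction_on (p := fun x => star (star x) = x) x
      (isClosed_eq (p.continuous_star.comp p.continuous_star) continuous_id) fun a => ?_
    rw [p.star_coe, p.star_coe, star_star]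
  star_mul x y := by
    refine p.denseRange_coe.induction_on₂ (p := fun x y => star (x * y) = star y * star x)
      (isClosed_eq (p.continuous_star.comp continuous_mul)
        ((p.continuous_star.comp continuous_snd).mul (p.continuous_star.comp continuous_fst)))
      (fun a b => ?_) x y
    rw [← p.coe_mul, p.star_coe, p.star_coe, p.star_coe, ← p.coe_mul, star_mul]
  star_add x y := by
    refine p.denseRange_coe.induction_on₂ (p := fun x y => star (x + y) = star x + star y)
      (isClosed_eq (p.continuous_star.comp continuous_add)
        ((p.continuous_star.comp continuous_fst).add (p.continuous_star.comp continuous_snd)))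
      (fun a b => ?_) x y
    rw [← p.coe_add, p.star_coe, p.star_coe, p.star_coe, ← p.coe_add, star_add]

instance : CStarRing p.Compl where
  norm_mul_self_le x := by
    refine p.denseRange_coe.induction_on (p := fun x => ‖x‖ * ‖x‖ ≤ ‖star x * x‖) x
      (isClosed_le (by fun_prop) (continuous_norm.comp (p.continuous_star.mul continuous_id)))
      fun a => ?_
    rw [p.star_coe, ← p.coe_mul, p.norm_coe, p.norm_coe, p.star_mul_self']

variable [StarModule ℂ R]

instance : StarModule ℂ p.Compl where
  star_smul c x := by
    refine p.denseRange_coe.induction_on (p := fun x => star (c • x) = star c • star x) x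
      (isClosed_eq (p.continuous_star.comp (continuous_const_smul c))
        (p.continuous_star.const_smul (star c)))
      fun a => ?_
    rw [← p.coe_smul, p.star_coe, p.star_coe, ← p.coe_smul, star_smul]

instance : CStarAlgebra p.Compl where

end CStarSeminorm

/-! ### Free star-algebras -/

/-- The free unital complex star-algebra on the set `X`: the monoid algebra of the free monoid on
the letters `(x, false)`, standing for `x`, and `(x, true)`, standing for `x*`. -/
abbrev FreeStar (X : Type) : Type := MonoidAlgebra ℂ (FreeMonoid (X × Bool))

namespace FreeStar

variable {X : Type}

/-- The letter `x` or `x*`. -/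
def letter (y : X × Bool) : FreeStar X := MonoidAlgebra.single (FreeMonoid.of y) 1

/-- The generator `x`. -/
def gen (x : X) : FreeStar X := letter (x, false)

/-- The conjugate-linear anti-automorphism exchanging `x` and `x*`. -/
def starHom (X : Type) : FreeStar X →+* (FreeStar X)ᵐᵒᵖ :=
  MonoidAlgebra.liftNCRingHom
    ((algebraMap ℂ (FreeStar X)ᵐᵒᵖ).comp (starRingEnd ℂ))
    (FreeMonoid.lift fun y : X × Bool => MulOpposite.op (letter (y.1, !y.2)))
    (fun c _ => Algebra.commute_algebraMap_left (starRingEnd ℂ c) _)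

theorem starHom_letter (y : X × Bool) :
    starHom X (letter y) = MulOpposite.op (letter (y.1, !y.2)) := by
  simp [starHom, letter, MonoidAlgebra.one_def]

theorem starHom_algebraMap (c : ℂ) :
    starHom X (algebraMap ℂ _ c) = algebraMap ℂ _ (star c) := by
  simp [starHom, MonoidAlgebra.coe_algebraMap]

theorem induction {C : FreeStar X → Prop} (hc : ∀ c : ℂ, C (algebraMap ℂ _ c))
    (hl : ∀ y, C (letter y)) (ha : ∀ a b, C a → C b → C (a + b))
    (hm : ∀ a b, C a → C b → C (a * b)) (a : FreeStar X) : C a := by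
  let S : Subalgebra ℂ (FreeStar X) :=
    { carrier := {a | C a}
      mul_mem' := fun h h' => hm _ _ h h'
      add_mem' := fun h h' => ha _ _ h h'
      algebraMap_mem' := hc }
  have hw : ∀ w : FreeMonoid (X × Bool), (MonoidAlgebra.of ℂ _ w : FreeStar X) ∈ S := by
    intro w
    induction w using FreeMonoid.inductionOn' with
    | one => exact S.one_mem
    | of_mul y w ih =>
      have := S.mul_mem (show letter y ∈ S from hl y) ih
      rw [map_mul]
      exact this
  exact MonoidAlgebra.induction_on (motive := fun a : MonoidAlgebra ℂ (FreeMonoid (X × Bool)) => a ∈ S) a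
    hw (fun _ _ h h' => S.add_mem h h') (fun c _ h => S.smul_mem h c)

instance : StarRing (FreeStar X) where
  star a := MulOpposite.unop (starHom X a)
  star_involutive a := by
    induction a using induction with
    | hc c =>
      beta_reduce
      rw [starHom_algebraMap, MulOpposite.algebraMap_apply, MulOpposite.unop_op,
        starHom_algebraMap, star_star, MulOpposite.algebraMap_apply, MulOpposite.unop_op]
    | hl y => simp [starHom_letter]
    | ha a b h h' => simp only [map_add, MulOpposite.unop_add] at *; rw [h, h']
    | hm a b h h' => simp only [map_mul, MulOpposite.unop_mul] at *; rw [h, h']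
  star_mul a b := by simp
  star_add a b := by simp

theorem star_def (a : FreeStar X) : star a = MulOpposite.unop (starHom X a) := rfl

theorem star_letter (y : X × Bool) : star (letter y) = letter (y.1, !y.2) := by
  simp [star_def, starHom_letter]

theorem star_algebraMap (c : ℂ) :
    star (algebraMap ℂ (FreeStar X) c) = algebraMap ℂ _ (star c) := by
  rw [star_def, starHom_algebraMap, MulOpposite.algebraMap_apply, MulOpposite.unop_op]

instance : StarModule ℂ (FreeStar X) where
  star_smul c a := by
    rw [Algebra.smul_def, star_mul, star_algebraMap, Algebra.smul_def, Algebra.commutes]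

variable {B : Type*} [Ring B] [StarRing B] [Algebra ℂ B]

/-- Evaluation of noncommutative star-polynomials at the family `v`. -/
def evalAlgHom (v : X → B) : FreeStar X →ₐ[ℂ] B :=
  MonoidAlgebra.lift ℂ B (FreeMonoid (X × Bool))
    (FreeMonoid.lift fun y : X × Bool => if y.2 then star (v y.1) else v y.1)

theorem evalAlgHom_letter (v : X → B) (y : X × Bool) :
    evalAlgHom v (letter y) = if y.2 then star (v y.1) else v y.1 := by
  simp [evalAlgHom, letter]

/-- Evaluation of noncommutative star-polynomials at the family `v`, as a star-homomorphism. -/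
def eval [StarModule ℂ B] (v : X → B) : FreeStar X →⋆ₐ[ℂ] B :=
  { evalAlgHom v with
    map_star' := by
      intro a
      change evalAlgHom v (star a) = star (evalAlgHom v a)
      induction a using induction with
      | hc c => rw [star_algebraMap, AlgHom.commutes, AlgHom.commutes, algebraMap_star_comm]
      | hl y => rcases y with ⟨x, _ | _⟩ <;> simp [star_letter, evalAlgHom_letter]
      | ha a b h h' => simp [h, h']
      | hm a b h h' => simp [h, h'] }

theorem eval_gen [StarModule ℂ B] (v : X → B) (x : X) : eval v (gen x) = v x := by
  simp [eval, gen, evalAlgHom_letter]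

end FreeStar

/-! ### Universal C*-algebras -/

/-- A condition on families `X → B` of elements of unital C*-algebras. -/
abbrev Relations (X : Type) : Type 1 := ∀ (B : Type) [CStarAlgebra B], (X → B) → Prop

/-- The relations force the norm of every generator to be bounded. This is exactly what is needed
for the universal C*-algebra to exist. -/
def Relations.Bounded {X : Type} (P : Relations X) : Prop :=
  ∀ x, ∃ C : ℝ, ∀ (B : Type) [CStarAlgebra B] (v : X → B), P B v → ‖v x‖ ≤ C

/-- A realization of the relations `P` in some unital C*-algebra. -/
structure Realization {X : Type} (P : Relations X) : Type 1 where
  alg : Type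
  [cstar : CStarAlgebra alg]
  fam : X → alg
  rel : P alg fam

attribute [instance] Realization.cstar

variable {X : Type} {P : Relations X}

theorem Relations.Bounded.bddAbove (hP : P.Bounded) (a : FreeStar X) :
    BddAbove (Set.range fun r : Realization P => ‖FreeStar.eval r.fam a‖) := by
  suffices h : ∃ C : ℝ, ∀ r : Realization P, ‖FreeStar.eval r.fam a‖ ≤ C by
    obtain ⟨C, hC⟩ := h
    exact ⟨C, by rintro _ ⟨r, rfl⟩; exact hC r⟩
  induction a using FreeStar.induction with
  | hc c =>
    refine ⟨‖c‖, fun r => ?_⟩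
    rw [AlgHomClass.commutes]
    rcases subsingleton_or_nontrivial r.alg with h | h
    · rw [Subsingleton.elim (algebraMap ℂ r.alg c) 0, norm_zero]; exact norm_nonneg _
    · rw [norm_algebraMap']
  | hl y =>
    obtain ⟨C, hC⟩ := hP y.1
    refine ⟨C, fun r => ?_⟩
    have := hC r.alg r.fam r.rel
    rcases y with ⟨x, _ | _⟩ <;>
    simpa [FreeStar.eval, FreeStar.evalAlgHom_letter] using this
  | ha a b h h' =>
    obtain ⟨C, hC⟩ := h
    obtain ⟨D, hD⟩ := h'
    refine ⟨C + D, fun r => ?_⟩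
    rw [map_add]
    exact (norm_add_le _ _).trans (add_le_add (hC r) (hD r))
  | hm a b h h' =>
    obtain ⟨C, hC⟩ := h
    obtain ⟨D, hD⟩ := h'
    refine ⟨C * D, fun r => ?_⟩
    rw [map_mul]
    exact (norm_mul_le _ _).trans
      (mul_le_mul (hC r) (hD r) (norm_nonneg _) ((norm_nonneg _).trans (hC r)))

/-- A supremum of pull-backs of C*-norms is a C*-seminorm. -/
def supSeminorm {R : Type} [Ring R] [StarRing R] [Algebra ℂ R] {ι : Type 1} (q : ι → R → ℝ)
    (hb : ∀ a, BddAbove (Set.range fun i => q i a)) (h0 : ∀ i a, 0 ≤ q i a)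
    (hadd : ∀ i a b, q i (a + b) ≤ q i a + q i b)
    (hsmul : ∀ i (c : ℂ) a, q i (c • a) = ‖c‖ * q i a)
    (hmul : ∀ i a b, q i (a * b) ≤ q i a * q i b)
    (hstar : ∀ i a, q i (star a * a) = q i a * q i a) : CStarSeminorm R where
  toFun a := ⨆ i, q i a
  add_le' a b := Real.iSup_le
    (fun i => (hadd i a b).trans (add_le_add (le_ciSup (hb a) i) (le_ciSup (hb b) i)))
    (add_nonneg (Real.iSup_nonneg fun i => h0 i a) (Real.iSup_nonneg fun i => h0 i b))
  smul' c a := by simp_rw [hsmul]; rw [Real.mul_iSup_of_nonneg (norm_nonneg c)]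
  mul_le' a b := Real.iSup_le
    (fun i => (hmul i a b).trans (mul_le_mul (le_ciSup (hb a) i) (le_ciSup (hb b) i) (h0 i b)
      (Real.iSup_nonneg fun i => h0 i a)))
    (mul_nonneg (Real.iSup_nonneg fun i => h0 i a) (Real.iSup_nonneg fun i => h0 i b))
  star_mul_self' a := by
    simp_rw [hstar]
    have hn : 0 ≤ ⨆ i, q i a := Real.iSup_nonneg fun i => h0 i a
    refine le_antisymm (Real.iSup_le (fun i => ?_) (mul_nonneg hn hn)) ?_
    · exact mul_le_mul (le_ciSup (hb a) i) (le_ciSup (hb a) i) (h0 i a) hn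
    · have hn' : 0 ≤ ⨆ i, q i a * q i a := Real.iSup_nonneg fun i => mul_nonneg (h0 i a) (h0 i a)
      suffices h : ⨆ i, q i a ≤ Real.sqrt (⨆ i, q i a * q i a) by
        calc _ ≤ _ := mul_le_mul h h hn (Real.sqrt_nonneg _)
          _ = _ := Real.mul_self_sqrt hn'
      refine Real.iSup_le (fun i => ?_) (Real.sqrt_nonneg _)
      refine Real.le_sqrt_of_sq_le ?_
      rw [sq]
      have hb' := hb (star a * a)
      simp_rw [hstar] at hb'
      exact le_ciSup hb' i

/-- The universal C*-seminorm of the relations `P`: the supremum over all realizations. -/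
def universalSeminorm (P : Relations X) (hP : P.Bounded) : CStarSeminorm (FreeStar X) :=
  supSeminorm (fun (r : Realization P) a => ‖FreeStar.eval r.fam a‖) hP.bddAbove
    (fun _ _ => norm_nonneg _) (fun _ _ _ => by rw [map_add]; exact norm_add_le _ _)
    (fun _ _ _ => by rw [map_smul, norm_smul]) (fun _ _ _ => by rw [map_mul]; exact norm_mul_le _ _)
    (fun _ _ => by rw [map_mul, map_star, CStarRing.norm_star_mul_self])

/-- The universal unital C*-algebra `C*(X | P)`. -/
abbrev UniversalCStar (P : Relations X) (hP : P.Bounded) : Type := (universalSeminorm P hP).Compl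

/-- The canonical generators of `C*(X | P)`. -/
def UniversalCStar.gen (P : Relations X) (hP : P.Bounded) (x : X) : UniversalCStar P hP :=
  (universalSeminorm P hP).coe (FreeStar.gen x)

/-! ### The minimal tensor product -/

section MinTensor

variable (A B : Type) [CStarAlgebra A] [CStarAlgebra B]

/-- A pair of representations of `A` and `B` on Hilbert spaces. -/
structure RepPair : Type 1 where
  H : Type
  K : Type
  [h₁ : NormedAddCommGroup H]
  [h₂ : InnerProductSpace ℂ H]
  [h₃ : CompleteSpace H]
  [k₁ : NormedAddCommGroup K]
  [k₂ : InnerProductSpace ℂ K]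
  [k₃ : CompleteSpace K]
  π : A →⋆ₐ[ℂ] (H →L[ℂ] H)
  ρ : B →⋆ₐ[ℂ] (K →L[ℂ] K)

attribute [instance] RepPair.h₁ RepPair.h₂ RepPair.h₃ RepPair.k₁ RepPair.k₂ RepPair.k₃

variable {A B}

/-- `π ⊗ ρ`, acting on the algebraic tensor product of the two Hilbert spaces (a dense subspace of
the Hilbert space tensor product, so that operator norms may be computed on it). -/
def RepPair.tensor (r : RepPair A B) : A ⊗[ℂ] B →ₐ[ℂ] (r.H ⊗[ℂ] r.K →L[ℂ] r.H ⊗[ℂ] r.K) :=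
  Algebra.TensorProduct.lift
    (AlgHom.ofLinearMap
      { toFun := fun a => TensorProduct.mapL (r.π a) 1
        map_add' := fun a b => by rw [map_add, TensorProduct.mapL_add_left]
        map_smul' := fun c a => by rw [map_smul, TensorProduct.mapL_smul_left]; rfl }
      (by change TensorProduct.mapL (r.π 1) 1 = 1; rw [map_one]; exact TensorProduct.mapL_id_id)
      (fun a b => by
        change TensorProduct.mapL (r.π (a * b)) 1 = _ * _
        rw [map_mul, ← one_mul (1 : r.K →L[ℂ] r.K), TensorProduct.mapL_mul, one_mul]; rfl))
    (AlgHom.ofLinearMap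
      { toFun := fun b => TensorProduct.mapL 1 (r.ρ b)
        map_add' := fun a b => by rw [map_add, TensorProduct.mapL_add_right]
        map_smul' := fun c a => by rw [map_smul, TensorProduct.mapL_smul_right]; rfl }
      (by change TensorProduct.mapL 1 (r.ρ 1) = 1; rw [map_one]; exact TensorProduct.mapL_id_id)
      (fun a b => by
        change TensorProduct.mapL 1 (r.ρ (a * b)) = _ * _
        rw [map_mul, ← one_mul (1 : r.H →L[ℂ] r.H), TensorProduct.mapL_mul, one_mul]; rfl))
    (fun a b => by
      change TensorProduct.mapL _ _ * TensorProduct.mapL _ _ =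
        TensorProduct.mapL _ _ * TensorProduct.mapL _ _
      rw [← TensorProduct.mapL_mul, ← TensorProduct.mapL_mul]; simp)

theorem RepPair.tensor_tmul (r : RepPair A B) (a : A) (b : B) :
    r.tensor (a ⊗ₜ b) = TensorProduct.mapL (r.π a) (r.ρ b) := by
  change TensorProduct.mapL (r.π a) 1 * TensorProduct.mapL 1 (r.ρ b) = _
  rw [← TensorProduct.mapL_mul]; simp

theorem RepPair.inner_tensor_star (r : RepPair A B) (t : A ⊗[ℂ] B) (x y : r.H ⊗[ℂ] r.K) :
    inner ℂ (r.tensor (star t) x) y = inner ℂ x (r.tensor t y) := by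
  induction t with
  | zero => simp
  | add s t hs ht => simp [inner_add_left, inner_add_right, hs, ht]
  | tmul a b =>
    rw [TensorProduct.star_tmul, r.tensor_tmul, r.tensor_tmul]
    induction x with
    | zero => simp
    | add x x' h h' => simp only [map_add, inner_add_left, h, h']
    | tmul ξ η =>
      induction y with
      | zero => simp
      | add y y' h h' => simp only [map_add, inner_add_right, h, h']
      | tmul ξ' η' =>
        rw [TensorProduct.mapL_tmul, TensorProduct.mapL_tmul, TensorProduct.inner_tmul,
          TensorProduct.inner_tmul, map_star, map_star, ContinuousLinearMap.star_eq_adjoint,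
          ContinuousLinearMap.star_eq_adjoint, ContinuousLinearMap.adjoint_inner_left,
          ContinuousLinearMap.adjoint_inner_left]

/-- The operator norm of `(π ⊗ ρ)(t)`. -/
def RepPair.opNorm (r : RepPair A B) (t : A ⊗[ℂ] B) : ℝ := ‖r.tensor t‖

theorem RepPair.opNorm_nonneg (r : RepPair A B) (t : A ⊗[ℂ] B) : 0 ≤ r.opNorm t :=
  ContinuousLinearMap.opNorm_nonneg _

theorem RepPair.opNorm_add_le (r : RepPair A B) (s t : A ⊗[ℂ] B) :
    r.opNorm (s + t) ≤ r.opNorm s + r.opNorm t := by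
  unfold RepPair.opNorm
  rw [map_add]
  exact ContinuousLinearMap.opNorm_add_le _ _

theorem RepPair.opNorm_mul_le (r : RepPair A B) (s t : A ⊗[ℂ] B) :
    r.opNorm (s * t) ≤ r.opNorm s * r.opNorm t := by
  unfold RepPair.opNorm
  rw [map_mul]
  exact ContinuousLinearMap.opNorm_comp_le _ _

theorem RepPair.opNorm_smul (r : RepPair A B) (c : ℂ) (t : A ⊗[ℂ] B) :
    r.opNorm (c • t) = ‖c‖ * r.opNorm t := by
  have hle : ∀ (c : ℂ) (t : A ⊗[ℂ] B), r.opNorm (c • t) ≤ ‖c‖ * r.opNorm t := fun c t => by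
    unfold RepPair.opNorm
    rw [map_smul]
    exact ContinuousLinearMap.opNorm_smul_le _ _
  refine le_antisymm (hle c t) ?_
  rcases eq_or_ne c 0 with rfl | hc
  · simpa using r.opNorm_nonneg _
  · have h := mul_le_mul_of_nonneg_left (hle c⁻¹ (c • t)) (norm_nonneg c)
    rwa [inv_smul_smul₀ hc, norm_inv, mul_inv_cancel_left₀ (norm_ne_zero_iff.mpr hc)] at h

theorem RepPair.opNorm_sq_le (r : RepPair A B) (t : A ⊗[ℂ] B) :
    r.opNorm t * r.opNorm t ≤ r.opNorm (star t * t) := by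
  have h0 := r.opNorm_nonneg (star t * t)
  have h : r.opNorm t ≤ Real.sqrt (r.opNorm (star t * t)) := by
    refine ContinuousLinearMap.opNorm_le_bound _ (Real.sqrt_nonneg _) fun x => ?_
    refine (abs_le_of_sq_le_sq' ?_ (by positivity)).2
    rw [mul_pow, Real.sq_sqrt h0, ← inner_self_eq_norm_sq (𝕜 := ℂ),
      ← r.inner_tensor_star]
    have hx : r.tensor (star t) (r.tensor t x) = r.tensor (star t * t) x := by
      rw [map_mul]; rfl
    rw [hx]
    refine (re_inner_le_norm (𝕜 := ℂ) (r.tensor (star t * t) x) x).trans ?_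
    rw [sq, ← mul_assoc]
    exact mul_le_mul_of_nonneg_right (ContinuousLinearMap.le_opNorm _ _) (norm_nonneg _)
  calc _ ≤ Real.sqrt (r.opNorm (star t * t)) * Real.sqrt (r.opNorm (star t * t)) :=
        mul_le_mul h h (r.opNorm_nonneg _) (Real.sqrt_nonneg _)
    _ = _ := Real.mul_self_sqrt h0

theorem RepPair.opNorm_star_le (r : RepPair A B) (t : A ⊗[ℂ] B) :
    r.opNorm (star t) ≤ r.opNorm t := by
  have h := r.opNorm_sq_le (star t)
  rw [star_star] at h
  have h' := h.trans (r.opNorm_mul_le _ _)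
  by_contra hlt
  push Not at hlt
  nlinarith [r.opNorm_nonneg t]

theorem RepPair.opNorm_star_mul_self (r : RepPair A B) (t : A ⊗[ℂ] B) :
    r.opNorm (star t * t) = r.opNorm t * r.opNorm t :=
  le_antisymm ((r.opNorm_mul_le _ _).trans
    (mul_le_mul_of_nonneg_right (r.opNorm_star_le t) (r.opNorm_nonneg t))) (r.opNorm_sq_le t)

theorem RepPair.bddAbove (t : A ⊗[ℂ] B) :
    BddAbove (Set.range fun r : RepPair A B => r.opNorm t) := by
  suffices h : ∃ C : ℝ, ∀ r : RepPair A B, r.opNorm t ≤ C by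
    obtain ⟨C, hC⟩ := h
    exact ⟨C, by rintro _ ⟨r, rfl⟩; exact hC r⟩
  induction t with
  | zero => exact ⟨0, fun r => by simpa using (r.opNorm_smul 0 0).le⟩
  | add s t hs ht =>
    obtain ⟨C, hC⟩ := hs
    obtain ⟨D, hD⟩ := ht
    exact ⟨C + D, fun r => (r.opNorm_add_le s t).trans (add_le_add (hC r) (hD r))⟩
  | tmul a b =>
    refine ⟨‖a‖ * ‖b‖, fun r => ?_⟩
    unfold RepPair.opNorm
    rw [r.tensor_tmul]
    exact (TensorProduct.norm_mapL_le _ _).trans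
      (mul_le_mul (NonUnitalStarAlgHom.norm_apply_le r.π a)
        (NonUnitalStarAlgHom.norm_apply_le r.ρ b) (norm_nonneg _) (norm_nonneg _))

variable (A B)

/-- The minimal (spatial) C*-seminorm on the algebraic tensor product `A ⊗ B`: the supremum of
`‖(π ⊗ ρ)(t)‖` over all pairs of representations on Hilbert spaces. -/
def minSeminorm : CStarSeminorm (A ⊗[ℂ] B) :=
  supSeminorm (fun (r : RepPair A B) t => r.opNorm t) RepPair.bddAbove
    (fun r => r.opNorm_nonneg) (fun r => r.opNorm_add_le) (fun r => r.opNorm_smul)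
    (fun r => r.opNorm_mul_le) (fun r => r.opNorm_star_mul_self)

/-- The minimal tensor product of C*-algebras. -/
abbrev MinTensor : Type := (minSeminorm A B).Compl

variable {A B}

/-- The elementary tensor `a ⊗ b` in the minimal tensor product. -/
def mtmul (a : A) (b : B) : MinTensor A B := (minSeminorm A B).coe (a ⊗ₜ[ℂ] b)

end MinTensor

/-! ### Free products -/

section FreeProduct

variable (A B : Type) [CStarAlgebra A] [CStarAlgebra B]

/-- The relations presenting the unital free product: the generators are the elements of `A` and
of `B`, and each of the two families of generators is a unital star-homomorphism. -/
def freeProductRel : Relations (A ⊕ B) := fun D _ v =>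
  ∃ (φ : A →⋆ₐ[ℂ] D) (ψ : B →⋆ₐ[ℂ] D), ∀ x, v x = Sum.elim φ ψ x

theorem freeProductRel_bounded : (freeProductRel A B).Bounded := by
  rintro (a | b)
  · refine ⟨‖a‖, ?_⟩
    rintro D _ v ⟨φ, ψ, h⟩
    rw [h]
    exact NonUnitalStarAlgHom.norm_apply_le φ a
  · refine ⟨‖b‖, ?_⟩
    rintro D _ v ⟨φ, ψ, h⟩
    rw [h]
    exact NonUnitalStarAlgHom.norm_apply_le ψ b

/-- The (full) unital free product `A * B` of C*-algebras. -/
abbrev FreeProduct : Type := UniversalCStar (freeProductRel A B) (freeProductRel_bounded A B)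

variable {A B}

/-- The canonical map `A → A * B`. -/
def FreeProduct.inl (a : A) : FreeProduct A B :=
  UniversalCStar.gen (freeProductRel A B) (freeProductRel_bounded A B) (Sum.inl a)

/-- The canonical map `B → A * B`. -/
def FreeProduct.inr (b : B) : FreeProduct A B :=
  UniversalCStar.gen (freeProductRel A B) (freeProductRel_bounded A B) (Sum.inr b)

end FreeProduct

/-! ### C*-algebras generated by the entries of a matrix -/

/-- A pair `(A, U)` of a unital C*-algebra `A` and an `n × n` matrix `U` over `A`. -/
structure MatrixPair (n : ℕ) : Type 1 where
  carrier : Type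
  [cstar : CStarAlgebra carrier]
  U : Matrix (Fin n) (Fin n) carrier

attribute [instance] MatrixPair.cstar

/-- The matrix with the given family of entries. -/
def toMatrix {n : ℕ} {B : Type} (v : Fin n × Fin n → B) : Matrix (Fin n) (Fin n) B :=
  Matrix.of fun i j => v (i, j)

/-- A unitary matrix over a C*-algebra. -/
def IsUnitaryMatrix {m B : Type} [Fintype m] [DecidableEq m] [CStarAlgebra B]
    (V : Matrix m m B) : Prop :=
  V * V.conjTranspose = 1 ∧ V.conjTranspose * V = 1

/-- `(u_ij) = (u_ij*)` is unitary. -/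
def oRel (n : ℕ) : Relations (Fin n × Fin n) := fun _B _ v =>
  (toMatrix v).map star = toMatrix v ∧ IsUnitaryMatrix (toMatrix v)

/-- All rows and all columns of `u` sum up to the element `z`. -/
def SumsTo {n : ℕ} {B : Type} [CStarAlgebra B] (u : Matrix (Fin n) (Fin n) B) (z : B) : Prop :=
  (∀ i, ∑ j, u i j = z) ∧ (∀ j, ∑ i, u i j = z)

/-- All entries of `u` are partial isometries. -/
def EntriesPartialIsometries {n : ℕ} {B : Type} [CStarAlgebra B]
    (u : Matrix (Fin n) (Fin n) B) : Prop :=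
  ∀ i j, u i j * star (u i j) * u i j = u i j

/-- The relations of the bistochastic quantum group. -/
def bRel (n : ℕ) : Relations (Fin n × Fin n) := fun B _ v =>
  oRel n B v ∧ SumsTo (toMatrix v) 1

/-- The relations of the quantum permutation group. -/
def sRel (n : ℕ) : Relations (Fin n × Fin n) := fun B _ v =>
  oRel n B v ∧ EntriesPartialIsometries (toMatrix v) ∧ SumsTo (toMatrix v) 1

/-- The relations of the symmetrized bistochastic quantum group. -/
def bPrimeRel (n : ℕ) : Relations (Fin n × Fin n) := fun B _ v =>
  oRel n B v ∧ ∃ z, SumsTo (toMatrix v) z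

/-- The relations of the symmetrized quantum permutation group. -/
def sPrimeRel (n : ℕ) : Relations (Fin n × Fin n) := fun B _ v =>
  oRel n B v ∧ EntriesPartialIsometries (toMatrix v) ∧ ∃ z, SumsTo (toMatrix v) z

theorem norm_entry_le_one {n : ℕ} {B : Type} [CStarAlgebra B] {u : Matrix (Fin n) (Fin n) B}
    (hu : IsUnitaryMatrix u) (i j : Fin n) : ‖u i j‖ ≤ 1 := by
  let _ : PartialOrder B := CStarAlgebra.spectralOrder B
  let _ : StarOrderedRing B := CStarAlgebra.spectralOrderedRing B
  have h := congrFun (congrFun hu.1 i) i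
  rw [Matrix.mul_apply, Matrix.one_apply_eq] at h
  simp only [Matrix.conjTranspose_apply] at h
  have hle : u i j * star (u i j) ≤ 1 := by
    rw [← h]
    exact Finset.single_le_sum (f := fun k => u i k * star (u i k))
      (fun k _ => mul_star_self_nonneg _) (Finset.mem_univ j)
  have h1 := (CStarAlgebra.norm_le_one_iff_of_nonneg _ (mul_star_self_nonneg (u i j))).mpr hle
  rw [CStarRing.norm_self_mul_star] at h1
  nlinarith [norm_nonneg (u i j)]

theorem bounded_of_oRel {n : ℕ} {P : Relations (Fin n × Fin n)}
    (h : ∀ (B : Type) [CStarAlgebra B] (v : Fin n × Fin n → B), P B v → oRel n B v) :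
    P.Bounded := fun x => ⟨1, fun B _ v hv => norm_entry_le_one (h B v hv).2 x.1 x.2⟩

/-- The universal C*-algebra generated by the entries of a matrix subject to the relations `P`. -/
def universalPair {n : ℕ} (P : Relations (Fin n × Fin n)) (hP : P.Bounded) : MatrixPair n where
  carrier := UniversalCStar P hP
  U := toMatrix (UniversalCStar.gen P hP)

/-- `A_o(n)` with its fundamental matrix. -/
def Ao (n : ℕ) : MatrixPair n := universalPair (oRel n) (bounded_of_oRel fun _ _ _ h => h)

/-- `A_s(n)` with its fundamental matrix. -/
def As (n : ℕ) : MatrixPair n := universalPair (sRel n) (bounded_of_oRel fun _ _ _ h => h.1)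

/-- `A_b(n)` with its fundamental matrix. -/
def Ab (n : ℕ) : MatrixPair n := universalPair (bRel n) (bounded_of_oRel fun _ _ _ h => h.1)

/-- `A_b'(n)` with its fundamental matrix. -/
def AbPrime (n : ℕ) : MatrixPair n :=
  universalPair (bPrimeRel n) (bounded_of_oRel fun _ _ _ h => h.1)

/-- `A_s'(n)` with its fundamental matrix. -/
def AsPrime (n : ℕ) : MatrixPair n :=
  universalPair (sPrimeRel n) (bounded_of_oRel fun _ _ _ h => h.1)

/-- The sub-C*-algebra generated by a set. -/
def generatedBy {A : Type} [CStarAlgebra A] (s : Set A) : StarSubalgebra ℂ A :=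
  (StarAlgebra.adjoin ℂ s).topologicalClosure

theorem subset_generatedBy {A : Type} [CStarAlgebra A] (s : Set A) : s ⊆ generatedBy s :=
  (StarAlgebra.subset_adjoin ℂ s).trans (StarSubalgebra.le_topologicalClosure _)

instance {A : Type} [CStarAlgebra A] (s : Set A) : CStarAlgebra (generatedBy s) :=
  haveI : IsClosed (generatedBy s : Set A) := StarSubalgebra.isClosed_topologicalClosure _
  StarSubalgebra.cstarAlgebra (generatedBy s)

/-- The canonical generator of `C(S¹)`. -/
def circleId : C(Circle, ℂ) := ⟨fun z => (z : ℂ), continuous_subtype_val⟩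

/-- The set of the elements `u_ij · id_{S¹}` of the free product `A * C(S¹)`. -/
def complexEntries {n : ℕ} (G : MatrixPair n) : Set (FreeProduct G.carrier C(Circle, ℂ)) :=
  Set.range fun p : Fin n × Fin n =>
    FreeProduct.inl (G.U p.1 p.2) * FreeProduct.inr circleId

/-- The free complexification: the sub-C*-algebra of `A * C(S¹)` generated by the elements
`u_ij · id_{S¹}`, with the matrix formed by these elements. -/
def freeComplexification {n : ℕ} (G : MatrixPair n) : MatrixPair n where
  carrier := generatedBy (complexEntries G)
  U := toMatrix fun p => ⟨FreeProduct.inl (G.U p.1 p.2) * FreeProduct.inr circleId,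
    subset_generatedBy _ ⟨p, rfl⟩⟩

/-- `A_c(n)`, the free complexification of `A_b(n)`. -/
def Ac (n : ℕ) : MatrixPair n := freeComplexification (Ab n)

/-- `A_p(n)`, the free complexification of `A_s(n)`. -/
def Ap (n : ℕ) : MatrixPair n := freeComplexification (As n)

/-! ### Compact matrix quantum groups and their corepresentations -/

/-- A compact matrix quantum group with an `n × n` fundamental matrix. The comultiplication is
uniquely determined by the pair `(A, U)`, because the entries of `U` generate `A`. -/
structure CMQG (n : ℕ) : Type 1 extends MatrixPair n where
  unitary_U : IsUnitaryMatrix U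
  generates : generatedBy (Set.range fun p : Fin n × Fin n => U p.1 p.2) = ⊤
  comul : carrier →⋆ₐ[ℂ] MinTensor carrier carrier
  comul_U : ∀ i j, comul (U i j) = ∑ k, mtmul (U i k) (U k j)
  isUnit_conj : IsUnit (U.map star)

section Intertwiners

variable {A : Type} [CStarAlgebra A] {m m' : Type} [Fintype m] [Fintype m'] [DecidableEq m]
  [DecidableEq m']

/-- A scalar matrix, viewed as a matrix over `A`. -/
def scalarMatrix (A : Type) [CStarAlgebra A] {m m' : Type} (T : Matrix m' m ℂ) : Matrix m' m A :=
  T.map (algebraMap ℂ A)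

/-- The space `Hom(V, W)` of intertwiners: scalar matrices `T` with `T V = W T`. -/
def Intertwiners (V : Matrix m m A) (W : Matrix m' m' A) : Submodule ℂ (Matrix m' m ℂ) where
  carrier := {T | scalarMatrix A T * V = W * scalarMatrix A T}
  add_mem' {S T} hS hT := by
    have h : scalarMatrix A (S + T) = scalarMatrix A S + scalarMatrix A T := by
      ext; simp [scalarMatrix]
    simp only [Set.mem_ofPred_eq] at *
    rw [h, Matrix.add_mul, Matrix.mul_add, hS, hT]
  zero_mem' := by
    have h : scalarMatrix A (0 : Matrix m' m ℂ) = 0 := by ext; simp [scalarMatrix]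
    simp [h]
  smul_mem' c T hT := by
    have h : scalarMatrix A (c • T) = c • scalarMatrix A T := by
      ext; simp [scalarMatrix, Algebra.smul_def]
    simp only [Set.mem_ofPred_eq] at *
    rw [h, Matrix.smul_mul, Matrix.mul_smul, hT]

/-- Equivalence `V ≃ W`: there is an invertible intertwiner. -/
def Equivalent (V : Matrix m m A) (W : Matrix m' m' A) : Prop :=
  ∃ T ∈ Intertwiners V W, ∃ S : Matrix m m' ℂ, S * T = 1 ∧ T * S = 1

/-- The direct sum `V ⊞ W`. -/
def directSum (V : Matrix m m A) (W : Matrix m' m' A) : Matrix (m ⊕ m') (m ⊕ m') A :=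
  Matrix.fromBlocks V 0 0 W

/-- The tensor product `V ⊠ W`, with entries `v_ij w_kl`. -/
def tensor (V : Matrix m m A) (W : Matrix m' m' A) : Matrix (m × m') (m × m') A :=
  Matrix.of fun p q => V p.1 q.1 * W p.2 q.2

/-- The conjugate matrix, with entries `v_ij*`. -/
def conj (V : Matrix m m A) : Matrix m m A := V.map star

/-- The tensor product `U^{w_1} ⊠ ⋯ ⊠ U^{w_k}` of copies of `U` (where `w` is `false`) and of the
conjugate of `U` (where `w` is `true`). -/
def wordPower (U : Matrix m m A) {k : ℕ} (w : Fin k → Bool) :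
    Matrix (Fin k → m) (Fin k → m) A :=
  Matrix.of fun i j => (List.ofFn fun a => (if w a then conj U else U) (i a) (j a)).prod

end Intertwiners

namespace CMQG

variable {n : ℕ} (G : CMQG n)

/-- `V` is a (finite-dimensional) unitary corepresentation matrix of `G`. -/
def IsCorep {m : Type} [Fintype m] [DecidableEq m] (V : Matrix m m G.carrier) : Prop :=
  IsUnitaryMatrix V ∧ ∀ i j, G.comul (V i j) = ∑ k, mtmul (V i k) (V k j)

/-- The corepresentation `V` contains the corepresentation `W` as a direct summand. -/
def Contains {m m' : Type} [Fintype m] [DecidableEq m] [Fintype m'] [DecidableEq m']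
    (V : Matrix m m G.carrier) (W : Matrix m' m' G.carrier) : Prop :=
  ∃ (d : ℕ) (X : Matrix (Fin d) (Fin d) G.carrier), G.IsCorep X ∧ Equivalent V (directSum W X)

/-- The type of all unitary corepresentation matrices of `G`. -/
structure Corep : Type where
  dim : ℕ
  mat : Matrix (Fin dim) (Fin dim) G.carrier
  isCorep : G.IsCorep mat

/-- The defining relations of the fusion ring: `[X] = [V]` if `X ≃ V`, `[X] = [V] + [W]` if
`X ≃ V ⊞ W`, `[X] = [V] [W]` if `X ≃ V ⊠ W`, and `[X] = 1` if `X` is trivial. -/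
inductive FusionRel : FreeAlgebra ℤ G.Corep → FreeAlgebra ℤ G.Corep → Prop
  | equiv (X V : G.Corep) (h : Equivalent X.mat V.mat) :
      FusionRel (FreeAlgebra.ι ℤ X) (FreeAlgebra.ι ℤ V)
  | add (X V W : G.Corep) (h : Equivalent X.mat (directSum V.mat W.mat)) :
      FusionRel (FreeAlgebra.ι ℤ X) (FreeAlgebra.ι ℤ V + FreeAlgebra.ι ℤ W)
  | mul (X V W : G.Corep) (h : Equivalent X.mat (tensor V.mat W.mat)) :
      FusionRel (FreeAlgebra.ι ℤ X) (FreeAlgebra.ι ℤ V * FreeAlgebra.ι ℤ W)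
  | one (X : G.Corep) (h : Equivalent X.mat (1 : Matrix (Fin 1) (Fin 1) G.carrier)) :
      FusionRel (FreeAlgebra.ι ℤ X) 1

/-- The fusion ring of `G`: the Grothendieck ring of the finite-dimensional unitary
corepresentations with respect to direct sum and tensor product, given as the ring generated by
the classes `[V]` subject to the relations above. -/
def FusionRing : Type := RingQuot G.FusionRel

instance : Ring G.FusionRing := inferInstanceAs (Ring (RingQuot G.FusionRel))

/-- The class `[V]` of a corepresentation in the fusion ring. -/
def cls (V : G.Corep) : G.FusionRing :=
  RingQuot.mkRingHom G.FusionRel (FreeAlgebra.ι ℤ V)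

end CMQG

/-! ### Free fusion rings -/

/-- A set with a fusion (`none` stands for the empty set) and a conjugation. -/
structure FusionSet : Type 1 where
  S : Type
  fusion : S → S → Option S
  bar : S → S
  assoc : ∀ a b c, ((fusion a b).bind fun x => fusion x c) = (fusion b c).bind fun y => fusion a y
  bar_bar : ∀ a, bar (bar a) = a
  compat : ∀ a b c, fusion a b = some (bar c) ↔ fusion b c = some (bar a)

namespace FusionSet

variable (F : FusionSet)

/-- The conjugation on words. -/
def barWord (w : List F.S) : List F.S := (w.map F.bar).reverse

/-- The fusion of words: the last letter of the first word is fused with the first letter of the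
second one; it is empty if one of the words is. -/
def fuseWord (x z : List F.S) : Option (List F.S) :=
  x.getLast?.bind fun s => z.head?.bind fun t =>
    (F.fusion s t).map fun r => x.dropLast ++ r :: z.tail

/-- The free abelian group `ℤM` on the free monoid `M` of words over the fusion set. -/
def ZM : Type := List F.S →₀ ℤ

instance : AddCommGroup F.ZM := inferInstanceAs (AddCommGroup (List F.S →₀ ℤ))

/-- The basis element `a_w`. -/
def basis (w : List F.S) : F.ZM := Finsupp.single w 1

open scoped Classical in
/-- The product `a_w a_w'`: the sum of `a_{xz} + a_{x·z}` over all `w = xy`, `w' = ȳz`, the second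
summand being dropped if the fusion `x · z` is empty. -/
def mulWord (w w' : List F.S) : F.ZM :=
  ∑ k ∈ Finset.range (w.length + 1),
    if F.barWord (w.drop k) <+: w' then
      F.basis (w.take k ++ w'.drop (w.length - k)) +
        ((F.fuseWord (w.take k) (w'.drop (w.length - k))).elim 0 F.basis)
    else 0

/-- The biadditive extension of the product of words. -/
instance : Mul F.ZM where
  mul a b := Finsupp.sum (show List F.S →₀ ℤ from a) fun w c =>
    Finsupp.sum (show List F.S →₀ ℤ from b) fun w' d => (c * d) • F.mulWord w w'

instance : One F.ZM := ⟨F.basis []⟩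

/-- The additive extension of the conjugation of words. -/
instance : Star F.ZM := ⟨fun a => Finsupp.mapDomain F.barWord (show List F.S →₀ ℤ from a)⟩

end FusionSet

namespace CMQG

variable {n : ℕ} (G : CMQG n)

/-- The fusion ring of `G` is a free fusion ring: it is isomorphic, as a ring with involution, to
`ℤM` for some fusion set. The involution of the fusion ring sends `[V]` to the class of any
unitary corepresentation `W` that is equivalent to the conjugate of `V`. -/
def HasFreeFusionRing : Prop :=
  ∃ (F : FusionSet) (e : G.FusionRing ≃+* F.ZM),
    ∀ V W : G.Corep, Equivalent W.mat (conj V.mat) → e (G.cls W) = star (e (G.cls V))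

end CMQG

/-! ### Orthogonal free quantum groups -/

open scoped Classical in
/-- The matrix of the linear map `T_P : (ℂⁿ)^{⊗k} → (ℂⁿ)^{⊗l}` of a partition `P` of
`{1, …, k} ⊔ {1, …, l}` (given as an equivalence relation): the entry at `(j, i)` is `1` if `P` joins
only points carrying equal indices, and `0` otherwise. -/
def partitionMap (n : ℕ) {k l : ℕ} (P : Setoid (Fin k ⊕ Fin l)) :
    Matrix (Fin l → Fin n) (Fin k → Fin n) ℂ :=
  Matrix.of fun j i => if ∀ a b, P a b → Sum.elim i j a = Sum.elim i j b then 1 else 0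

/-- `G` is an orthogonal free quantum group: the morphism from `A_o(n)` to `A_s(n)` factorizes
through `G`, and the intertwiner spaces between tensor products of copies of `U` and its conjugate
are spanned by partitions. -/
def CMQG.IsOrthogonalFree {n : ℕ} (G : CMQG n) : Prop :=
  (∃ φ : (Ao n).carrier →⋆ₐ[ℂ] G.carrier, ∀ i j, φ ((Ao n).U i j) = G.U i j) ∧
  (∃ ψ : G.carrier →⋆ₐ[ℂ] (As n).carrier, ∀ i j, ψ (G.U i j) = (As n).U i j) ∧
  ∀ (k l : ℕ) (w : Fin k → Bool) (w' : Fin l → Bool),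
    ∃ D : Set (Setoid (Fin k ⊕ Fin l)),
      Intertwiners (wordPower G.U w) (wordPower G.U w') =
        Submodule.span ℂ (partitionMap n '' D)

/-- The indices `b'`, `s'`, `c`, `p`. -/
inductive Index
  | bPrime
  | sPrime
  | c
  | p

/-- The pair `(A_*(n), U_*)` for `* ∈ {b', s', c, p}`. -/
def Index.pair (n : ℕ) : Index → MatrixPair n
  | .bPrime => AbPrime n
  | .sPrime => AsPrime n
  | .c => Ac n
  | .p => Ap n

end FreeQG

end

/-!
The two ideas are independent of each other.

**Fusion rings.** In `ℤM` the coefficient of the unit in `a a*` is the sum of the squares of the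
coefficients of `a`, and `a_w a_{w̄}` contains `a_{w w̄}`; hence `a a* = 1` only for `a = ±1`
(`FusionSet.eq_one_or_neg_one_of_mul_star`). On the other hand, if all rows and columns of the
fundamental matrix have the same sum `z`, then `z` is unitary and group-like, and a unitary change
of coordinates that moves `(1, …, 1)` to a coordinate axis splits off the one-dimensional
corepresentation `z` (`CMQG.contains_of_sumsTo`). Characters `χ` of the algebra induce ring
homomorphisms `[V] ↦ tr χ(V)` on the fusion ring, so that the class of `z` is not `±1` as soon as
`χ z ≠ 1` and `χ' z ≠ -1` for some characters (`CMQG.not_hasFreeFusionRing`). For `A_b'(n)` and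
`A_s'(n)` the characters given by the scalar matrices `-1` and `1` do this. For the free
complexifications `z` is the canonical generator of `C(S¹)`, which takes the value `I` under some
character. Since `z` is a row sum, it belongs to the free complexification, which is therefore the whole
free product, which gives its comultiplication (`exists_complexCMQG`).

**Orthogonal freeness.** No description of the intertwiner spaces by explicit categories of
partitions is needed. Let `D(k, l)` consist of *all* partitions `P` for which `T_P` is an
intertwiner of the given quantum group. The spans of the `T_P` with `P ∈ D(k, l)` are again closed under
composition (`T_P T_Q` is a nonzero multiple of some `T_R`), adjoints and Frobenius rotation
(`IntertwinerFamily.partitionPart`). By Tannaka–Krein reconstruction, such a family `C` comes from a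
matrix of operators whose intertwiners belong to `C` (`IntertwinerFamily.intertwiners_ops_le`). The
relations of `A_b'(n)` and `A_s'(n)` say that certain maps `T_P` are intertwiners; these `P` belong
to `D`, so the relations hold for the operators. Thus there is a homomorphism from the given
algebra to the operators, and all intertwiners of the given quantum group belong to `C`.

The reconstruction is done on the level of the Haar state: the projections onto the spaces `C(l, k)`
define a kernel on pairs of words, which is to be the inner product of the matrix coefficients
`u_{x₁y₁} ⋯ u_{x_k y_k}`. It is positive semidefinite (`re_hs_frameMap_nonneg`), and left
multiplication by `u_ij` is symmetric and bounded on the resulting Hilbert space. If `T` intertwines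
tensor powers of these operators, then applying the relation to the empty word shows that `T` equals
its projection onto `C`.
-/

noncomputable section

namespace FreeQG

/-! ### Universal properties of completions and of universal C*-algebras -/

namespace CStarSeminorm

variable {R : Type} [Ring R] [StarRing R] [Algebra ℂ R] (p : CStarSeminorm R)

theorem coe_one : p.coe 1 = 1 := UniformSpace.Completion.coe_one p.Carrier

/-- The canonical map into the completion, as a star-homomorphism. -/
def coeHom : R →⋆ₐ[ℂ] p.Compl where
  toFun := p.coe
  map_one' := p.coe_one
  map_mul' := p.coe_mul
  map_zero' := UniformSpace.Completion.coe_zero (α := p.Carrier)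
  map_add' := p.coe_add
  commutes' c := by
    rw [Algebra.algebraMap_eq_smul_one, p.coe_smul, p.coe_one, Algebra.algebraMap_eq_smul_one]
  map_star' a := (p.star_coe a).symm

theorem coeHom_apply (a : R) : p.coeHom a = p.coe a := rfl

theorem coe_eq_coe_of_sub {a b : R} (h : p.toFun (a - b) = 0) : p.coe a = p.coe b := by
  rw [← sub_eq_zero, ← p.coeHom_apply, ← p.coeHom_apply, ← map_sub, ← norm_eq_zero,
    p.coeHom_apply, p.norm_coe, h]

variable {B : Type} [CStarAlgebra B]

/-- The extension to the completion, as a ring homomorphism, of a contractive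
star-homomorphism. -/
def liftRingHom (f : R →⋆ₐ[ℂ] B) (hf : ∀ a, ‖f a‖ ≤ p.toFun a) : p.Compl →+* B :=
  UniformSpace.Completion.extensionHom
    (show p.Carrier →+* B from (f : R →+* B))
    (by
      let g : p.Carrier →+ B := ((f : R →+* B) : R →+ B)
      exact AddMonoidHomClass.continuous_of_bound g 1 fun a => by
        rw [one_mul]; exact hf a)

theorem liftRingHom_coe (f : R →⋆ₐ[ℂ] B) (hf : ∀ a, ‖f a‖ ≤ p.toFun a) (a : R) :
    p.liftRingHom f hf (p.coe a) = f a :=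
  UniformSpace.Completion.extensionHom_coe _ _ _

theorem continuous_liftRingHom (f : R →⋆ₐ[ℂ] B) (hf : ∀ a, ‖f a‖ ≤ p.toFun a) :
    Continuous (p.liftRingHom f hf) :=
  UniformSpace.Completion.continuous_extension

/-- A star-homomorphism that is contractive for the seminorm `p` extends to the completion. -/
def lift (f : R →⋆ₐ[ℂ] B) (hf : ∀ a, ‖f a‖ ≤ p.toFun a) : p.Compl →⋆ₐ[ℂ] B :=
  { p.liftRingHom f hf with
    commutes' := fun c => by
      have h := p.liftRingHom_coe f hf (algebraMap ℂ R c)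
      rw [AlgHomClass.commutes, ← p.coeHom_apply, AlgHomClass.commutes] at h
      exact h
    map_star' := fun x => by
      refine p.denseRange_coe.induction_on
        (p := fun x => p.liftRingHom f hf (star x) = star (p.liftRingHom f hf x)) x
        (isClosed_eq ((p.continuous_liftRingHom f hf).comp p.continuous_star)
          (p.continuous_liftRingHom f hf).star) fun a => ?_
      rw [p.star_coe, p.liftRingHom_coe, p.liftRingHom_coe, map_star] }

theorem lift_coe (f : R →⋆ₐ[ℂ] B) (hf : ∀ a, ‖f a‖ ≤ p.toFun a) (a : R) :
    p.lift f hf (p.coe a) = f a := p.liftRingHom_coe f hf a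

end CStarSeminorm

theorem generatedBy_le {A : Type} [CStarAlgebra A] {s : Set A} {S : StarSubalgebra ℂ A}
    (hS : IsClosed (S : Set A)) (h : s ⊆ S) : generatedBy s ≤ S :=
  StarSubalgebra.topologicalClosure_minimal (StarAlgebra.adjoin_le h) hS

theorem isClosed_generatedBy {A : Type} [CStarAlgebra A] (s : Set A) :
    IsClosed (generatedBy s : Set A) :=
  StarSubalgebra.isClosed_topologicalClosure _

theorem continuous_starAlgHom {A B : Type} [CStarAlgebra A] [CStarAlgebra B]
    (f : A →⋆ₐ[ℂ] B) : Continuous f :=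
  AddMonoidHomClass.continuous_of_bound f 1 fun a => by
    rw [one_mul]; exact NonUnitalStarAlgHom.norm_apply_le f a

/-- A star-homomorphism maps the C*-algebra generated by `s` into any C*-algebra that contains the
image of `s`. -/
theorem map_mem_of_mem_generatedBy {A B : Type} [CStarAlgebra A] [CStarAlgebra B]
    (f : A →⋆ₐ[ℂ] B) {S : StarSubalgebra ℂ B} (hS : IsClosed (S : Set B)) {s : Set A}
    (h : ∀ a ∈ s, f a ∈ S) {a : A} (ha : a ∈ generatedBy s) : f a ∈ S := by
  have hle : generatedBy s ≤ S.comap f :=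
    generatedBy_le (hS.preimage (continuous_starAlgHom f)) h
  exact hle ha

/-- The generators of a generated C*-subalgebra generate it, as elements of the subalgebra. -/
theorem generatedBy_preimage_eq_top {A : Type} [CStarAlgebra A] (s : Set A) :
    generatedBy {x : generatedBy s | (x : A) ∈ s} = ⊤ := by
  rw [eq_top_iff]
  rintro x -
  have hx : (x : A) ∈ closure (StarAlgebra.adjoin ℂ s : Set A) := x.2
  change x ∈ closure (StarAlgebra.adjoin ℂ {x : generatedBy s | (x : A) ∈ s} : Set (generatedBy s))
  rw [closure_subtype]
  refine closure_mono ?_ hx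
  have hle : StarAlgebra.adjoin ℂ s ≤
      (StarAlgebra.adjoin ℂ {x : generatedBy s | (x : A) ∈ s}).map (generatedBy s).subtype := by
    refine StarAlgebra.adjoin_le fun a ha => ?_
    exact ⟨⟨a, subset_generatedBy s ha⟩, StarAlgebra.subset_adjoin ℂ _ ha, rfl⟩
  exact hle

namespace UniversalCStar

variable {X : Type} (P : Relations X) (hP : P.Bounded)

/-- The universal property of `C*(X | P)`. -/
def lift {B : Type} [CStarAlgebra B] (v : X → B) (hv : P B v) : UniversalCStar P hP →⋆ₐ[ℂ] B :=
  (universalSeminorm P hP).lift (FreeStar.eval v)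
    fun a => le_ciSup (hP.bddAbove a) (⟨B, v, hv⟩ : Realization P)

theorem lift_gen {B : Type} [CStarAlgebra B] (v : X → B) (hv : P B v) (x : X) :
    lift P hP v hv (gen P hP x) = v x := by
  exact ((universalSeminorm P hP).lift_coe _ _ _).trans (FreeStar.eval_gen v x)

/-- An identity between noncommutative polynomials that holds in all realizations of the relations
holds in the universal C*-algebra. -/
theorem coe_eq_coe {a b : FreeStar X}
    (h : ∀ r : Realization P, FreeStar.eval r.fam a = FreeStar.eval r.fam b) :
    (universalSeminorm P hP).coe a = (universalSeminorm P hP).coe b := by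
  refine (universalSeminorm P hP).coe_eq_coe_of_sub ?_
  change ⨆ r : Realization P, ‖FreeStar.eval r.fam (a - b)‖ = 0
  simp [h]

theorem generatedBy_range_gen : generatedBy (Set.range (gen P hP)) = ⊤ := by
  rw [eq_top_iff]
  rintro x -
  refine (universalSeminorm P hP).denseRange_coe.induction_on
    (p := fun x => x ∈ generatedBy (Set.range (gen P hP))) x (isClosed_generatedBy _) fun a => ?_
  rw [← CStarSeminorm.coeHom_apply]
  induction a using FreeStar.induction with
  | hc c => rw [AlgHomClass.commutes]; exact (generatedBy (Set.range (gen P hP))).algebraMap_mem c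
  | hl y =>
    have hx : gen P hP y.1 ∈ generatedBy (Set.range (gen P hP)) := subset_generatedBy _ ⟨_, rfl⟩
    rcases y with ⟨x, _ | _⟩
    · exact hx
    · have : FreeStar.letter (x, true) = star (FreeStar.gen x) := by
        rw [FreeStar.gen, FreeStar.star_letter]; rfl
      rw [this, map_star]
      exact star_mem hx
  | ha a b h h' => rw [map_add]; exact add_mem h h'
  | hm a b h h' => rw [map_mul]; exact mul_mem h h'

/-- If a family of generators, indexed by a C*-algebra `A`, is a star-homomorphism in every
realization, then it is one in the universal C*-algebra. -/
def genHom {A : Type} [CStarAlgebra A] (j : A → X)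
    (h : ∀ r : Realization P, ∃ φ : A →⋆ₐ[ℂ] r.alg, ∀ a, r.fam (j a) = φ a) :
    A →⋆ₐ[ℂ] UniversalCStar P hP :=
  let q := (universalSeminorm P hP).coeHom
  have key : ∀ x y : FreeStar X,
      (∀ r : Realization P, FreeStar.eval r.fam x = FreeStar.eval r.fam y) → q x = q y :=
    fun _ _ h => coe_eq_coe _ _ h
  { toFun := fun a => gen P hP (j a)
    map_one' := (key (.gen (j 1)) 1 fun r => by
      obtain ⟨φ, h⟩ := h r
      rw [FreeStar.eval_gen, h, map_one, map_one]).trans (universalSeminorm P hP).coe_one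
    map_zero' := (key (.gen (j 0)) 0 fun r => by
      obtain ⟨φ, h⟩ := h r
      rw [FreeStar.eval_gen, h, map_zero, map_zero]).trans (map_zero q)
    map_mul' := fun a b => by
      change _ = q _ * q _
      rw [← map_mul]
      refine key _ _ fun r => ?_
      obtain ⟨φ, h⟩ := h r
      simp only [FreeStar.eval_gen, h, map_mul]
    map_add' := fun a b => (key (.gen (j (a + b))) (.gen (j a) + .gen (j b)) fun r => by
      obtain ⟨φ, h⟩ := h r
      simp only [FreeStar.eval_gen, h, map_add]).trans ((universalSeminorm P hP).coe_add _ _)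
    commutes' := fun c => (key (.gen (j (algebraMap ℂ A c))) (algebraMap ℂ _ c) fun r => by
      obtain ⟨φ, h⟩ := h r
      rw [FreeStar.eval_gen, h, AlgHomClass.commutes, AlgHomClass.commutes]).trans
        (q.commutes' c)
    map_star' := fun a => (key (.gen (j (star a))) (star (.gen (j a))) fun r => by
      obtain ⟨φ, h⟩ := h r
      rw [FreeStar.eval_gen, h, map_star, map_star, FreeStar.eval_gen, h]).trans
      ((universalSeminorm P hP).star_coe _).symm }

end UniversalCStar

/-! ### Homomorphisms of free products and of tensor products -/

namespace FreeProduct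

variable {A B D : Type} [CStarAlgebra A] [CStarAlgebra B] [CStarAlgebra D]

/-- The homomorphism of a free product given by homomorphisms of the factors. -/
def lift (φ : A →⋆ₐ[ℂ] D) (ψ : B →⋆ₐ[ℂ] D) : FreeProduct A B →⋆ₐ[ℂ] D :=
  UniversalCStar.lift (freeProductRel A B) (freeProductRel_bounded A B) (Sum.elim φ ψ)
    ⟨φ, ψ, fun _ => rfl⟩

theorem lift_inl (φ : A →⋆ₐ[ℂ] D) (ψ : B →⋆ₐ[ℂ] D) (a : A) : lift φ ψ (inl a) = φ a :=
  UniversalCStar.lift_gen _ _ _ _ _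

theorem lift_inr (φ : A →⋆ₐ[ℂ] D) (ψ : B →⋆ₐ[ℂ] D) (b : B) : lift φ ψ (inr b) = ψ b :=
  UniversalCStar.lift_gen _ _ _ _ _

variable (A B)

/-- The inclusion of the first factor of a free product. -/
def inlHom : A →⋆ₐ[ℂ] FreeProduct A B :=
  UniversalCStar.genHom _ (freeProductRel_bounded A B) Sum.inl
    fun r => r.rel.elim fun φ h => h.elim fun _ h => ⟨φ, fun a => h (Sum.inl a)⟩

/-- The inclusion of the second factor of a free product. -/
def inrHom : B →⋆ₐ[ℂ] FreeProduct A B :=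
  UniversalCStar.genHom _ (freeProductRel_bounded A B) Sum.inr
    fun r => r.rel.elim fun _ h => h.elim fun ψ h => ⟨ψ, fun b => h (Sum.inr b)⟩

variable {A B}

theorem inlHom_apply (a : A) : inlHom A B a = inl a := rfl

theorem inrHom_apply (b : B) : inrHom A B b = inr b := rfl

end FreeProduct

section MinTensorLemmas

variable {A B : Type} [CStarAlgebra A] [CStarAlgebra B]

theorem mtmul_mul_mtmul (a a' : A) (b b' : B) :
    mtmul a b * mtmul a' b' = mtmul (a * a') (b * b') := by
  simp only [mtmul]
  rw [← CStarSeminorm.coe_mul, Algebra.TensorProduct.tmul_mul_tmul]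

theorem star_mtmul (a : A) (b : B) : star (mtmul a b) = mtmul (star a) (star b) := by
  simp only [mtmul]
  rw [CStarSeminorm.star_coe, TensorProduct.star_tmul]

theorem mtmul_one_one : mtmul (1 : A) (1 : B) = 1 := by
  simp only [mtmul]
  rw [← Algebra.TensorProduct.one_def, CStarSeminorm.coe_one]

/-- The elementary tensor `a ⊗ b` depends linearly on `a` and `b`. -/
def mtmulLin (A B : Type) [CStarAlgebra A] [CStarAlgebra B] : A →ₗ[ℂ] B →ₗ[ℂ] MinTensor A B :=
  (TensorProduct.mk ℂ A B).compr₂ (minSeminorm A B).coeHom.toAlgHom.toLinearMap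

theorem mtmulLin_apply (a : A) (b : B) : mtmulLin A B a b = mtmul a b := rfl

theorem sum_mtmul {ι : Type*} (s : Finset ι) (f : ι → A) (b : B) :
    mtmul (∑ i ∈ s, f i) b = ∑ i ∈ s, mtmul (f i) b := by
  simp only [← mtmulLin_apply, map_sum, LinearMap.sum_apply]

theorem mtmul_sum {ι : Type*} (s : Finset ι) (a : A) (f : ι → B) :
    mtmul a (∑ i ∈ s, f i) = ∑ i ∈ s, mtmul a (f i) := by
  simp only [← mtmulLin_apply, map_sum]

theorem smul_mtmul (c : ℂ) (a : A) (b : B) : mtmul (c • a) b = c • mtmul a b := by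
  simp only [← mtmulLin_apply, map_smul, LinearMap.smul_apply]

theorem mtmul_smul (c : ℂ) (a : A) (b : B) : mtmul a (c • b) = c • mtmul a b := by
  simp only [← mtmulLin_apply, map_smul]

theorem mtmul_zero (a : A) : mtmul a (0 : B) = 0 := by
  simp only [← mtmulLin_apply, map_zero]

theorem zero_mtmul (b : B) : mtmul (0 : A) b = 0 := by
  simp only [← mtmulLin_apply, map_zero, LinearMap.zero_apply]

variable (A B)

/-- The homomorphism `a ↦ a ⊗ 1`. -/
def mtmulLeft : A →⋆ₐ[ℂ] MinTensor A B where
  toFun a := mtmul a 1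
  map_one' := mtmul_one_one
  map_zero' := zero_mtmul 1
  map_mul' a a' := by rw [mtmul_mul_mtmul, mul_one]
  map_add' a a' := by simp only [← mtmulLin_apply, map_add, LinearMap.add_apply]
  commutes' c := by
    rw [Algebra.algebraMap_eq_smul_one, smul_mtmul, mtmul_one_one, Algebra.algebraMap_eq_smul_one]
  map_star' a := by rw [star_mtmul, star_one]

/-- The homomorphism `b ↦ 1 ⊗ b`. -/
def mtmulRight : B →⋆ₐ[ℂ] MinTensor A B where
  toFun b := mtmul 1 b
  map_one' := mtmul_one_one
  map_zero' := mtmul_zero 1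
  map_mul' b b' := by rw [mtmul_mul_mtmul, mul_one]
  map_add' b b' := by simp only [← mtmulLin_apply, map_add]
  commutes' c := by
    rw [Algebra.algebraMap_eq_smul_one, mtmul_smul, mtmul_one_one, Algebra.algebraMap_eq_smul_one]
  map_star' b := by rw [star_mtmul, star_one]

theorem mtmulLeft_apply (a : A) : mtmulLeft A B a = mtmul a 1 := rfl

theorem mtmulRight_apply (b : B) : mtmulRight A B b = mtmul 1 b := rfl

end MinTensorLemmas

/-! ### Matrices of generators -/

section UnitaryMatrices

variable {m B : Type} [Fintype m] [DecidableEq m] [CStarAlgebra B]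

theorem isUnitaryMatrix_iff {V : Matrix m m B} : IsUnitaryMatrix V ↔
    (∀ i j, ∑ k, V i k * star (V j k) = if i = j then 1 else 0) ∧
    (∀ i j, ∑ k, star (V k i) * V k j = if i = j then 1 else 0) := by
  simp only [IsUnitaryMatrix, ← Matrix.ext_iff, Matrix.mul_apply, Matrix.conjTranspose_apply,
    Matrix.one_apply]

theorem IsUnitaryMatrix.map {B' : Type} [CStarAlgebra B'] {V : Matrix m m B}
    (hV : IsUnitaryMatrix V) (f : B →⋆ₐ[ℂ] B') : IsUnitaryMatrix (V.map f) := by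
  rw [isUnitaryMatrix_iff] at hV ⊢
  simp only [Matrix.map_apply, ← map_star, ← map_mul, ← map_sum, hV.1, hV.2, apply_ite f,
    map_one, map_zero, implies_true, and_self]

theorem IsUnitaryMatrix.mul {V W : Matrix m m B} (hV : IsUnitaryMatrix V)
    (hW : IsUnitaryMatrix W) : IsUnitaryMatrix (V * W) := by
  constructor
  · rw [Matrix.conjTranspose_mul, Matrix.mul_assoc, ← Matrix.mul_assoc W, hW.1, Matrix.one_mul,
      hV.1]
  · rw [Matrix.conjTranspose_mul, Matrix.mul_assoc, ← Matrix.mul_assoc _ V, hV.2, Matrix.one_mul,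
      hW.2]

/-- The matrix with the entries `∑ k, v i k ⊗ v k j` is unitary if `v` is. -/
theorem IsUnitaryMatrix.comul {V : Matrix m m B} (hV : IsUnitaryMatrix V) :
    IsUnitaryMatrix (Matrix.of fun i j => ∑ k, mtmul (V i k) (V k j)) := by
  have h : (Matrix.of fun i j => ∑ k, mtmul (V i k) (V k j)) =
      V.map (mtmulLeft B B) * V.map (mtmulRight B B) := by
    ext i j
    rw [Matrix.mul_apply, Matrix.of_apply]
    refine Finset.sum_congr rfl fun k _ => ?_
    rw [Matrix.map_apply, Matrix.map_apply, mtmulLeft_apply, mtmulRight_apply, mtmul_mul_mtmul,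
      mul_one, one_mul]
  rw [h]
  exact (hV.map _).mul (hV.map _)

end UnitaryMatrices

/-- Projections that sum up to `1` are pairwise orthogonal. -/
theorem mul_eq_zero_of_sum_projections_eq_one {ι B : Type} [Fintype ι] [DecidableEq ι]
    [CStarAlgebra B] {p : ι → B} (hstar : ∀ i, star (p i) = p i) (hp : ∀ i, p i * p i = p i)
    (hsum : ∑ i, p i = 1) {i j : ι} (hij : i ≠ j) : p i * p j = 0 := by
  let _ : PartialOrder B := CStarAlgebra.spectralOrder B
  let _ : StarOrderedRing B := CStarAlgebra.spectralOrderedRing B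
  have hpos (k : ι) : star (p k * p j) * (p k * p j) = p j * p k * p j := by
    rw [star_mul, hstar, hstar, mul_assoc, ← mul_assoc (p k), hp, mul_assoc]
  have h1 : ∑ k, p j * p k * p j = p j := by
    rw [← Finset.sum_mul, ← Finset.mul_sum, hsum, mul_one, hp]
  have h2 : ∑ k ∈ Finset.univ.erase j, p j * p k * p j = 0 := by
    rw [← Finset.add_sum_erase _ _ (Finset.mem_univ j), hp, hp] at h1
    exact add_eq_left.mp h1
  have h3 := (Finset.sum_eq_zero_iff_of_nonneg fun k _ => by
    rw [← hpos]; exact star_mul_self_nonneg _).mp h2 i (by simp [hij])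
  rw [← hpos] at h3
  exact (CStarRing.star_mul_self_eq_zero_iff _).mp h3

section PartialIsometries

variable {n : ℕ} {B : Type} [CStarAlgebra B] {u : Matrix (Fin n) (Fin n) B}

/-- Distinct self-adjoint partial isometries in a row of a unitary matrix have product zero. -/
theorem row_mul_eq_zero (hs : ∀ i j, star (u i j) = u i j) (hu : IsUnitaryMatrix u)
    (hp : EntriesPartialIsometries u) (i : Fin n) {j k : Fin n} (hjk : j ≠ k) :
    u i j * u i k = 0 := by
  have hcube (j) : u i j * u i j * u i j = u i j := by simpa only [hs] using hp i j
  have hstar (j) : star (u i j * u i j) = u i j * u i j := by rw [star_mul, hs]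
  have hproj (j) : u i j * u i j * (u i j * u i j) = u i j * u i j := by rw [← mul_assoc, hcube]
  have h := mul_eq_zero_of_sum_projections_eq_one (p := fun j => u i j * u i j) hstar hproj
    (by simpa only [hs, if_true] using (isUnitaryMatrix_iff.mp hu).1 i i) hjk
  calc u i j * u i k = (u i j * u i j * u i j) * (u i k * u i k * u i k) := by
        rw [hcube, hcube]
    _ = u i j * ((u i j * u i j) * (u i k * u i k)) * u i k := by simp only [mul_assoc]
    _ = 0 := by rw [h, mul_zero, zero_mul]

theorem EntriesPartialIsometries.comul (hs : ∀ i j, star (u i j) = u i j)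
    (hu : IsUnitaryMatrix u) (hp : EntriesPartialIsometries u) :
    EntriesPartialIsometries (Matrix.of fun i j => ∑ k, mtmul (u i k) (u k j)) := by
  intro i j
  have hcube (i j) : u i j * u i j * u i j = u i j := by simpa only [hs] using hp i j
  have h0 (k l : Fin n) : mtmul (u i k) (u k j) * mtmul (u i l) (u l j) =
      if k = l then mtmul (u i k * u i k) (u k j * u k j) else 0 := by
    rw [mtmul_mul_mtmul]
    split_ifs with h
    · rw [h]
    · rw [row_mul_eq_zero hs hu hp i h, zero_mtmul]
  have h1 (k l : Fin n) : mtmul (u i k * u i k) (u k j * u k j) * mtmul (u i l) (u l j) =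
      if k = l then mtmul (u i k) (u k j) else 0 := by
    rw [mtmul_mul_mtmul]
    split_ifs with h
    · rw [← h, hcube, hcube]
    · rw [mul_assoc (u i k), row_mul_eq_zero hs hu hp i h, mul_zero, zero_mtmul]
  have h2 : star (∑ k, mtmul (u i k) (u k j)) = ∑ k, mtmul (u i k) (u k j) := by
    rw [star_sum]
    exact Finset.sum_congr rfl fun k _ => by rw [star_mtmul, hs, hs]
  simp only [Matrix.of_apply]
  rw [h2, Finset.sum_mul_sum]
  simp_rw [h0, Finset.sum_ite_eq, Finset.mem_univ, if_true]
  rw [Finset.sum_mul_sum]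
  simp_rw [h1, Finset.sum_ite_eq, Finset.mem_univ, if_true]

end PartialIsometries

/-! ### Relations that define quantum groups -/

/-- Relations that make the universal algebra a compact matrix quantum group with self-adjoint
entries: they are inherited by homomorphic images, by the canonical generators and by the
comultiplied matrix, and they contain the orthogonality relations. -/
structure Relations.IsQuantum {n : ℕ} (P : Relations (Fin n × Fin n)) : Prop where
  isOrthogonal : ∀ (B : Type) [CStarAlgebra B] (v : Fin n × Fin n → B), P B v → oRel n B v
  gen : ∀ hP : P.Bounded, P (UniversalCStar P hP) (UniversalCStar.gen P hP)
  map : ∀ (B B' : Type) [CStarAlgebra B] [CStarAlgebra B'] (f : B →⋆ₐ[ℂ] B')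
    (v : Fin n × Fin n → B), P B v → P B' (fun p => f (v p))
  comul : ∀ (B : Type) [CStarAlgebra B] (v : Fin n × Fin n → B), P B v →
    P (MinTensor B B) (fun p => ∑ k, mtmul (v (p.1, k)) (v (k, p.2)))

section RelationLemmas

variable {n : ℕ} {B : Type} [CStarAlgebra B] {v : Fin n × Fin n → B}

theorem oRel_iff : oRel n B v ↔ (∀ i j, star (v (i, j)) = v (i, j)) ∧
    IsUnitaryMatrix (toMatrix v) := by
  simp [oRel, ← Matrix.ext_iff, toMatrix]

theorem oRel.map {B' : Type} [CStarAlgebra B'] (f : B →⋆ₐ[ℂ] B') (h : oRel n B v) :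
    oRel n B' (fun p => f (v p)) := by
  rw [oRel_iff] at h ⊢
  exact ⟨fun i j => by rw [← map_star, h.1], h.2.map f⟩

theorem oRel.comul (h : oRel n B v) :
    oRel n (MinTensor B B) (fun p => ∑ k, mtmul (v (p.1, k)) (v (k, p.2))) := by
  rw [oRel_iff] at h ⊢
  refine ⟨fun i j => ?_, h.2.comul⟩
  simp only [star_sum, star_mtmul, h.1]

theorem oRel_gen {P : Relations (Fin n × Fin n)} (hP : P.Bounded)
    (h : ∀ (B : Type) [CStarAlgebra B] (v : Fin n × Fin n → B), P B v → oRel n B v) :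
    oRel n (UniversalCStar P hP) (UniversalCStar.gen P hP) := by
  let q := (universalSeminorm P hP).coeHom
  have key : ∀ x y : FreeStar (Fin n × Fin n),
      (∀ r : Realization P, FreeStar.eval r.fam x = FreeStar.eval r.fam y) → q x = q y :=
    fun _ _ h => UniversalCStar.coe_eq_coe _ _ h
  simp only [oRel_iff, isUnitaryMatrix_iff] at h ⊢
  refine ⟨fun i j => ?_, fun i j => ?_, fun i j => ?_⟩
  · change star (q (.gen (i, j))) = q (.gen (i, j))
    rw [← map_star]
    exact key _ _ fun r => by rw [map_star, FreeStar.eval_gen, (h _ _ r.rel).1]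
  · change ∑ k, q (.gen (i, k)) * star (q (.gen (j, k))) = _
    simp_rw [← map_star, ← map_mul, ← map_sum]
    have := key (∑ k, .gen (i, k) * star (.gen (j, k))) (if i = j then 1 else 0) fun r => by
      simp_rw [apply_ite (FreeStar.eval r.fam), map_sum, map_mul, map_star, FreeStar.eval_gen,
        map_one, map_zero]
      exact (h _ _ r.rel).2.1 i j
    rw [this, apply_ite q, map_one, map_zero]
  · change ∑ k, star (q (.gen (k, i))) * q (.gen (k, j)) = _
    simp_rw [← map_star, ← map_mul, ← map_sum]
    have := key (∑ k, star (.gen (k, i)) * .gen (k, j)) (if i = j then 1 else 0) fun r => by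
      simp_rw [apply_ite (FreeStar.eval r.fam), map_sum, map_mul, map_star, FreeStar.eval_gen,
        map_one, map_zero]
      exact (h _ _ r.rel).2.2 i j
    rw [this, apply_ite q, map_one, map_zero]

theorem EntriesPartialIsometries.map {B' : Type} [CStarAlgebra B'] (f : B →⋆ₐ[ℂ] B')
    (h : EntriesPartialIsometries (toMatrix v)) :
    EntriesPartialIsometries (toMatrix fun p => f (v p)) := by
  intro i j
  have := h i j
  simp only [toMatrix, Matrix.of_apply] at this ⊢
  rw [← map_star, ← map_mul, ← map_mul, this]

theorem oRel.comul_entriesPartialIsometries (h : oRel n B v)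
    (hp : EntriesPartialIsometries (toMatrix v)) :
    EntriesPartialIsometries (toMatrix fun p => ∑ k, mtmul (v (p.1, k)) (v (k, p.2))) :=
  fun i j => hp.comul (oRel_iff.mp h).1 h.2 i j

theorem entriesPartialIsometries_gen {P : Relations (Fin n × Fin n)} (hP : P.Bounded)
    (h : ∀ (B : Type) [CStarAlgebra B] (v : Fin n × Fin n → B), P B v →
      EntriesPartialIsometries (toMatrix v)) :
    EntriesPartialIsometries (toMatrix (UniversalCStar.gen P hP)) := by
  let q := (universalSeminorm P hP).coeHom
  intro i j
  change q (.gen (i, j)) * star (q (.gen (i, j))) * q (.gen (i, j)) = q (.gen (i, j))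
  simp_rw [← map_star, ← map_mul]
  refine UniversalCStar.coe_eq_coe _ _ fun r => ?_
  simp_rw [map_mul, map_star, FreeStar.eval_gen]
  exact h _ _ r.rel i j

theorem SumsTo.map {B' : Type} [CStarAlgebra B'] (f : B →⋆ₐ[ℂ] B') {z : B}
    (h : SumsTo (toMatrix v) z) : SumsTo (toMatrix fun p => f (v p)) (f z) := by
  simp only [SumsTo, toMatrix, Matrix.of_apply, ← map_sum] at h ⊢
  simp only [h.1, h.2, implies_true, and_self]

theorem SumsTo.comul {z : B} (h : SumsTo (toMatrix v) z) :
    SumsTo (toMatrix fun p => ∑ k, mtmul (v (p.1, k)) (v (k, p.2))) (mtmul z z) := by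
  simp only [SumsTo, toMatrix, Matrix.of_apply] at h ⊢
  constructor
  · intro i
    rw [Finset.sum_comm]
    simp_rw [← mtmul_sum, h.1, ← sum_mtmul, h.1]
  · intro j
    rw [Finset.sum_comm]
    simp_rw [← sum_mtmul, h.2, ← mtmul_sum, h.2]

theorem sumsTo_one_gen {P : Relations (Fin n × Fin n)} (hP : P.Bounded)
    (h : ∀ (B : Type) [CStarAlgebra B] (v : Fin n × Fin n → B), P B v →
      SumsTo (toMatrix v) 1) : SumsTo (toMatrix (UniversalCStar.gen P hP)) 1 := by
  let q := (universalSeminorm P hP).coeHom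
  constructor
  · intro i
    change ∑ j, q (.gen (i, j)) = 1
    rw [← map_sum, ← map_one q]
    refine UniversalCStar.coe_eq_coe _ _ fun r => ?_
    simp_rw [map_sum, map_one, FreeStar.eval_gen]
    exact (h _ _ r.rel).1 i
  · intro j
    change ∑ i, q (.gen (i, j)) = 1
    rw [← map_sum, ← map_one q]
    refine UniversalCStar.coe_eq_coe _ _ fun r => ?_
    simp_rw [map_sum, map_one, FreeStar.eval_gen]
    exact (h _ _ r.rel).2 j

/-- A common value of all row and column sums exists if and only if every row sum agrees with
every column sum. -/
theorem exists_sumsTo_iff {u : Matrix (Fin n) (Fin n) B} :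
    (∃ z, SumsTo u z) ↔ ∀ i j, ∑ k, u i k = ∑ k, u k j := by
  constructor
  · rintro ⟨z, h⟩ i j
    rw [h.1, h.2]
  · intro h
    rcases isEmpty_or_nonempty (Fin n) with _ | ⟨⟨i⟩⟩
    · exact ⟨0, fun i => isEmptyElim i, fun i => isEmptyElim i⟩
    · exact ⟨∑ k, u i k, fun j => (h j i).trans (h i i).symm, fun j => (h i j).symm⟩

theorem exists_sumsTo_gen {P : Relations (Fin n × Fin n)} (hP : P.Bounded)
    (h : ∀ (B : Type) [CStarAlgebra B] (v : Fin n × Fin n → B), P B v →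
      ∃ z, SumsTo (toMatrix v) z) : ∃ z, SumsTo (toMatrix (UniversalCStar.gen P hP)) z := by
  let q := (universalSeminorm P hP).coeHom
  simp only [exists_sumsTo_iff] at h ⊢
  intro i j
  change ∑ k, q (.gen (i, k)) = ∑ k, q (.gen (k, j))
  rw [← map_sum, ← map_sum]
  refine UniversalCStar.coe_eq_coe _ _ fun r => ?_
  simp_rw [map_sum, FreeStar.eval_gen]
  exact h _ _ r.rel i j

end RelationLemmas

theorem bPrimeRel_isQuantum (n : ℕ) : (bPrimeRel n).IsQuantum where
  isOrthogonal _ _ _ h := h.1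
  gen hP := ⟨oRel_gen hP fun _ _ _ h => h.1, exists_sumsTo_gen hP fun _ _ _ h => h.2⟩
  map _ _ _ _ f _ h := ⟨h.1.map f, h.2.imp' f fun _ hz => hz.map f⟩
  comul _ _ _ h := ⟨h.1.comul, h.2.imp' (fun z => mtmul z z) fun _ hz => hz.comul⟩

theorem bRel_isQuantum (n : ℕ) : (bRel n).IsQuantum where
  isOrthogonal _ _ _ h := h.1
  gen hP := ⟨oRel_gen hP fun _ _ _ h => h.1, sumsTo_one_gen hP fun _ _ _ h => h.2⟩
  map _ _ _ _ f _ h := ⟨h.1.map f, by simpa only [map_one] using h.2.map f⟩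
  comul _ _ _ h := ⟨h.1.comul, by simpa only [mtmul_one_one] using h.2.comul⟩

theorem sPrimeRel_isQuantum (n : ℕ) : (sPrimeRel n).IsQuantum where
  isOrthogonal _ _ _ h := h.1
  gen hP := ⟨oRel_gen hP fun _ _ _ h => h.1,
    entriesPartialIsometries_gen hP fun _ _ _ h => h.2.1,
    exists_sumsTo_gen hP fun _ _ _ h => h.2.2⟩
  map _ _ _ _ f _ h := ⟨h.1.map f, h.2.1.map f, h.2.2.imp' f fun _ hz => hz.map f⟩
  comul _ _ _ h := ⟨h.1.comul, h.1.comul_entriesPartialIsometries h.2.1,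
    h.2.2.imp' (fun z => mtmul z z) fun _ hz => hz.comul⟩

theorem sRel_isQuantum (n : ℕ) : (sRel n).IsQuantum where
  isOrthogonal _ _ _ h := h.1
  gen hP := ⟨oRel_gen hP fun _ _ _ h => h.1,
    entriesPartialIsometries_gen hP fun _ _ _ h => h.2.1,
    sumsTo_one_gen hP fun _ _ _ h => h.2.2⟩
  map _ _ _ _ f _ h := ⟨h.1.map f, h.2.1.map f, by simpa only [map_one] using h.2.2.map f⟩
  comul _ _ _ h := ⟨h.1.comul, h.1.comul_entriesPartialIsometries h.2.1,
    by simpa only [mtmul_one_one] using h.2.2.comul⟩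

/-- The compact matrix quantum group defined by relations on the entries of its fundamental
matrix. -/
def universalCMQG {n : ℕ} (P : Relations (Fin n × Fin n)) (hP : P.Bounded) (hQ : P.IsQuantum) :
    CMQG n where
  toMatrixPair := universalPair P hP
  unitary_U := (hQ.isOrthogonal _ _ (hQ.gen hP)).2
  generates := UniversalCStar.generatedBy_range_gen P hP
  comul := UniversalCStar.lift P hP _ (hQ.comul _ _ (hQ.gen hP))
  comul_U i j := UniversalCStar.lift_gen P hP _ (hQ.comul _ _ (hQ.gen hP)) (i, j)
  isUnit_conj := by
    have h := hQ.isOrthogonal _ _ (hQ.gen hP)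
    have h' : (universalPair P hP).U.map star = (universalPair P hP).U := h.1
    rw [h']
    exact ⟨⟨_, _, h.2.1, h.2.2⟩, rfl⟩

/-! ### The one-dimensional corepresentation given by the row sums -/

section ScalarMatrices

variable {A B : Type} [CStarAlgebra A] [CStarAlgebra B] {l m m' : Type}

theorem scalarMatrix_mul [Fintype m] (S : Matrix l m ℂ) (T : Matrix m m' ℂ) :
    scalarMatrix A (S * T) = scalarMatrix A S * scalarMatrix A T :=
  Matrix.map_mul

theorem scalarMatrix_one [DecidableEq m] :
    scalarMatrix A (1 : Matrix m m ℂ) = 1 := by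
  simp [scalarMatrix]

theorem scalarMatrix_conjTranspose (T : Matrix l m ℂ) :
    (scalarMatrix A T).conjTranspose = scalarMatrix A T.conjTranspose := by
  ext i j
  exact (algebraMap_star_comm _).symm

theorem scalarMatrix_map (f : A →⋆ₐ[ℂ] B) (T : Matrix l m ℂ) :
    (scalarMatrix A T).map f = scalarMatrix B T := by
  ext i j
  simp [scalarMatrix, AlgHomClass.commutes]

theorem map_mul_starAlgHom [Fintype m] (f : A →⋆ₐ[ℂ] B) (V : Matrix l m A) (W : Matrix m m' A) :
    (V * W).map f = V.map f * W.map f := by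
  ext i j
  simp [Matrix.mul_apply, map_sum, map_mul]

end ScalarMatrices

namespace CMQG

variable {n : ℕ} (G : CMQG n)

/-- The comultiplication formula for a matrix `V`, written as a product of the matrices with
entries `v_ij ⊗ 1` and `1 ⊗ v_ij`. -/
theorem comul_iff {m : Type} [Fintype m] (V : Matrix m m G.carrier) :
    (∀ i j, G.comul (V i j) = ∑ k, mtmul (V i k) (V k j)) ↔
      V.map G.comul = V.map (mtmulLeft _ _) * V.map (mtmulRight _ _) := by
  simp only [← Matrix.ext_iff, Matrix.mul_apply, Matrix.map_apply, mtmulLeft_apply,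
    mtmulRight_apply, mtmul_mul_mtmul, mul_one, one_mul]

theorem isCorep_conj_one {z : G.carrier} (h : G.IsCorep (Matrix.of fun _ _ : Fin 1 => z)) :
    G.IsCorep (Matrix.of fun _ _ : Fin 1 => star z) := by
  obtain ⟨h1, h2⟩ := h
  have h2' := h2 0 0
  simp only [Matrix.of_apply, Finset.univ_unique, Finset.sum_singleton] at h2'
  refine ⟨?_, fun i j => ?_⟩
  · rw [isUnitaryMatrix_iff] at h1 ⊢
    simp only [Matrix.of_apply, star_star] at h1 ⊢
    exact ⟨h1.2, h1.1⟩
  · simp only [Matrix.of_apply, Finset.univ_unique, Finset.sum_singleton]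
    rw [map_star, h2', star_mtmul]

theorem isCorep_one : G.IsCorep (1 : Matrix (Fin 1) (Fin 1) G.carrier) := by
  refine ⟨⟨by simp, by simp⟩, fun i j => ?_⟩
  rw [Subsingleton.elim i 0, Subsingleton.elim j 0]
  simp only [Matrix.one_apply_eq, map_one, Finset.univ_unique, Finset.sum_singleton]
  exact mtmul_one_one.symm

variable {G} {z : G.carrier}

/-- The common value of all row and column sums of a unitary matrix is unitary. -/
theorem unitary_of_sumsTo (hn : 1 ≤ n) (hz : SumsTo G.U z) : star z * z = 1 ∧ z * star z = 1 := by
  have hn0 : (n : ℂ) ≠ 0 := by exact_mod_cast (by omega : n ≠ 0)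
  have hU := isUnitaryMatrix_iff.mp G.unitary_U
  have cancel (x : G.carrier) (h : (n : ℂ) • x = (n : ℂ) • (1 : G.carrier)) : x = 1 := by
    rw [← inv_smul_smul₀ hn0 x, h, inv_smul_smul₀ hn0]
  constructor
  · apply cancel
    calc (n : ℂ) • (star z * z) = ∑ i : Fin n, star z * z := by
          simp [Nat.cast_smul_eq_nsmul]
      _ = ∑ i, (∑ j, star (G.U i j)) * ∑ k, G.U i k :=
          Finset.sum_congr rfl fun i _ => by rw [← star_sum, hz.1]
      _ = ∑ j, ∑ k, ∑ i, star (G.U i j) * G.U i k := by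
          simp_rw [Finset.sum_mul_sum]
          rw [Finset.sum_comm]
          exact Finset.sum_congr rfl fun j _ => Finset.sum_comm
      _ = (n : ℂ) • (1 : G.carrier) := by
          simp [hU.2, Nat.cast_smul_eq_nsmul]
  · apply cancel
    calc (n : ℂ) • (z * star z) = ∑ i : Fin n, z * star z := by
          simp [Nat.cast_smul_eq_nsmul]
      _ = ∑ j, (∑ i, G.U i j) * ∑ k, star (G.U k j) :=
          Finset.sum_congr rfl fun i _ => by rw [← star_sum, hz.2]
      _ = ∑ i, ∑ k, ∑ j, G.U i j * star (G.U k j) := by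
          simp_rw [Finset.sum_mul_sum]
          rw [Finset.sum_comm]
          exact Finset.sum_congr rfl fun j _ => Finset.sum_comm
      _ = (n : ℂ) • (1 : G.carrier) := by
          simp [hU.1, Nat.cast_smul_eq_nsmul]

theorem comul_of_sumsTo (hn : 1 ≤ n) (hz : SumsTo G.U z) : G.comul z = mtmul z z := by
  rw [← hz.1 ⟨0, hn⟩, map_sum]
  simp_rw [G.comul_U]
  rw [Finset.sum_comm]
  simp_rw [← mtmul_sum, hz.1, ← sum_mtmul, hz.1]

theorem isCorep_of_sumsTo (hn : 1 ≤ n) (hz : SumsTo G.U z) :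
    G.IsCorep (Matrix.of fun _ _ : Fin 1 => z) := by
  obtain ⟨h1, h2⟩ := unitary_of_sumsTo hn hz
  refine ⟨isUnitaryMatrix_iff.mpr ⟨fun i j => ?_, fun i j => ?_⟩, fun i j => ?_⟩
  · simp [h2, Subsingleton.elim i j]
  · simp [h1, Subsingleton.elim i j]
  · simp [comul_of_sumsTo hn hz]

/-- A unitary scalar matrix whose first row is constant: the coordinates with respect to an
orthonormal basis that contains a multiple of `(1, …, 1)`. -/
theorem exists_unitary_constant_row (d : ℕ) : ∃ T : Matrix (Fin 1 ⊕ Fin d) (Fin (d + 1)) ℂ,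
    T * T.conjTranspose = 1 ∧ T.conjTranspose * T = 1 ∧
      ∃ c : ℝ, ∀ i, T (Sum.inl 0) i = c := by
  let c : ℝ := (Real.sqrt (d + 1))⁻¹
  have hc : c * c * (d + 1) = 1 := by
    have : (0 : ℝ) < d + 1 := by positivity
    rw [← mul_inv, Real.mul_self_sqrt this.le, inv_mul_cancel₀ this.ne']
  let ξ : EuclideanSpace ℂ (Fin (d + 1)) := WithLp.toLp 2 fun _ => (c : ℂ)
  have hξ : inner ℂ ξ ξ = 1 := by
    rw [PiLp.inner_apply]
    simp only [ξ, RCLike.inner_apply, Complex.conj_ofReal, Finset.sum_const, Finset.card_univ,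
      Fintype.card_fin, nsmul_eq_mul]
    rw [← Complex.ofReal_mul, mul_comm]
    exact_mod_cast hc
  have hnorm : ‖ξ‖ = 1 := by
    rw [inner_self_eq_norm_sq_to_K] at hξ
    have h1 : ‖ξ‖ ^ 2 = 1 := Complex.ofReal_injective (by simpa using hξ)
    nlinarith [norm_nonneg ξ]
  obtain ⟨b, hb⟩ := Orthonormal.exists_orthonormalBasis_extension_of_card_eq (𝕜 := ℂ)
    (E := EuclideanSpace ℂ (Fin (d + 1))) (ι := Fin 1 ⊕ Fin d) (by simp [add_comm])
    (v := fun _ => ξ) (s := {Sum.inl 0}) (by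
      rw [orthonormal_iff_ite]
      rintro ⟨x, hx⟩ ⟨y, hy⟩
      rw [Set.mem_singleton_iff] at hx hy
      subst hx hy
      simpa using hξ)
  let T : Matrix (Fin 1 ⊕ Fin d) (Fin (d + 1)) ℂ := Matrix.of fun a i => star (b a i)
  have hT : T * T.conjTranspose = 1 := by
    ext x y
    have h := orthonormal_iff_ite.mp b.orthonormal x y
    rw [PiLp.inner_apply] at h
    simp only [RCLike.inner_apply] at h
    rw [Matrix.mul_apply, Matrix.one_apply, ← h]
    refine Finset.sum_congr rfl fun i _ => ?_
    simp [T, mul_comm]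
  refine ⟨T, hT, (Matrix.mul_eq_one_comm_of_card_eq _ _ _ (by simp [add_comm])).mp hT,
    c, fun i => ?_⟩
  simp only [T, Matrix.of_apply, hb _ (Set.mem_singleton _)]
  simp [ξ]

/-- The row sums of the fundamental matrix form a direct summand: in an orthonormal basis that
contains a multiple of `(1, …, 1)` the fundamental matrix is block diagonal. -/
theorem contains_of_sumsTo (hn : 1 ≤ n) (hz : SumsTo G.U z) :
    G.Contains G.U (Matrix.of fun _ _ : Fin 1 => z) := by
  obtain ⟨d, rfl⟩ : ∃ d, n = d + 1 := ⟨n - 1, by omega⟩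
  obtain ⟨T, hT, hT', c, hc⟩ := exists_unitary_constant_row d
  let t := scalarMatrix G.carrier T
  let t' := scalarMatrix G.carrier T.conjTranspose
  have htt' : t * t' = 1 := by rw [← scalarMatrix_mul, hT, scalarMatrix_one]
  have ht't : t' * t = 1 := by rw [← scalarMatrix_mul, hT', scalarMatrix_one]
  have hstar : t.conjTranspose = t' := scalarMatrix_conjTranspose T
  have hstar' : t'.conjTranspose = t := by rw [← hstar, Matrix.conjTranspose_conjTranspose]
  let V := t * G.U * t'
  have hVu : IsUnitaryMatrix V := by
    constructor
    · simp only [V, Matrix.conjTranspose_mul, hstar, hstar']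
      calc t * G.U * t' * (t * (G.U.conjTranspose * t'))
          = t * G.U * (t' * t) * (G.U.conjTranspose * t') := by simp only [Matrix.mul_assoc]
        _ = t * (G.U * G.U.conjTranspose) * t' := by
          rw [ht't, Matrix.mul_one]; simp only [Matrix.mul_assoc]
        _ = 1 := by rw [G.unitary_U.1, Matrix.mul_one, htt']
    · simp only [V, Matrix.conjTranspose_mul, hstar, hstar']
      calc t * (G.U.conjTranspose * t') * (t * G.U * t')
          = t * G.U.conjTranspose * (t' * t) * (G.U * t') := by simp only [Matrix.mul_assoc]
        _ = t * (G.U.conjTranspose * G.U) * t' := by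
          rw [ht't, Matrix.mul_one]; simp only [Matrix.mul_assoc]
        _ = 1 := by rw [G.unitary_U.2, Matrix.mul_one, htt']
  have hVΔ : V.map G.comul = V.map (mtmulLeft _ _) * V.map (mtmulRight _ _) := by
    have hU := (G.comul_iff G.U).mp G.comul_U
    simp only [V, t, t', map_mul_starAlgHom, scalarMatrix_map, hU, Matrix.mul_assoc]
    rw [← Matrix.mul_assoc (scalarMatrix _ T.conjTranspose) (scalarMatrix _ T), ← scalarMatrix_mul,
      hT', scalarMatrix_one, Matrix.one_mul]
  rw [← comul_iff] at hVΔ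
  have hrow (j) : (t * G.U) (Sum.inl 0) j = (c : ℂ) • z := by
    rw [Matrix.mul_apply, ← hz.2 j, Finset.smul_sum]
    simp [t, scalarMatrix, hc, Algebra.smul_def]
  have hcol (i) : (G.U * t') i (Sum.inl 0) = (c : ℂ) • z := by
    rw [Matrix.mul_apply, ← hz.1 i, Finset.smul_sum]
    refine Finset.sum_congr rfl fun k _ => ?_
    simp [t', scalarMatrix, hc, Algebra.smul_def, Algebra.commutes]
  have hVrow (b) : V (Sum.inl 0) b = if Sum.inl 0 = b then z else 0 := by
    have h : V (Sum.inl 0) b = z * (t * t') (Sum.inl 0) b := by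
      simp only [V]
      rw [Matrix.mul_apply, Matrix.mul_apply, Finset.mul_sum]
      refine Finset.sum_congr rfl fun k _ => ?_
      rw [hrow, ← mul_assoc]
      simp [t, scalarMatrix, hc, Algebra.smul_def, Algebra.commutes]
    rw [h, htt', Matrix.one_apply, mul_ite, mul_one, mul_zero]
  have hVcol (a) : V a (Sum.inl 0) = if a = Sum.inl 0 then z else 0 := by
    have h : V a (Sum.inl 0) = (t * t') a (Sum.inl 0) * z := by
      simp only [V]
      rw [Matrix.mul_assoc, Matrix.mul_apply, Matrix.mul_apply, Finset.sum_mul]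
      refine Finset.sum_congr rfl fun k _ => ?_
      rw [hcol, mul_assoc]
      simp [t', scalarMatrix, hc, Algebra.smul_def]
    rw [h, htt', Matrix.one_apply, ite_mul, one_mul, zero_mul]
  have hblock : V = directSum (Matrix.of fun _ _ : Fin 1 => z) V.toBlocks₂₂ := by
    rw [directSum, ← Matrix.fromBlocks_toBlocks V]
    congr 1
    · ext i j
      rw [Subsingleton.elim i 0, Subsingleton.elim j 0]
      simp [Matrix.toBlocks₁₁, hVrow]
    · ext i j
      rw [Subsingleton.elim i 0]
      simp [Matrix.toBlocks₁₂, hVrow]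
    · ext i j
      rw [Subsingleton.elim j 0]
      simp [Matrix.toBlocks₂₁, hVcol]
  refine ⟨d, V.toBlocks₂₂, ⟨?_, ?_⟩, T, ?_, T.conjTranspose, hT', hT⟩
  · rw [isUnitaryMatrix_iff] at hVu ⊢
    constructor
    · intro i j
      have h := hVu.1 (Sum.inr i) (Sum.inr j)
      simpa [Fintype.sum_sum_type, hVcol, Matrix.toBlocks₂₂] using h
    · intro i j
      have h := hVu.2 (Sum.inr i) (Sum.inr j)
      simpa [Fintype.sum_sum_type, hVrow, Matrix.toBlocks₂₂] using h
  · intro i j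
    have h := hVΔ (Sum.inr i) (Sum.inr j)
    simpa [Fintype.sum_sum_type, hVcol, Matrix.toBlocks₂₂, zero_mtmul] using h
  · rw [← hblock]
    change t * G.U = t * G.U * t' * t
    rw [Matrix.mul_assoc _ t', ht't, Matrix.mul_one]

/-- A one-dimensional corepresentation that is equivalent to the trivial one is equal to it: scalars
commute with everything. -/
theorem eq_one_of_equivalent_one {A : Type} [CStarAlgebra A] {z : A}
    (h : Equivalent (Matrix.of fun _ _ : Fin 1 => z) (1 : Matrix (Fin 1) (Fin 1) A)) : z = 1 := by
  obtain ⟨T, hT, S, hST, -⟩ := h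
  have hT' : scalarMatrix A T * (Matrix.of fun _ _ : Fin 1 => z) = 1 * scalarMatrix A T := hT
  have h := congrArg (scalarMatrix A S * ·) hT'
  simp only [← Matrix.mul_assoc, Matrix.mul_one] at h
  rw [← scalarMatrix_mul, hST, scalarMatrix_one, Matrix.one_mul] at h
  have := congrFun (congrFun h 0) 0
  simpa using this

theorem equivalent_refl {A : Type} [CStarAlgebra A] {m : Type} [Fintype m] [DecidableEq m]
    (V : Matrix m m A) : Equivalent V V :=
  ⟨1, by change _ * _ = _ * _; rw [scalarMatrix_one, Matrix.one_mul, Matrix.mul_one], 1, by simp,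
    by simp⟩

/-- Equality up to the bijection of one-point index sets is an equivalence. -/
theorem equivalent_of_entry {A : Type} [CStarAlgebra A] {m m' : Type} [Fintype m] [DecidableEq m]
    [Subsingleton m] [Fintype m'] [DecidableEq m'] [Subsingleton m'] {V : Matrix m m A}
    {W : Matrix m' m' A} (i : m) (j : m') (h : V i i = W j j) : Equivalent V W := by
  refine ⟨Matrix.of fun _ _ => 1, ?_, Matrix.of fun _ _ => 1, ?_, ?_⟩
  · change _ * _ = _ * _
    ext j' i'
    rw [Subsingleton.elim i' i, Subsingleton.elim j' j, Matrix.mul_apply, Matrix.mul_apply,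
      Fintype.sum_subsingleton _ i, Fintype.sum_subsingleton _ j]
    simp [scalarMatrix, h]
  · ext i' j'
    rw [Subsingleton.elim i' j', Matrix.mul_apply, Fintype.sum_subsingleton _ j]
    simp
  · ext i' j'
    rw [Subsingleton.elim i' j', Matrix.mul_apply, Fintype.sum_subsingleton _ i]
    simp

end CMQG

/-! ### Free complexifications -/

/-- `C(S¹)` is generated by the identity function, by the Stone–Weierstrass theorem. -/
theorem generatedBy_circleId : generatedBy {circleId} = ⊤ := by
  refine ContinuousMap.starSubalgebra_topologicalClosure_eq_top_of_separatesPoints _ ?_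
  intro x y hxy
  exact ⟨circleId, ⟨circleId, StarAlgebra.subset_adjoin ℂ _ rfl, rfl⟩,
    fun h => hxy (Circle.ext h)⟩

theorem star_circleId_mul : star circleId * circleId = 1 := by
  ext z
  change (starRingEnd ℂ) (z : ℂ) * (z : ℂ) = 1
  rw [mul_comm, Complex.mul_conj, Circle.normSq_coe, Complex.ofReal_one]

theorem circleId_mul_star : circleId * star circleId = 1 := by
  rw [mul_comm, star_circleId_mul]

/-- The homomorphism `C(S¹) → B` that maps the identity function to a given unitary, given by
the continuous functional calculus. -/
theorem exists_circle_hom {B : Type} [CStarAlgebra B] {v : B} (h1 : star v * v = 1)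
    (h2 : v * star v = 1) : ∃ ψ : C(Circle, ℂ) →⋆ₐ[ℂ] B, ψ circleId = v := by
  have hv : v ∈ unitary B := Unitary.mem_iff.mpr ⟨h1, h2⟩
  have hn : IsStarNormal v := ⟨by rw [Commute, SemiconjBy, h1, h2]⟩
  let f : C(spectrum ℂ v, Circle) :=
    ⟨fun z => ⟨z, by
        have := spectrum.subset_circle_of_unitary hv z.2
        simpa [Submonoid.unitSphere] using this⟩,
      by fun_prop⟩
  refine ⟨(cfcHom hn).comp (ContinuousMap.compStarAlgHom' ℂ ℂ f), ?_⟩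
  have : ContinuousMap.compStarAlgHom' ℂ ℂ f circleId =
      (ContinuousMap.id ℂ).restrict (spectrum ℂ v) := by
    ext z
    rfl
  rw [StarAlgHom.comp_apply, this, cfcHom_id]

section Complexification

variable {n : ℕ} (G : MatrixPair n)

theorem sum_row_complexEntries (hs : SumsTo G.U 1) (i : Fin n) :
    ∑ j, FreeProduct.inl (G.U i j) * FreeProduct.inr circleId =
      (FreeProduct.inr circleId : FreeProduct G.carrier C(Circle, ℂ)) := by
  rw [← Finset.sum_mul]
  simp_rw [← FreeProduct.inlHom_apply]
  rw [← map_sum, hs.1, map_one, one_mul]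

theorem sum_column_complexEntries (hs : SumsTo G.U 1) (j : Fin n) :
    ∑ i, FreeProduct.inl (G.U i j) * FreeProduct.inr circleId =
      (FreeProduct.inr circleId : FreeProduct G.carrier C(Circle, ℂ)) := by
  rw [← Finset.sum_mul]
  simp_rw [← FreeProduct.inlHom_apply]
  rw [← map_sum, hs.2, map_one, one_mul]

theorem inr_circleId_mul_star {A : Type} [CStarAlgebra A] :
    (FreeProduct.inr circleId : FreeProduct A C(Circle, ℂ)) *
      star (FreeProduct.inr circleId) = 1 := by
  rw [← FreeProduct.inrHom_apply, ← map_star, ← map_mul, circleId_mul_star, map_one]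

theorem star_inr_circleId_mul {A : Type} [CStarAlgebra A] :
    star (FreeProduct.inr circleId : FreeProduct A C(Circle, ℂ)) *
      FreeProduct.inr circleId = 1 := by
  rw [← FreeProduct.inrHom_apply, ← map_star, ← map_mul, star_circleId_mul, map_one]

theorem generatedBy_inl_inr {A B : Type} [CStarAlgebra A] [CStarAlgebra B]
    {S : StarSubalgebra ℂ (FreeProduct A B)} (hS : IsClosed (S : Set (FreeProduct A B)))
    (h1 : ∀ a, FreeProduct.inl a ∈ S) (h2 : ∀ b, FreeProduct.inr b ∈ S) : S = ⊤ := by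
  rw [eq_top_iff, ← UniversalCStar.generatedBy_range_gen]
  refine generatedBy_le hS ?_
  rintro _ ⟨a | b, rfl⟩
  exacts [h1 a, h2 b]

/-- If the entries of a generating matrix sum up to `1` in each row, then the free complexification
is the whole free product with `C(S¹)`: the row sums of its entries `u_ij z` are the unitary
`z`. -/
theorem generatedBy_complexEntries (hn : 1 ≤ n) (hs : SumsTo G.U 1)
    (hgen : generatedBy (Set.range fun p : Fin n × Fin n => G.U p.1 p.2) = ⊤) :
    generatedBy (complexEntries G) = ⊤ := by
  have hcl := isClosed_generatedBy (complexEntries G)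
  have hmem (i j) : FreeProduct.inl (G.U i j) * FreeProduct.inr circleId ∈
      generatedBy (complexEntries G) := subset_generatedBy _ ⟨(i, j), rfl⟩
  have hw : FreeProduct.inr circleId ∈ generatedBy (complexEntries G) := by
    rw [← sum_row_complexEntries G hs ⟨0, hn⟩]
    exact sum_mem fun j _ => hmem _ j
  refine generatedBy_inl_inr hcl (fun a => ?_) (fun b => ?_)
  · refine map_mem_of_mem_generatedBy (FreeProduct.inlHom _ _) hcl ?_
      (hgen ▸ StarSubalgebra.mem_top : a ∈ generatedBy _)
    rintro _ ⟨⟨i, j⟩, rfl⟩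
    have := mul_mem (hmem i j) (star_mem hw)
    rw [mul_assoc, inr_circleId_mul_star, mul_one] at this
    exact this
  · refine map_mem_of_mem_generatedBy (FreeProduct.inrHom _ _) hcl ?_
      (generatedBy_circleId ▸ StarSubalgebra.mem_top : b ∈ generatedBy _)
    rintro _ rfl
    exact hw

/-- All rows and columns of the fundamental matrix of a free complexification sum up to `id_{S¹}`,
if those of the original matrix sum up to `1`. -/
theorem exists_sumsTo_freeComplexification (hn : 1 ≤ n) (hs : SumsTo G.U 1) :
    ∃ z : generatedBy (complexEntries G), (z : FreeProduct G.carrier C(Circle, ℂ)) =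
      FreeProduct.inr circleId ∧ SumsTo (freeComplexification G).U z := by
  have hrow := sum_row_complexEntries G hs
  have hcol := sum_column_complexEntries G hs
  have hmem : FreeProduct.inr circleId ∈ generatedBy (complexEntries G) := by
    rw [← hrow ⟨0, hn⟩]
    exact sum_mem fun j _ => subset_generatedBy _ ⟨(_, j), rfl⟩
  refine ⟨⟨_, hmem⟩, rfl, fun i => Subtype.ext ?_, fun j => Subtype.ext ?_⟩
  · exact (map_sum (generatedBy (complexEntries G)).subtype _ _).trans (hrow i)
  · exact (map_sum (generatedBy (complexEntries G)).subtype _ _).trans (hcol j)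

end Complexification

section TwistedMatrices

variable {m B : Type} [Fintype m] [DecidableEq m] [CStarAlgebra B] {V : Matrix m m B} {w : B}

theorem IsUnitaryMatrix.map_mul_right (hV : IsUnitaryMatrix V) (hw1 : star w * w = 1)
    (hw2 : w * star w = 1) : IsUnitaryMatrix (V.map fun x => x * w) := by
  rw [isUnitaryMatrix_iff] at hV ⊢
  constructor
  · intro i j
    rw [← hV.1]
    refine Finset.sum_congr rfl fun k _ => ?_
    rw [Matrix.map_apply, Matrix.map_apply, star_mul, mul_assoc, ← mul_assoc w, hw2, one_mul]
  · intro i j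
    calc ∑ k, star (V.map (fun x => x * w) k i) * V.map (fun x => x * w) k j
        = star w * (∑ k, star (V k i) * V k j) * w := by
          rw [Finset.mul_sum, Finset.sum_mul]
          refine Finset.sum_congr rfl fun k _ => ?_
          rw [Matrix.map_apply, Matrix.map_apply, star_mul]
          simp only [mul_assoc]
      _ = if i = j then 1 else 0 := by
          rw [hV.2]
          split_ifs
          · rw [mul_one, hw1]
          · rw [mul_zero, zero_mul]

/-- The matrix with entries `(v_ij w)* = w* v_ij` has the inverse with entries `v_ji w`. -/
theorem isUnit_map_star_map_mul_right (hs : ∀ i j, star (V i j) = V i j) (hV : IsUnitaryMatrix V)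
    (hw1 : star w * w = 1) (hw2 : w * star w = 1) :
    IsUnit ((V.map fun x => x * w).map star) := by
  rw [isUnitaryMatrix_iff] at hV
  have h1 : (V.map fun x => x * w).map star * (V.map fun x => x * w).transpose = 1 := by
    ext i j
    rw [Matrix.mul_apply, Matrix.one_apply]
    calc ∑ k, (V.map fun x => x * w).map star i k * (V.map fun x => x * w).transpose k j
        = star w * (∑ k, V i k * star (V j k)) * w := by
          rw [Finset.mul_sum, Finset.sum_mul]
          refine Finset.sum_congr rfl fun k _ => ?_
          rw [Matrix.map_apply, Matrix.transpose_apply, Matrix.map_apply, Matrix.map_apply,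
            star_mul, hs, hs]
          simp only [mul_assoc]
      _ = if i = j then 1 else 0 := by
          rw [hV.1]
          split_ifs
          · rw [mul_one, hw1]
          · rw [mul_zero, zero_mul]
  have h2 : (V.map fun x => x * w).transpose * (V.map fun x => x * w).map star = 1 := by
    ext i j
    rw [Matrix.mul_apply, Matrix.one_apply, ← hV.2]
    refine Finset.sum_congr rfl fun k _ => ?_
    rw [Matrix.map_apply, Matrix.transpose_apply, Matrix.map_apply, Matrix.map_apply, star_mul,
      mul_assoc, ← mul_assoc w, hw2, one_mul, hs, hs]
  exact ⟨⟨_, _, h1, h2⟩, rfl⟩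

end TwistedMatrices

/-- The comultiplication of the free complexification, with values in the tensor square of an
algebra that contains the coefficients `κ (u_ij)` and the unitary `w` that stands for
`id_{S¹}`. -/
theorem exists_twisted_comul {n : ℕ} {G : MatrixPair n} {B : Type} [CStarAlgebra B]
    (κ : G.carrier →⋆ₐ[ℂ] B) {w : B} (hw1 : star w * w = 1) (hw2 : w * star w = 1)
    (hcomul : ∃ Δ : G.carrier →⋆ₐ[ℂ] MinTensor B B,
      ∀ i j, Δ (G.U i j) = ∑ k, mtmul (κ (G.U i k)) (κ (G.U k j))) :
    ∃ Δ : FreeProduct G.carrier C(Circle, ℂ) →⋆ₐ[ℂ] MinTensor B B,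
      ∀ i j, Δ (FreeProduct.inl (G.U i j) * FreeProduct.inr circleId) =
        ∑ k, mtmul (κ (G.U i k) * w) (κ (G.U k j) * w) := by
  obtain ⟨Δ₁, hΔ₁⟩ := hcomul
  obtain ⟨Δ₂, hΔ₂⟩ := exists_circle_hom (v := mtmul w w)
    (by rw [star_mtmul, mtmul_mul_mtmul, hw1, mtmul_one_one])
    (by rw [star_mtmul, mtmul_mul_mtmul, hw2, mtmul_one_one])
  refine ⟨FreeProduct.lift Δ₁ Δ₂, fun i j => ?_⟩
  rw [map_mul, FreeProduct.lift_inl, FreeProduct.lift_inr, hΔ₁, hΔ₂, Finset.sum_mul]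
  exact Finset.sum_congr rfl fun k _ => by rw [mtmul_mul_mtmul]

/-- The free complexification of a quantum group with self-adjoint coefficients and row sums `1` is
a compact matrix quantum group. It is the whole free product, so that its comultiplication can be
defined on the two factors; the hypothesis `hcomul` provides the values on the first factor in the
tensor square of the larger algebra. -/
theorem exists_complexCMQG {n : ℕ} (G : MatrixPair n) (hn : 1 ≤ n)
    (hstar : ∀ i j, star (G.U i j) = G.U i j) (hU : IsUnitaryMatrix G.U) (hs : SumsTo G.U 1)
    (hgen : generatedBy (Set.range fun p : Fin n × Fin n => G.U p.1 p.2) = ⊤)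
    (hcomul : ∀ (B : Type) [CStarAlgebra B] (f : G.carrier →⋆ₐ[ℂ] B),
      ∃ Δ : G.carrier →⋆ₐ[ℂ] MinTensor B B,
        ∀ i j, Δ (G.U i j) = ∑ k, mtmul (f (G.U i k)) (f (G.U k j))) :
    ∃ G' : CMQG n, G'.toMatrixPair = freeComplexification G := by
  have htop : generatedBy (complexEntries G) = ⊤ := generatedBy_complexEntries G hn hs hgen
  obtain ⟨ι, hι⟩ : ∃ ι : FreeProduct G.carrier C(Circle, ℂ) →⋆ₐ[ℂ] generatedBy (complexEntries G),
      ∀ x, (ι x : FreeProduct G.carrier C(Circle, ℂ)) = x :=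
    ⟨(StarAlgHom.id ℂ _).codRestrict _ fun x => htop ▸ StarSubalgebra.mem_top, fun _ => rfl⟩
  obtain ⟨w, hw⟩ : ∃ w, w = ι (FreeProduct.inr circleId) := ⟨_, rfl⟩
  have hw1 : star w * w = 1 := by
    rw [hw, ← map_star, ← map_mul, star_inr_circleId_mul, map_one]
  have hw2 : w * star w = 1 := by
    rw [hw, ← map_star, ← map_mul, inr_circleId_mul_star, map_one]
  obtain ⟨κ, hκ⟩ : ∃ κ : G.carrier →⋆ₐ[ℂ] generatedBy (complexEntries G),
      ∀ a, κ a = ι (FreeProduct.inl a) := ⟨ι.comp (FreeProduct.inlHom _ _), fun _ => rfl⟩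
  have hW : (freeComplexification G).U = (G.U.map κ).map fun x => x * w := by
    ext i j
    refine Subtype.ext ?_
    change FreeProduct.inl (G.U i j) * FreeProduct.inr circleId =
      (κ (G.U i j) * w : generatedBy _).1
    rw [hκ, hw, ← map_mul, hι]
  obtain ⟨Δ, hΔ⟩ := exists_twisted_comul κ hw1 hw2 (hcomul _ κ)
  have hgen' : generatedBy (Set.range fun p : Fin n × Fin n => (freeComplexification G).U p.1 p.2)
      = ⊤ := by
    have h' : (Set.range fun p : Fin n × Fin n => (freeComplexification G).U p.1 p.2) =
        {x : generatedBy (complexEntries G) |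
          (x : FreeProduct G.carrier C(Circle, ℂ)) ∈ complexEntries G} := by
      ext x
      constructor
      · rintro ⟨p, rfl⟩
        exact ⟨p, rfl⟩
      · rintro ⟨p, hp⟩
        exact ⟨p, Subtype.ext hp⟩
    exact (congrArg generatedBy h').trans (generatedBy_preimage_eq_top (complexEntries G))
  exact ⟨{ toMatrixPair := freeComplexification G
           unitary_U := hW ▸ (hU.map κ).map_mul_right hw1 hw2
           generates := hgen'
           comul := Δ.comp (generatedBy (complexEntries G)).subtype
           comul_U := fun i j => by
             rw [hW]
             exact (congrArg _ (congrArg Subtype.val (congrFun (congrFun hW.symm i) j))).trans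
               (hΔ i j)
           isUnit_conj := hW ▸ isUnit_map_star_map_mul_right
             (fun i j => (map_star κ (G.U i j)).symm.trans (congrArg κ (hstar i j)))
             (hU.map κ) hw1 hw2 }, rfl⟩

/-- The free complexification of the quantum group defined by relations that imply that all rows
and columns sum up to `1`. -/
theorem exists_complexCMQG_universalPair {n : ℕ} (hn : 1 ≤ n) (P : Relations (Fin n × Fin n))
    (hP : P.Bounded) (hQ : P.IsQuantum)
    (hs : ∀ (B : Type) [CStarAlgebra B] (v : Fin n × Fin n → B), P B v → SumsTo (toMatrix v) 1) :
    ∃ G' : CMQG n, G'.toMatrixPair = freeComplexification (universalPair P hP) :=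
  exists_complexCMQG (universalPair P hP) hn (oRel_iff.mp (hQ.isOrthogonal _ _ (hQ.gen hP))).1
    (hQ.isOrthogonal _ _ (hQ.gen hP)).2 (hs _ _ (hQ.gen hP))
    (UniversalCStar.generatedBy_range_gen P hP)
    fun _ _ f => ⟨UniversalCStar.lift P hP _ (hQ.comul _ _ (hQ.map _ _ f _ (hQ.gen hP))),
      fun i j => UniversalCStar.lift_gen P hP _ (hQ.comul _ _ (hQ.map _ _ f _ (hQ.gen hP))) (i, j)⟩

/-! ### Invertible elements of free fusion rings -/

namespace FusionSet

variable (F : FusionSet)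

/-- The coefficient of a word, as a homomorphism. -/
def coeff (w : List F.S) : F.ZM →+ ℤ := Finsupp.applyAddHom w

variable {F}

theorem coeff_basis (v w : List F.S) [Decidable (w = v)] :
    F.coeff v (F.basis w) = if w = v then 1 else 0 := by
  classical
  change Finsupp.single w (1 : ℤ) v = _
  rw [Finsupp.single_apply]

theorem barWord_barWord (w : List F.S) : F.barWord (F.barWord w) = w := by
  simp [barWord, Function.comp_def, F.bar_bar]

theorem barWord_injective : Function.Injective F.barWord :=
  Function.LeftInverse.injective barWord_barWord

theorem ne_nil_of_mem_fuseWord {x z v : List F.S} (h : F.fuseWord x z = some v) : v ≠ [] := by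
  simp only [fuseWord, Option.bind_eq_some_iff, Option.map_eq_some_iff] at h
  obtain ⟨s, -, t, -, r, -, rfl⟩ := h
  simp

theorem coeff_elim_nonneg (o : Option (List F.S)) (v : List F.S) :
    0 ≤ F.coeff v (o.elim 0 F.basis) := by
  classical
  cases o with
  | none => simp
  | some w =>
    rw [Option.elim_some, coeff_basis]
    split_ifs <;> simp

/-- The product of `a_w` and `a_w'` contains the unit if and only if `w'` is conjugate to `w`. -/
theorem coeff_nil_mulWord (w w' : List F.S) [Decidable (F.barWord w = w')] :
    F.coeff [] (F.mulWord w w') = if F.barWord w = w' then 1 else 0 := by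
  classical
  have hf (k : ℕ) : F.coeff []
      ((F.fuseWord (w.take k) (w'.drop (w.length - k))).elim 0 F.basis) = 0 := by
    cases h : F.fuseWord (w.take k) (w'.drop (w.length - k)) with
    | none => simp
    | some v => rw [Option.elim_some, coeff_basis, if_neg (ne_nil_of_mem_fuseWord h)]
  have hf0 : F.coeff [] ((F.fuseWord [] (w'.drop w.length)).elim 0 F.basis) = 0 := hf 0
  rw [mulWord, map_sum, Finset.sum_eq_single 0]
  · simp only [apply_ite (F.coeff []), map_add, hf0, coeff_basis, map_zero, List.drop_zero,
      List.take_zero, List.nil_append, Nat.sub_zero, add_zero, List.drop_eq_nil_iff]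
    by_cases h : F.barWord w = w'
    · have hl : w'.length ≤ w.length := by simp [← h, barWord]
      rw [if_pos (h ▸ List.prefix_refl _), if_pos hl, if_pos h]
    · rw [if_neg h]
      split_ifs with h1 h2
      · exact absurd (h1.eq_of_length_le (by simpa [barWord] using h2)) h
      · rfl
      · rfl
  · intro k hk hk0
    have hne : w.take k ++ w'.drop (w.length - k) ≠ [] := by
      intro h
      rw [List.append_eq_nil_iff, List.take_eq_nil_iff] at h
      rcases h.1 with h | h
      · exact hk0 h
      · subst h
        simp at hk
        exact hk0 hk
    split_ifs
    · rw [map_add, hf, coeff_basis, if_neg hne, add_zero]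
    · exact map_zero _
  · simp

/-- The product of `a_w` and `a_w'` contains the class of the concatenation of `w` and `w'`. -/
theorem one_le_coeff_append_mulWord (w w' : List F.S) :
    1 ≤ F.coeff (w ++ w') (F.mulWord w w') := by
  classical
  rw [mulWord, map_sum]
  have hmem : w.length ∈ Finset.range (w.length + 1) := by simp
  refine le_trans ?_ (Finset.single_le_sum (fun k _ => ?_) hmem)
  · rw [if_pos (by simp [barWord]), map_add]
    have h := coeff_elim_nonneg (F := F) (F.fuseWord (w.take w.length)
      (w'.drop (w.length - w.length))) (w ++ w')
    simp only [List.take_length, Nat.sub_self, List.drop_zero, coeff_basis, if_true] at h ⊢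
    linarith
  · split_ifs
    · rw [map_add]
      refine add_nonneg ?_ (coeff_elim_nonneg _ _)
      rw [coeff_basis]
      split_ifs <;> simp
    · simp

/-- `mulWord w []` has only the summand `w`. -/
theorem mulWord_nil (w : List F.S) : F.mulWord w [] = F.basis w := by
  rw [mulWord, Finset.sum_eq_single w.length]
  · simp [barWord, fuseWord]
  · intro k hk hkl
    rw [if_neg]
    rw [List.prefix_nil, barWord, List.reverse_eq_nil_iff, List.map_eq_nil_iff,
      List.drop_eq_nil_iff]
    simp at hk
    omega
  · simp

theorem mul_def (a b : F.ZM) : a * b = Finsupp.sum (show List F.S →₀ ℤ from a) fun w c =>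
    Finsupp.sum (show List F.S →₀ ℤ from b) fun w' d => (c * d) • F.mulWord w w' := rfl

theorem mul_one_ZM (a : F.ZM) : a * 1 = a := by
  rw [mul_def]
  have h : ∀ (w : List F.S) (c : ℤ), Finsupp.sum (show List F.S →₀ ℤ from (1 : F.ZM))
      (fun w' d => (c * d) • F.mulWord w w') = (Finsupp.single w c : List F.S →₀ ℤ) := by
    intro w c
    change Finsupp.sum (Finsupp.single [] 1) _ = _
    rw [Finsupp.sum_single_index (by simp), mul_one, mulWord_nil]
    change c • (Finsupp.single w 1 : List F.S →₀ ℤ) = _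
    rw [Finsupp.smul_single, smul_eq_mul, mul_one]
  simp_rw [h]
  exact Finsupp.sum_single a

/-- The coefficient of the unit in `a a*` is the sum of the squares of the coefficients of `a`. -/
theorem coeff_nil_mul_star (a : F.ZM) : F.coeff [] (a * star a) =
    Finsupp.sum (show List F.S →₀ ℤ from a) fun _ c => c * c := by
  classical
  have hstar : (star a : F.ZM) =
    (Finsupp.mapDomain F.barWord (show List F.S →₀ ℤ from a) : List F.S →₀ ℤ) := rfl
  rw [mul_def, map_finsuppSum]
  refine Finsupp.sum_congr fun w hw => ?_
  rw [hstar, Finsupp.sum_mapDomain_index_inj barWord_injective, map_finsuppSum]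
  simp only [map_zsmul, coeff_nil_mulWord, barWord_injective.eq_iff, smul_eq_mul, mul_ite, mul_one,
    mul_zero]
  exact (Finsupp.sum_ite_eq _ _ _).trans (if_pos hw)

/-- In a free fusion ring `a a* = 1` holds only for `a = ±1`. -/
theorem eq_one_or_neg_one_of_mul_star (a : F.ZM) (h : a * star a = 1) : a = 1 ∨ a = -1 := by
  classical
  let a' : List F.S →₀ ℤ := a
  have hsum : ∑ w ∈ a'.support, a' w * a' w = 1 := by
    have := coeff_nil_mul_star a
    rw [h] at this
    exact this.symm.trans ((coeff_basis [] []).trans (if_pos rfl))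
  obtain ⟨w, hw⟩ : a'.support.Nonempty := by
    rw [Finset.nonempty_iff_ne_empty]
    intro h0
    rw [h0, Finset.sum_empty] at hsum
    exact zero_ne_one hsum
  have hw1 : 1 ≤ a' w * a' w := by
    have := Finsupp.mem_support_iff.mp hw
    have := mul_self_pos.mpr this
    omega
  have hrest : ∀ v ∈ a'.support.erase w, a' v * a' v = 0 := by
    rw [← Finset.add_sum_erase _ _ hw] at hsum
    have hnn : ∀ v ∈ a'.support.erase w, 0 ≤ a' v * a' v := fun v _ => mul_self_nonneg _
    refine (Finset.sum_eq_zero_iff_of_nonneg hnn).mp (le_antisymm ?_ (Finset.sum_nonneg hnn))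
    linarith
  have hsingle : a' = Finsupp.single w (a' w) := by
    ext v
    rw [Finsupp.single_apply]
    split_ifs with hv
    · rw [hv]
    · by_contra hne
      have := hrest v (by simp [Ne.symm hv, hne])
      exact hne (mul_self_eq_zero.mp this)
  have hcc : a' w * a' w = 1 := by
    rwa [← Finset.add_sum_erase _ _ hw, Finset.sum_eq_zero hrest, add_zero] at hsum
  have hprod : a * star a = F.mulWord w (F.barWord w) := by
    have h1 : a = (Finsupp.single w (a' w) : List F.S →₀ ℤ) := hsingle
    have h2 : star a = (Finsupp.single (F.barWord w) (a' w) : List F.S →₀ ℤ) :=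
      (congrArg (Finsupp.mapDomain F.barWord) hsingle).trans Finsupp.mapDomain_single
    rw [mul_def, h2, h1, Finsupp.sum_single_index, Finsupp.sum_single_index]
    · rw [hcc, one_smul]
    · simp
    · simp
  have hnil : w = [] := by
    by_contra hne
    have h1 := one_le_coeff_append_mulWord w (F.barWord w)
    rw [← hprod, h] at h1
    have h2 : F.coeff (w ++ F.barWord w) (F.basis []) = 0 := by
      rw [coeff_basis, if_neg]
      intro h
      exact hne (List.append_eq_nil_iff.mp h.symm).1
    have : F.coeff (w ++ F.barWord w) 1 = 0 := h2
    omega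
  subst hnil
  rcases mul_self_eq_one_iff.mp hcc with h1 | h1
  · left
    rw [h1] at hsingle
    exact hsingle
  · right
    rw [h1, Finsupp.single_neg] at hsingle
    exact hsingle

end FusionSet

/-! ### One-dimensional corepresentations in fusion rings -/

namespace CMQG

variable {n : ℕ} (G : CMQG n)

theorem trace_eq_of_equivalent {m m' : Type} [Fintype m] [Fintype m'] [DecidableEq m]
    [DecidableEq m'] (χ : G.carrier →⋆ₐ[ℂ] ℂ) {V : Matrix m m G.carrier}
    {W : Matrix m' m' G.carrier} (h : Equivalent V W) : (V.map χ).trace = (W.map χ).trace := by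
  obtain ⟨T, hT, S, hST, hTS⟩ := h
  have hscal : ∀ {l l' : Type} (R : Matrix l l' ℂ), (scalarMatrix G.carrier R).map χ = R := by
    intro l l' R
    rw [scalarMatrix_map]
    rfl
  have h : T * V.map χ = W.map χ * T := by
    have := congrArg (fun X : Matrix m' m G.carrier => X.map χ) hT
    simpa only [map_mul_starAlgHom, hscal] using this
  calc (V.map χ).trace = (S * (T * V.map χ)).trace := by
        rw [← Matrix.mul_assoc, hST, Matrix.one_mul]
    _ = (W.map χ).trace := by
        rw [h, Matrix.trace_mul_comm, Matrix.mul_assoc, hTS, Matrix.mul_one]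

/-- The ring homomorphism from the fusion ring to `ℂ` that evaluates the character of a
corepresentation at a point `χ` of the quantum group. -/
def evalCharacter (χ : G.carrier →⋆ₐ[ℂ] ℂ) : G.FusionRing →+* ℂ :=
  RingQuot.lift ⟨(FreeAlgebra.lift ℤ fun V : G.Corep => (V.mat.map χ).trace).toRingHom, by
    rintro _ _ (⟨X, V, h⟩ | ⟨X, V, W, h⟩ | ⟨X, V, W, h⟩ | ⟨X, h⟩)
    · simpa using trace_eq_of_equivalent G χ h
    · have := trace_eq_of_equivalent G χ h
      simpa [Matrix.trace, directSum, Fintype.sum_sum_type] using this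
    · have := trace_eq_of_equivalent G χ h
      simpa [Matrix.trace, tensor, Fintype.sum_prod_type, Finset.sum_mul_sum] using this
    · have := trace_eq_of_equivalent G χ h
      simpa [Matrix.trace] using this⟩

theorem evalCharacter_cls (χ : G.carrier →⋆ₐ[ℂ] ℂ) (V : G.Corep) :
    G.evalCharacter χ (G.cls V) = (V.mat.map χ).trace := by
  simp only [evalCharacter, cls]
  exact (RingQuot.lift_mkRingHom_apply _ _ _).trans (by simp)

variable {G} {z : G.carrier}

/-- A one-dimensional corepresentation that is nontrivial in the fusion ring prevents the fusion
ring from being free: its class `a` satisfies `a a* = 1` and `a ≠ ±1`. -/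
theorem not_hasFreeFusionRing (hz : G.IsCorep (Matrix.of fun _ _ : Fin 1 => z))
    {χ₁ χ₂ : G.carrier →⋆ₐ[ℂ] ℂ} (h₁ : χ₁ z ≠ 1) (h₂ : χ₂ z ≠ -1) : ¬ G.HasFreeFusionRing := by
  rintro ⟨F, e, he⟩
  let V : G.Corep := ⟨1, _, hz⟩
  let W : G.Corep := ⟨1, _, isCorep_conj_one G hz⟩
  let I : G.Corep := ⟨1, 1, isCorep_one G⟩
  have hI : G.cls I = 1 :=
    (RingQuot.mkRingHom_rel (FusionRel.one I (equivalent_refl _))).trans (map_one _)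
  have hVW : G.cls V * G.cls W = 1 := by
    have hz' : z * star z = 1 := by
      have := (isUnitaryMatrix_iff.mp hz.1).1 0 0
      simpa using this
    rw [← hI]
    refine Eq.symm ((RingQuot.mkRingHom_rel (FusionRel.mul I V W ?_)).trans (map_mul _ _ _))
    change Equivalent (1 : Matrix (Fin 1) (Fin 1) G.carrier)
      (tensor (Matrix.of fun _ _ : Fin 1 => z) (Matrix.of fun _ _ : Fin 1 => star z))
    exact equivalent_of_entry 0 (0, 0) (by simp [tensor, hz'])
  have he1 : e 1 = 1 := by
    have h : e 1 * e (e.symm 1) = e (e.symm 1) := by rw [← map_mul, one_mul]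
    rwa [RingEquiv.apply_symm_apply, FusionSet.mul_one_ZM] at h
  have hstar : e (G.cls W) = star (e (G.cls V)) :=
    he V W (equivalent_refl _)
  have hprod : e (G.cls V) * star (e (G.cls V)) = 1 := by
    rw [← hstar, ← map_mul, hVW, he1]
  have hneg : e (-1) = -1 := by
    have h : e (-1) + e 1 = 0 := by
      rw [← map_add, neg_add_cancel]
      have : e 0 + e 0 = e 0 := by rw [← map_add, add_zero]
      exact add_eq_left.mp this
    rw [he1] at h
    exact eq_neg_of_add_eq_zero_left h
  have hχ (χ : G.carrier →⋆ₐ[ℂ] ℂ) : G.evalCharacter χ (G.cls V) = χ z := by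
    rw [evalCharacter_cls]
    simp [V, Matrix.trace]
  rcases FusionSet.eq_one_or_neg_one_of_mul_star _ hprod with h | h
  · rw [← he1] at h
    have := e.injective h
    exact h₁ (by rw [← hχ, this, map_one])
  · rw [← hneg] at h
    have := e.injective h
    exact h₂ (by rw [← hχ, this, map_neg, map_one])

end CMQG

/-! ### Frames of spaces of matrices -/

section Frames

variable {p q p' q' A A' : Type} [Fintype p] [Fintype q] [Fintype p'] [Fintype q'] [Fintype A]
  [Fintype A']

/-- The Hilbert–Schmidt inner product of matrices, conjugate-linear in the first variable. -/
def hs (X Y : Matrix p q ℂ) : ℂ := ∑ a, ∑ b, star (X a b) * Y a b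

theorem hs_eq_trace (X Y : Matrix p q ℂ) : hs X Y = (X.conjTranspose * Y).trace := by
  simp only [hs, Matrix.trace, Matrix.diag_apply, Matrix.mul_apply, Matrix.conjTranspose_apply]
  exact Finset.sum_comm

theorem star_hs (X Y : Matrix p q ℂ) : star (hs X Y) = hs Y X := by
  simp only [hs, star_sum, star_mul', star_star]
  simp only [mul_comm]

theorem hs_conjTranspose (X Y : Matrix p q ℂ) :
    hs X.conjTranspose Y.conjTranspose = star (hs X Y) := by
  rw [hs_eq_trace, star_hs, hs_eq_trace, Matrix.conjTranspose_conjTranspose, Matrix.trace_mul_comm]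

/-- A frame of a space of matrices: a finite family in the space that reproduces its elements by
the formula for the expansion in an orthonormal basis. -/
def IsFrame (S : Submodule ℂ (Matrix p q ℂ)) (T : A → Matrix p q ℂ) : Prop :=
  (∀ α, T α ∈ S) ∧ ∀ X ∈ S, X = ∑ α, hs (T α) X • T α

/-- Orthonormal bases are frames. -/
theorem exists_isFrame (S : Submodule ℂ (Matrix p q ℂ)) :
    ∃ (d : ℕ) (T : Fin d → Matrix p q ℂ), IsFrame S T := by
  let e : EuclideanSpace ℂ (p × q) ≃ₗ[ℂ] Matrix p q ℂ :=
    (WithLp.linearEquiv 2 ℂ (p × q → ℂ)).trans (LinearEquiv.curry ℂ ℂ p q)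
  let S' : Submodule ℂ (EuclideanSpace ℂ (p × q)) := S.comap e.toLinearMap
  let b := stdOrthonormalBasis ℂ S'
  refine ⟨_, fun α => e (b α), fun α => (b α).2, fun X hX => ?_⟩
  have hX' : e.symm X ∈ S' := by
    change e (e.symm X) ∈ S
    rwa [LinearEquiv.apply_symm_apply]
  have h := congrArg (fun x : S' => e x) (b.sum_repr' ⟨e.symm X, hX'⟩)
  simp only [Submodule.coe_sum, Submodule.coe_smul, map_sum, map_smul,
    LinearEquiv.apply_symm_apply, Submodule.coe_inner] at h
  rw [← h]
  refine Finset.sum_congr rfl fun α _ => ?_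
  congr 1
  rw [PiLp.inner_apply, Fintype.sum_prod_type, h]
  refine Finset.sum_congr rfl fun x _ => Finset.sum_congr rfl fun y _ => ?_
  rw [RCLike.inner_apply, mul_comm]
  rfl

variable {S : Submodule ℂ (Matrix p q ℂ)} {S' : Submodule ℂ (Matrix p' q' ℂ)}
  {T : A → Matrix p q ℂ} {T' : A' → Matrix p' q' ℂ}

/-- The canonical tensors of two spaces, given by frames, are related by a map `L` between the
spaces and its adjoint `L'`. In particular, the canonical tensor does not depend on the frame. -/
theorem IsFrame.casimir (hT : IsFrame S T) (hT' : IsFrame S' T')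
    (L : Matrix p q ℂ → Matrix p' q' ℂ) (L' : Matrix p' q' ℂ → Matrix p q ℂ)
    (hL : ∀ X ∈ S, L X ∈ S') (hL' : ∀ Y ∈ S', L' Y ∈ S)
    (hadj : ∀ X Y, hs (L' Y) X = hs Y (L X)) (a : p) (b : q) (c : p') (d : q') :
    ∑ α, star (T α a b) * L (T α) c d = ∑ β, star (L' (T' β) a b) * T' β c d := by
  have h1 (α) : L (T α) c d = ∑ β, hs (L' (T' β)) (T α) * T' β c d := by
    conv_lhs => rw [hT'.2 _ (hL _ (hT.1 α))]
    simp [Matrix.sum_apply, hadj]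
  have h2 (β) : L' (T' β) a b = ∑ α, hs (T α) (L' (T' β)) * T α a b := by
    conv_lhs => rw [hT.2 _ (hL' _ (hT'.1 β))]
    simp [Matrix.sum_apply]
  simp_rw [h1, h2, star_sum, star_mul', star_hs, Finset.mul_sum, Finset.sum_mul]
  rw [Finset.sum_comm]
  refine Finset.sum_congr rfl fun β _ => Finset.sum_congr rfl fun α _ => ?_
  ring

theorem IsFrame.conjTranspose (hT : IsFrame S T) {S₁ : Submodule ℂ (Matrix q p ℂ)}
    (h1 : ∀ X ∈ S, X.conjTranspose ∈ S₁) (h2 : ∀ X ∈ S₁, X.conjTranspose ∈ S) :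
    IsFrame S₁ fun α => (T α).conjTranspose := by
  refine ⟨fun α => h1 _ (hT.1 α), fun X hX => ?_⟩
  have h := congrArg Matrix.conjTranspose (hT.2 _ (h2 X hX))
  rw [Matrix.conjTranspose_conjTranspose, Matrix.conjTranspose_sum] at h
  rw [h]
  refine Finset.sum_congr rfl fun α _ => ?_
  rw [Matrix.conjTranspose_smul, ← hs_conjTranspose, Matrix.conjTranspose_conjTranspose, ← h]

end Frames

section Positivity

variable {K A : Type} [Fintype K] [Fintype A]
  {D : Submodule ℂ (Matrix K K ℂ)} {T : A → Matrix K K ℂ}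

/-- The map `a ↦ ∑ α, T_α a T_α*` given by a frame. -/
def frameMap (T : A → Matrix K K ℂ) (a : Matrix K K ℂ) : Matrix K K ℂ :=
  ∑ α, T α * a * (T α).conjTranspose

theorem sum_mul_mul_conjTranspose_apply (P Q : A → Matrix K K ℂ) (a : Matrix K K ℂ) (r s : K) :
    (∑ α, P α * a * (Q α).conjTranspose) r s =
      ∑ x, ∑ y, a x y * ∑ α, star (Q α s y) * P α r x := by
  simp only [Matrix.sum_apply, Matrix.mul_apply, Matrix.conjTranspose_apply,
    Finset.sum_mul, Finset.mul_sum]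
  rw [Finset.sum_comm]
  conv_lhs => enter [2, y]; rw [Finset.sum_comm]
  rw [Finset.sum_comm]
  refine Finset.sum_congr rfl fun x _ => Finset.sum_congr rfl fun y _ =>
    Finset.sum_congr rfl fun α _ => ?_
  ring

theorem frameMap_apply (a : Matrix K K ℂ) (r s : K) :
    frameMap T a r s = ∑ x, ∑ y, a x y * ∑ α, star (T α s y) * T α r x :=
  sum_mul_mul_conjTranspose_apply T T a r s

/-- The values of the map given by a frame of an algebra lie in the commutant of the algebra. -/
theorem mul_frameMap (hT : IsFrame D T) (hmul : ∀ X ∈ D, ∀ Y ∈ D, X * Y ∈ D)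
    (hstar : ∀ X ∈ D, X.conjTranspose ∈ D) {c : Matrix K K ℂ} (hc : c ∈ D) (a : Matrix K K ℂ) :
    c * frameMap T a = frameMap T a * c := by
  have h1 : c * frameMap T a = ∑ α, (c * T α) * a * (T α).conjTranspose := by
    simp only [frameMap, Finset.mul_sum, Matrix.mul_assoc]
  have h2 : frameMap T a * c = ∑ α, T α * a * (c.conjTranspose * T α).conjTranspose := by
    simp only [frameMap, Finset.sum_mul, Matrix.conjTranspose_mul,
      Matrix.conjTranspose_conjTranspose, Matrix.mul_assoc]
  have key := hT.casimir hT (fun X => c * X) (fun Y => c.conjTranspose * Y)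
    (fun X hX => hmul _ hc _ hX) (fun Y hY => hmul _ (hstar _ hc) _ hY) fun X Y => by
      rw [hs_eq_trace, hs_eq_trace, Matrix.conjTranspose_mul, Matrix.conjTranspose_conjTranspose,
        Matrix.mul_assoc]
  rw [h1, h2]
  ext r s
  rw [sum_mul_mul_conjTranspose_apply, sum_mul_mul_conjTranspose_apply]
  simp_rw [key]

open scoped ComplexOrder in
/-- The map given by a frame of a star-algebra of matrices is positive semidefinite for the
Hilbert–Schmidt inner product. Indeed, its square is its product with the positive invertible
matrix `Z = ∑ α, T_α T_α*`, which commutes with everything in sight. -/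
theorem re_hs_frameMap_nonneg [DecidableEq K] (hT : IsFrame D T) (hone : 1 ∈ D)
    (hmul : ∀ X ∈ D, ∀ Y ∈ D, X * Y ∈ D) (hstar : ∀ X ∈ D, X.conjTranspose ∈ D)
    (a : Matrix K K ℂ) : 0 ≤ (hs a (frameMap T a)).re := by
  let Z := frameMap T 1
  have hZ : Z = ∑ α, T α * (T α).conjTranspose := by simp [Z, frameMap]
  have hZpos : Z.PosDef := by
    rw [hZ]
    have hpsd : (∑ α, T α * (T α).conjTranspose).PosSemidef :=
      Matrix.posSemidef_sum _ fun α _ => Matrix.posSemidef_self_mul_conjTranspose (T α)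
    refine Matrix.PosDef.of_dotProduct_mulVec_pos hpsd.1 fun v hv => ?_
    refine lt_of_le_of_ne (hpsd.dotProduct_mulVec_nonneg v) fun h0 => hv ?_
    -- the identity is a combination of the frame, so a vector killed by all `T_α*` vanishes
    have hk : ∀ α, (T α).conjTranspose.mulVec v = 0 := by
      rw [Matrix.sum_mulVec, dotProduct_sum] at h0
      have hnn : ∀ α ∈ Finset.univ,
          0 ≤ star v ⬝ᵥ (T α * (T α).conjTranspose).mulVec v := fun α _ =>
        (Matrix.posSemidef_self_mul_conjTranspose (T α)).dotProduct_mulVec_nonneg v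
      intro α
      have h := (Finset.sum_eq_zero_iff_of_nonneg hnn).mp h0.symm α (Finset.mem_univ α)
      rw [← Matrix.mulVec_mulVec, Matrix.dotProduct_mulVec] at h
      have h' : Matrix.vecMul (star v) (T α) = star ((T α).conjTranspose.mulVec v) := by
        rw [Matrix.star_mulVec, Matrix.conjTranspose_conjTranspose]
      rw [h'] at h
      exact dotProduct_star_self_eq_zero.mp h
    have h1 := congrArg (fun X : Matrix K K ℂ => X.conjTranspose.mulVec v) (hT.2 1 hone)
    simp only [Matrix.conjTranspose_one, Matrix.one_mulVec, Matrix.conjTranspose_sum,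
      Matrix.conjTranspose_smul, Matrix.sum_mulVec, Matrix.smul_mulVec, hk, smul_zero,
      Finset.sum_const_zero] at h1
    exact h1
  have hdet : IsUnit Z.det := hZpos.isUnit.map Matrix.detMonoidHom
  have hcomm (c) (hc : c ∈ D) : Z⁻¹ * c = c * Z⁻¹ := by
    have h := mul_frameMap hT hmul hstar hc 1
    calc Z⁻¹ * c = Z⁻¹ * (c * Z) * Z⁻¹ := by
          rw [Matrix.mul_assoc, Matrix.mul_nonsing_inv_cancel_right _ _ hdet]
      _ = c * Z⁻¹ := by
          rw [h, ← Matrix.mul_assoc, Matrix.nonsing_inv_mul _ hdet, Matrix.one_mul]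
  have hinv : frameMap T (a * Z⁻¹) = frameMap T a * Z⁻¹ := by
    simp only [frameMap, Finset.sum_mul, Matrix.mul_assoc,
      hcomm _ (hstar _ (hT.1 _))]
  have hsq (b) : frameMap T (frameMap T b) = frameMap T b * Z := by
    rw [hZ, Finset.mul_sum]
    conv_lhs => rw [frameMap]
    refine Finset.sum_congr rfl fun α _ => ?_
    rw [mul_frameMap hT hmul hstar (hT.1 α), Matrix.mul_assoc]
  have hadj (b) : hs a (frameMap T b) = hs (frameMap T a) b := by
    have hT' : frameMap T a = ∑ α, (T α).conjTranspose * a * T α := by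
      have key := hT.casimir (hT.conjTranspose hstar hstar) id id (fun _ h => h) (fun _ h => h)
        fun _ _ => rfl
      ext r s
      have : (∑ α, (T α).conjTranspose * a * T α) =
          frameMap (fun α => (T α).conjTranspose) a := by
        simp [frameMap]
      rw [this, frameMap_apply, frameMap_apply]
      simp only [id] at key
      simp_rw [key]
    rw [hT', hs_eq_trace, hs_eq_trace, frameMap, Matrix.mul_sum, Matrix.trace_sum,
      Matrix.conjTranspose_sum, Matrix.sum_mul, Matrix.trace_sum]
    refine Finset.sum_congr rfl fun α _ => ?_
    simp only [Matrix.conjTranspose_mul, Matrix.conjTranspose_conjTranspose]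
    rw [← Matrix.mul_assoc, Matrix.trace_mul_comm, ← Matrix.mul_assoc, ← Matrix.mul_assoc,
      ← Matrix.mul_assoc]
  have hfinal : hs a (frameMap T a) =
      (frameMap T a * Z⁻¹ * (frameMap T a).conjTranspose).trace := by
    have h : frameMap T a = frameMap T (frameMap T (a * Z⁻¹)) := by
      rw [hsq, hinv, Matrix.nonsing_inv_mul_cancel_right _ _ hdet]
    conv_lhs => rw [h]
    rw [hadj, hinv, hs_eq_trace, Matrix.trace_mul_comm]
  rw [hfinal]
  have := (hZpos.inv.posSemidef.mul_mul_conjTranspose_same (frameMap T a)).trace_nonneg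
  exact (Complex.le_def.mp this).1

/-- The kernel given by a frame of a star-algebra of matrices is positive semidefinite. -/
theorem re_sum_frame_nonneg [DecidableEq K] (hT : IsFrame D T) (hone : 1 ∈ D)
    (hmul : ∀ X ∈ D, ∀ Y ∈ D, X * Y ∈ D) (hstar : ∀ X ∈ D, X.conjTranspose ∈ D)
    {ι : Type} [Fintype ι] (x y : ι → K) (c : ι → ℂ) :
    0 ≤ (∑ i, ∑ j, star (c i) * c j *
      ∑ α, star (T α (x i) (x j)) * T α (y i) (y j)).re := by
  -- the sum is the complex conjugate of the Hilbert–Schmidt inner product for the matrix `a`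
  let a : Matrix K K ℂ := ∑ i, star (c i) • Matrix.single (x i) (y i) 1
  have h : hs a (frameMap T a) = star (∑ i, ∑ j, star (c i) * c j *
      ∑ α, star (T α (x i) (x j)) * T α (y i) (y j)) := by
    have hl (b : Matrix K K ℂ) : hs a b = ∑ i, c i * b (x i) (y i) := by
      rw [hs_eq_trace]
      simp only [a, Matrix.conjTranspose_sum, Matrix.conjTranspose_smul, star_star,
        Matrix.conjTranspose_single, star_one, Matrix.sum_mul, Matrix.trace_sum, Matrix.smul_mul,
        Matrix.trace_smul, smul_eq_mul]
      refine Finset.sum_congr rfl fun i _ => ?_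
      rw [Matrix.trace_single_mul, one_smul]
    have hm : frameMap T a = ∑ j, star (c j) • frameMap T (Matrix.single (x j) (y j) 1) := by
      simp only [a, frameMap, Finset.mul_sum, Finset.sum_mul, Matrix.mul_smul, Matrix.smul_mul,
        Finset.smul_sum]
      exact Finset.sum_comm
    rw [hl, hm]
    simp only [Matrix.sum_apply, Matrix.smul_apply, smul_eq_mul, Finset.mul_sum, star_sum,
      star_mul', star_star, frameMap_apply]
    refine Finset.sum_congr rfl fun i _ => Finset.sum_congr rfl fun j _ => ?_
    rw [Finset.sum_eq_single (x j), Finset.sum_eq_single (y j)]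
    · rw [Matrix.single_apply_same]
      refine Finset.sum_congr rfl fun α _ => ?_
      ring
    · intro b _ hb
      simp [Ne.symm hb]
    · simp
    · intro b _ hb
      simp [Ne.symm hb]
    · simp
  have h' := re_hs_frameMap_nonneg hT hone hmul hstar a
  rwa [h, Complex.star_def, Complex.conj_re] at h'

end Positivity

/-! ### Reconstruction of a quantum group from spaces of intertwiners -/

/-- Words of length `k` in the alphabet `1, …, n`, which index the standard basis of
`(ℂⁿ)^{⊗k}`. -/
abbrev Word (n k : ℕ) : Type := Fin k → Fin n

/-- The Frobenius rotation of a matrix in `Hom(k, l + 1)` to one in `Hom(k + 1, l)`: the first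
upper index becomes the first lower index. -/
def rotate {n k l : ℕ} (T : Matrix (Word n (l + 1)) (Word n k) ℂ) :
    Matrix (Word n l) (Word n (k + 1)) ℂ :=
  Matrix.of fun y x => T (Fin.cons (x 0) y) (Fin.tail x)

/-- The inverse of the Frobenius rotation. -/
def rotateInv {n k l : ℕ} (T : Matrix (Word n l) (Word n (k + 1)) ℂ) :
    Matrix (Word n (l + 1)) (Word n k) ℂ :=
  Matrix.of fun y x => T (Fin.tail y) (Fin.cons (y 0) x)

/-- The matrix of the map `x ↦ ∑ i, e_i ⊗ e_i ⊗ x`. -/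
def cupMatrix (n r : ℕ) : Matrix (Word n (r + 2)) (Word n r) ℂ :=
  Matrix.of fun y x => if y 0 = y 1 ∧ Fin.tail (Fin.tail y) = x then 1 else 0

/-- The matrix of the map `e_i ⊗ x ↦ ∑ j, e_j ⊗ x`. -/
def sumMatrix (n r : ℕ) : Matrix (Word n (r + 1)) (Word n (r + 1)) ℂ :=
  Matrix.of fun y x => if Fin.tail y = Fin.tail x then 1 else 0

/-- The matrix of the map `e_i ⊗ e_j ⊗ x ↦ δ_ij e_i ⊗ e_j ⊗ x`. -/
def diagMatrix (n r : ℕ) : Matrix (Word n (r + 2)) (Word n (r + 2)) ℂ :=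
  Matrix.of fun y x => if y 0 = y 1 ∧ y = x then 1 else 0

/-- A family of spaces of matrices with the closure properties of the intertwiners between the
tensor powers of a self-conjugate fundamental corepresentation. The tensor product is needed only
through the Frobenius rotation and the maps `∑ e_i ⊗ e_i ⊗ id`. -/
structure IntertwinerFamily (n : ℕ) where
  Hom : ∀ k l, Submodule ℂ (Matrix (Word n l) (Word n k) ℂ)
  one_mem : ∀ k, 1 ∈ Hom k k
  mul_mem : ∀ {k l m} {S : Matrix (Word n m) (Word n l) ℂ} {T : Matrix (Word n l) (Word n k) ℂ},
    S ∈ Hom l m → T ∈ Hom k l → S * T ∈ Hom k m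
  star_mem : ∀ {k l} {T : Matrix (Word n l) (Word n k) ℂ}, T ∈ Hom k l → T.conjTranspose ∈ Hom l k
  rotate_mem : ∀ {k l} {T : Matrix (Word n (l + 1)) (Word n k) ℂ},
    T ∈ Hom k (l + 1) → rotate T ∈ Hom (k + 1) l
  cup_mem : ∀ r, cupMatrix n r ∈ Hom r (r + 2)

/-- A pair of words of the same length `k`, standing for the matrix coefficient
`u_{x₁y₁} ⋯ u_{x_k y_k}`. -/
abbrev WordPair (n : ℕ) : Type := Σ k, Word n k × Word n k

/-- Multiplication of a matrix coefficient by `u_ij` from the left. -/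
def WordPair.cons {n : ℕ} (i j : Fin n) (w : WordPair n) : WordPair n :=
  ⟨w.1 + 1, Fin.cons i w.2.1, Fin.cons j w.2.2⟩

namespace IntertwinerFamily

variable {n : ℕ} (C : IntertwinerFamily n)

theorem rotateInv_mem {k l : ℕ} {T : Matrix (Word n l) (Word n (k + 1)) ℂ}
    (hT : T ∈ C.Hom (k + 1) l) : rotateInv T ∈ C.Hom k (l + 1) := by
  have h : rotateInv T = (rotate T.conjTranspose).conjTranspose := by
    ext y x
    simp [rotate, rotateInv]
  rw [h]
  exact C.star_mem (C.rotate_mem (C.star_mem hT))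

/-- The size of the chosen frame of `Hom(k, l)`. -/
def frameDim (k l : ℕ) : ℕ := (exists_isFrame (C.Hom k l)).choose

/-- A chosen frame of `Hom(k, l)`. -/
def frame (k l : ℕ) : Fin (C.frameDim k l) → Matrix (Word n l) (Word n k) ℂ :=
  (exists_isFrame (C.Hom k l)).choose_spec.choose

theorem isFrame_frame (k l : ℕ) : IsFrame (C.Hom k l) (C.frame k l) :=
  (exists_isFrame (C.Hom k l)).choose_spec.choose_spec

/-- The kernel of the projection onto `Hom(l, k)`. It is the inner product, for the Haar state, of
the matrix coefficients `u_{x₁y₁} ⋯ u_{x_k y_k}` and `u_{x'₁y'₁} ⋯ u_{x'_l y'_l}`. -/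
def kernel {k l : ℕ} (x y : Word n k) (x' y' : Word n l) : ℂ :=
  ∑ α, star (C.frame l k α x x') * C.frame l k α y y'

theorem star_kernel {k l : ℕ} (x y : Word n k) (x' y' : Word n l) :
    star (C.kernel x y x' y') = C.kernel x' y' x y := by
  have h := (C.isFrame_frame k l).casimir
    ((C.isFrame_frame l k).conjTranspose (fun _ h => C.star_mem h) fun _ h => C.star_mem h)
    id id (fun _ h => h) (fun _ h => h) (fun _ _ => rfl) x' x y' y
  simp only [id, Matrix.conjTranspose_apply, star_star] at h
  rw [kernel, kernel, h, star_sum]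
  refine Finset.sum_congr rfl fun α _ => ?_
  rw [star_mul', star_star]

/-- Left multiplication by `u_ij` is symmetric for the kernel, by Frobenius reciprocity. -/
theorem kernel_cons {k l : ℕ} (i j : Fin n) (x y : Word n k) (x' y' : Word n l) :
    C.kernel (Fin.cons i x : Word n (k + 1)) (Fin.cons j y) x' y' =
      C.kernel x y (Fin.cons i x' : Word n (l + 1)) (Fin.cons j y') := by
  have h := (C.isFrame_frame l (k + 1)).casimir (C.isFrame_frame (l + 1) k)
    rotate rotateInv (fun _ h => C.rotate_mem h) (fun _ h => C.rotateInv_mem h)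
    (fun X Y => by
      simp only [hs, rotate, rotateInv, Matrix.of_apply]
      rw [← (Fin.consEquiv fun _ => Fin n).sum_comp, Fintype.sum_prod_type, Finset.sum_comm]
      refine Finset.sum_congr rfl fun b _ => ?_
      rw [← (Fin.consEquiv fun _ => Fin n).sum_comp, Fintype.sum_prod_type, Finset.sum_comm]
      simp only [Fin.consEquiv, Equiv.coe_fn_mk, Fin.tail_cons, Fin.cons_zero]
      exact Finset.sum_comm)
    (Fin.cons i x) x' y (Fin.cons j y')
  simpa only [kernel, rotate, rotateInv, Matrix.of_apply, Fin.cons_zero, Fin.tail_cons] using h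

/-- The relations `U^{⊗l'} B = B U^{⊗l}` between the matrix coefficients hold for the
kernel. -/
theorem kernel_relation {k l l' : ℕ} {B : Matrix (Word n l') (Word n l) ℂ} (hB : B ∈ C.Hom l l')
    (x y : Word n k) (x' : Word n l') (y' : Word n l) :
    ∑ z, B z y' * C.kernel x y x' z = ∑ z, B x' z * C.kernel x y z y' := by
  have h := (C.isFrame_frame l' k).casimir (C.isFrame_frame l k) (fun X => X * B)
    (fun Y => Y * B.conjTranspose) (fun _ h => C.mul_mem h hB)
    (fun _ h => C.mul_mem h (C.star_mem hB))
    (fun X Y => by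
      rw [hs_eq_trace, hs_eq_trace, Matrix.conjTranspose_mul, Matrix.conjTranspose_conjTranspose,
        Matrix.mul_assoc, Matrix.trace_mul_comm, Matrix.mul_assoc])
    x x' y y'
  simp only [Matrix.mul_apply, Matrix.conjTranspose_apply, star_sum, star_mul', star_star,
    Finset.mul_sum, Finset.sum_mul] at h
  simp only [kernel, Finset.mul_sum]
  refine Finset.sum_comm.trans (Eq.trans ?_ (h.trans (Eq.trans ?_ Finset.sum_comm)))
  · exact Finset.sum_congr rfl fun α _ => Finset.sum_congr rfl fun z _ => by ring
  · exact Finset.sum_congr rfl fun α _ => Finset.sum_congr rfl fun z _ => by ring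

/-- The matrices over all words of length less than `N`, with blocks in the given spaces. -/
def truncation (N : ℕ) :
    Submodule ℂ (Matrix (Σ k : Fin N, Word n k) (Σ k : Fin N, Word n k) ℂ) where
  carrier := {M | ∀ k l : Fin N, (Matrix.of fun x y => M ⟨k, x⟩ ⟨l, y⟩) ∈ C.Hom l k}
  add_mem' h h' k l := (C.Hom l k).add_mem (h k l) (h' k l)
  zero_mem' k l := (C.Hom l k).zero_mem
  smul_mem' c _ h k l := (C.Hom l k).smul_mem c (h k l)

theorem truncation_one (N : ℕ) : 1 ∈ C.truncation N := by
  intro k l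
  by_cases h : k = l
  · subst h
    convert C.one_mem k using 1
    ext x y
    simp [Matrix.one_apply]
  · convert (C.Hom l k).zero_mem using 1
    ext x y
    simp [h]

theorem truncation_mul (N : ℕ) : ∀ X ∈ C.truncation N, ∀ Y ∈ C.truncation N,
    X * Y ∈ C.truncation N := by
  intro X hX Y hY k l
  have h : (Matrix.of fun x y => (X * Y) ⟨k, x⟩ ⟨l, y⟩) =
      ∑ m : Fin N, (Matrix.of fun x y => X ⟨k, x⟩ ⟨m, y⟩) *
        (Matrix.of fun x y => Y ⟨m, x⟩ ⟨l, y⟩) := by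
    ext x y
    simp [Matrix.mul_apply, Matrix.sum_apply, Fintype.sum_sigma]
  rw [h]
  exact Submodule.sum_mem _ fun m _ => C.mul_mem (hX k m) (hY m l)

theorem truncation_star (N : ℕ) : ∀ X ∈ C.truncation N, X.conjTranspose ∈ C.truncation N :=
  fun _ hX k l => C.star_mem (hX l k)

/-- The kernel of the truncation is composed of the given kernels. -/
theorem kernel_eq_truncation (N : ℕ) {A : Type} [Fintype A]
    {T : A → Matrix (Σ k : Fin N, Word n k) (Σ k : Fin N, Word n k) ℂ}
    (hT : IsFrame (C.truncation N) T) {k l : Fin N} (x y : Word n k) (x' y' : Word n l) :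
    C.kernel x y x' y' =
      ∑ α, star (T α ⟨k, x⟩ ⟨l, x'⟩) * T α ⟨k, y⟩ ⟨l, y'⟩ := by
  let emb (Y : Matrix (Word n k) (Word n l) ℂ) :
      Matrix (Σ k : Fin N, Word n k) (Σ k : Fin N, Word n k) ℂ :=
    ∑ r, ∑ s, Y r s • Matrix.single ⟨k, r⟩ ⟨l, s⟩ 1
  have hemb (Y) (r : Word n k) (s : Word n l) : emb Y ⟨k, r⟩ ⟨l, s⟩ = Y r s := by
    simp only [emb, Matrix.sum_apply, Matrix.smul_apply, Matrix.single_apply, Sigma.mk.injEq,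
      heq_eq_eq, true_and]
    rw [Finset.sum_eq_single r, Finset.sum_eq_single s] <;> simp +contextual
  have h := hT.casimir (C.isFrame_frame l k) (fun X => Matrix.of fun r s => X ⟨k, r⟩ ⟨l, s⟩) emb
    (fun X hX => hX k l)
    (fun Y hY k' l' => by
      by_cases hk : k' = k
      · by_cases hl : l' = l
        · subst hk hl
          convert hY using 1
          ext r s
          exact hemb Y r s
        · convert (C.Hom l' k').zero_mem using 1
          ext r s
          simp [emb, Matrix.sum_apply, Ne.symm hl]
      · convert (C.Hom l' k').zero_mem using 1
        ext r s
        simp [emb, Matrix.sum_apply, Ne.symm hk])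
    (fun X Y => by
      rw [hs_eq_trace, hs]
      simp only [emb, Matrix.conjTranspose_sum, Matrix.conjTranspose_smul,
        Matrix.conjTranspose_single, star_one, Matrix.sum_mul, Matrix.trace_sum, Matrix.smul_mul,
        Matrix.trace_smul, smul_eq_mul, Matrix.of_apply]
      refine Finset.sum_congr rfl fun r _ => Finset.sum_congr rfl fun s _ => ?_
      rw [Matrix.trace_single_mul, one_smul])
    ⟨k, x⟩ ⟨l, x'⟩ y y'
  simp only [hemb, Matrix.of_apply] at h
  exact h.symm

/-- The kernel is positive semidefinite. -/
theorem re_sum_kernel_nonneg (s : Finset (WordPair n)) (c : WordPair n → ℂ) :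
    0 ≤ (∑ w ∈ s, ∑ w' ∈ s, star (c w) * c w' * C.kernel w.2.1 w.2.2 w'.2.1 w'.2.2).re := by
  let N := s.sup (fun w => w.1) + 1
  have hN (w : s) : w.1.1 < N :=
    Nat.lt_succ_of_le (Finset.le_sup (f := fun w : WordPair n => w.1) w.2)
  obtain ⟨d, T, hT⟩ := exists_isFrame (C.truncation N)
  have h := re_sum_frame_nonneg hT (C.truncation_one N) (C.truncation_mul N)
    (C.truncation_star N) (fun w : s => ⟨⟨w.1.1, hN w⟩, w.1.2.1⟩)
    (fun w : s => ⟨⟨w.1.1, hN w⟩, w.1.2.2⟩) (fun w : s => c w)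
  have h' : ∑ w ∈ s, ∑ w' ∈ s, star (c w) * c w' * C.kernel w.2.1 w.2.2 w'.2.1 w'.2.2 =
      ∑ w : s, ∑ w' : s, star (c w) * c w' *
        C.kernel w.1.2.1 w.1.2.2 w'.1.2.1 w'.1.2.2 := by
    rw [← Finset.sum_coe_sort s]
    refine Finset.sum_congr rfl fun w _ => ?_
    rw [← Finset.sum_coe_sort s]
  rw [h']
  convert h using 6 with w _ w' _
  exact C.kernel_eq_truncation N hT (k := ⟨w.1.1, hN w⟩) (l := ⟨w'.1.1, hN w'⟩) _ _ _ _

end IntertwinerFamily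

namespace IntertwinerFamily

variable {n : ℕ} (C : IntertwinerFamily n)

/-! ### Orthogonality relations for the kernel -/

theorem sum_word_succ {M : Type} [AddCommMonoid M] {k : ℕ} (f : Word n (k + 1) → M) :
    ∑ z, f z = ∑ p, ∑ z : Word n k, f (Fin.cons p z) := by
  rw [← (Fin.consEquiv fun _ => Fin n).sum_comp, Fintype.sum_prod_type]
  rfl

theorem cupMatrix_cons {r : ℕ} (i j : Fin n) (y x : Word n r) :
    cupMatrix n r (Fin.cons i (Fin.cons j y : Word n (r + 1))) x =
      if i = j ∧ y = x then 1 else 0 := rfl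

theorem kernel_cup_right {k r : ℕ} (x y : Word n k) (i j : Fin n) (s t : Word n r) :
    ∑ p, C.kernel x y (Fin.cons i (Fin.cons j s : Word n (r + 1)) : Word n (r + 2))
      (Fin.cons p (Fin.cons p t : Word n (r + 1))) = if i = j then C.kernel x y s t else 0 := by
  have h := C.kernel_relation (C.cup_mem r) x y
    (Fin.cons i (Fin.cons j s : Word n (r + 1)) : Word n (r + 2)) t
  simp only [sum_word_succ, cupMatrix_cons, ite_and, ite_mul, one_mul, zero_mul] at h
  simpa using h

theorem kernel_cup_left {k r : ℕ} (x y : Word n k) (i j : Fin n) (s t : Word n r) :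
    ∑ p, C.kernel x y (Fin.cons p (Fin.cons p s : Word n (r + 1)) : Word n (r + 2))
      (Fin.cons i (Fin.cons j t : Word n (r + 1))) = if i = j then C.kernel x y s t else 0 := by
  have h := C.kernel_relation (C.star_mem (C.cup_mem r)) x y s
    (Fin.cons i (Fin.cons j t : Word n (r + 1)) : Word n (r + 2))
  simp only [sum_word_succ, Matrix.conjTranspose_apply, cupMatrix_cons, apply_ite star, star_one,
    star_zero, ite_and, ite_mul, one_mul, zero_mul] at h
  simpa using h.symm

theorem kernel_sum (hC : ∀ r, sumMatrix n r ∈ C.Hom (r + 1) (r + 1)) {k r : ℕ} (x y : Word n k)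
    (i j : Fin n) (s t : Word n r) :
    ∑ p, C.kernel x y (Fin.cons i s : Word n (r + 1)) (Fin.cons p t) =
      ∑ p, C.kernel x y (Fin.cons p s : Word n (r + 1)) (Fin.cons j t) := by
  have h := C.kernel_relation (hC r) x y (Fin.cons i s) (Fin.cons j t)
  simpa [sum_word_succ, sumMatrix] using h

theorem kernel_diag (hC : ∀ r, diagMatrix n r ∈ C.Hom (r + 2) (r + 2)) {k r : ℕ} (x y : Word n k)
    (i : Fin n) {p q : Fin n} (hpq : p ≠ q) (s t : Word n r) :
    C.kernel x y (Fin.cons i (Fin.cons i s : Word n (r + 1)) : Word n (r + 2))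
      (Fin.cons p (Fin.cons q t : Word n (r + 1))) = 0 := by
  have h := C.kernel_relation (hC r) x y
    (Fin.cons i (Fin.cons i s : Word n (r + 1)) : Word n (r + 2))
    (Fin.cons p (Fin.cons q t : Word n (r + 1)))
  have h1 (z : Word n (r + 2)) :
      diagMatrix n r z (Fin.cons p (Fin.cons q t : Word n (r + 1))) = 0 := by
    rw [diagMatrix, Matrix.of_apply, if_neg]
    rintro ⟨h, rfl⟩
    exact hpq h
  have h2 (z : Word n (r + 2)) : diagMatrix n r (Fin.cons i (Fin.cons i s : Word n (r + 1))) z =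
      if Fin.cons i (Fin.cons i s : Word n (r + 1)) = z then 1 else 0 := by
    rw [diagMatrix, Matrix.of_apply]
    exact if_congr (and_iff_right rfl) rfl rfl
  simp_rw [h1, h2] at h
  simpa using h.symm

/-! ### The Hilbert space of the Haar state -/

/-- The pre-Hilbert space of formal linear combinations of matrix coefficients, with the inner
product given by the kernel. -/
def PreHaar (_C : IntertwinerFamily n) : Type := WordPair n →₀ ℂ

instance : AddCommGroup C.PreHaar := inferInstanceAs (AddCommGroup (WordPair n →₀ ℂ))
instance : Module ℂ C.PreHaar := inferInstanceAs (Module ℂ (WordPair n →₀ ℂ))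

/-- The inner product of matrix coefficients. -/
def pairKernel (w w' : WordPair n) : ℂ := C.kernel w.2.1 w.2.2 w'.2.1 w'.2.2

/-- The sesquilinear form given by the kernel. -/
def form (a b : WordPair n →₀ ℂ) : ℂ :=
  a.sum fun w c => b.sum fun w' d => star c * d * C.pairKernel w w'

theorem form_add_left (a b c : WordPair n →₀ ℂ) : C.form (a + b) c = C.form a c + C.form b c :=
  Finsupp.sum_add_index' (by simp) fun w x y => by simp [add_mul, Finsupp.sum_add]

theorem form_smul_left (r : ℂ) (a b : WordPair n →₀ ℂ) :
    C.form (r • a) b = star r * C.form a b := by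
  rw [form, Finsupp.sum_smul_index (by simp), form, Finsupp.mul_sum]
  refine Finsupp.sum_congr fun w _ => ?_
  rw [Finsupp.mul_sum]
  refine Finsupp.sum_congr fun w' _ => ?_
  rw [star_mul']
  ring

/-- Left multiplication by `u_ij` is symmetric. -/
theorem form_mapDomain_cons (i j : Fin n) (a b : WordPair n →₀ ℂ) :
    C.form (Finsupp.mapDomain (WordPair.cons i j) a) b =
      C.form a (Finsupp.mapDomain (WordPair.cons i j) b) := by
  have h0 : ∀ w w', C.pairKernel (WordPair.cons i j w) w' = C.pairKernel w (w'.cons i j) :=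
    fun w w' => C.kernel_cons i j _ _ _ _
  rw [form, Finsupp.sum_mapDomain_index (by simp)
    (fun w x y => by simp [add_mul, Finsupp.sum_add]), form]
  refine Finsupp.sum_congr fun w _ => ?_
  rw [Finsupp.sum_mapDomain_index (by simp) (fun w x y => by simp [mul_add, add_mul])]
  simp only [h0]

theorem star_form (a b : WordPair n →₀ ℂ) : star (C.form a b) = C.form b a := by
  simp only [form, Finsupp.sum, star_sum]
  rw [Finset.sum_comm]
  refine Finset.sum_congr rfl fun w _ => Finset.sum_congr rfl fun w' _ => ?_
  rw [star_mul', star_mul', star_star, pairKernel, star_kernel, pairKernel]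
  ring

theorem re_form_nonneg (a : WordPair n →₀ ℂ) : 0 ≤ (C.form a a).re :=
  C.re_sum_kernel_nonneg a.support a

/-- The positive semidefinite form on the formal linear combinations of matrix coefficients. -/
abbrev preHaarCore : PreInnerProductSpace.Core ℂ C.PreHaar where
  inner a b := C.form a b
  conj_inner_symm a b := C.star_form b a
  re_inner_nonneg a := C.re_form_nonneg a
  add_left a b c := C.form_add_left a b c
  smul_left a b r := C.form_smul_left r a b

instance : SeminormedAddCommGroup C.PreHaar :=
  InnerProductSpace.Core.toSeminormedAddCommGroup (c := C.preHaarCore)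

instance : InnerProductSpace ℂ C.PreHaar := InnerProductSpace.ofCore C.preHaarCore

theorem inner_def (a b : C.PreHaar) : inner ℂ a b = C.form a b := rfl

/-- The Hilbert space of the Haar state. -/
abbrev Haar : Type := UniformSpace.Completion C.PreHaar

/-- A matrix coefficient, as a vector. -/
def vec (w : WordPair n) : C.PreHaar := (Finsupp.single w 1 : WordPair n →₀ ℂ)

theorem inner_vec (w w' : WordPair n) : inner ℂ (C.vec w) (C.vec w') = C.pairKernel w w' := by
  rw [inner_def, vec, vec, form, Finsupp.sum_single_index, Finsupp.sum_single_index] <;> simp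

theorem span_vec : Submodule.span ℂ (Set.range C.vec) = ⊤ := by
  have h := (Finsupp.basisSingleOne (R := ℂ) (ι := WordPair n)).span_eq
  rw [Finsupp.coe_basisSingleOne] at h
  exact h

/-- Vectors of the Hilbert space that agree under pairing with all matrix coefficients are
equal. -/
theorem coe_eq_coe_of_inner_vec {a b : C.PreHaar}
    (h : ∀ w, inner ℂ (C.vec w) a = inner ℂ (C.vec w) b) : (a : C.Haar) = b := by
  have h1 : ∀ u : C.PreHaar, inner ℂ u (a - b) = 0 := by
    intro u
    have hu : u ∈ Submodule.span ℂ (Set.range C.vec) := C.span_vec ▸ Submodule.mem_top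
    induction hu using Submodule.span_induction with
    | mem x hx =>
      obtain ⟨w, rfl⟩ := hx
      rw [inner_sub_right, h, sub_self]
    | zero => exact inner_zero_left _
    | add x y _ _ hx hy => rw [inner_add_left, hx, hy, add_zero]
    | smul c x _ hx => rw [inner_smul_left, hx, mul_zero]
  have h2 : ‖a - b‖ = 0 := by
    have := inner_self_eq_norm_sq_to_K (𝕜 := ℂ) (a - b)
    rw [h1] at this
    exact pow_eq_zero_iff two_ne_zero |>.mp (Complex.ofReal_injective (by simpa using this.symm))
  rw [← sub_eq_zero, ← UniformSpace.Completion.coe_sub, ← norm_eq_zero,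
    UniformSpace.Completion.norm_coe, h2]

/-- Operators that agree on all matrix coefficients are equal. -/
theorem clm_ext {S T : C.Haar →L[ℂ] C.Haar} (h : ∀ w, S (C.vec w) = T (C.vec w)) : S = T := by
  ext x
  induction x using UniformSpace.Completion.induction_on with
  | hp => exact isClosed_eq S.continuous T.continuous
  | ih a =>
    have ha : a ∈ Submodule.span ℂ (Set.range C.vec) := C.span_vec ▸ Submodule.mem_top
    induction ha using Submodule.span_induction with
    | mem x hx => obtain ⟨w, rfl⟩ := hx; exact h w
    | zero => rw [UniformSpace.Completion.coe_zero, map_zero, map_zero]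
    | add x y _ _ hx hy => rw [UniformSpace.Completion.coe_add, map_add, map_add, hx, hy]
    | smul c x _ hx => rw [UniformSpace.Completion.coe_smul, map_smul, map_smul, hx]

/-- Left multiplication by `u_ij` on formal linear combinations of matrix coefficients. -/
def consLin (i j : Fin n) : C.PreHaar →ₗ[ℂ] C.PreHaar := Finsupp.lmapDomain ℂ ℂ (WordPair.cons i j)

theorem consLin_vec (i j : Fin n) (w : WordPair n) :
    C.consLin i j (C.vec w) = C.vec (w.cons i j) :=
  Finsupp.mapDomain_single

theorem inner_consLin (i j : Fin n) (a b : C.PreHaar) :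
    inner ℂ (C.consLin i j a) b = inner ℂ a (C.consLin i j b) :=
  C.form_mapDomain_cons i j a b

/-- Linear maps whose matrix coefficients agree have the same sesquilinear forms. -/
theorem inner_eq_of_vec {f g : C.PreHaar →ₗ[ℂ] C.PreHaar}
    (h : ∀ w w', inner ℂ (C.vec w) (f (C.vec w')) = inner ℂ (C.vec w) (g (C.vec w')))
    (u v : C.PreHaar) : inner ℂ u (f v) = inner ℂ u (g v) := by
  have hv : v ∈ Submodule.span ℂ (Set.range C.vec) := C.span_vec ▸ Submodule.mem_top
  induction hv using Submodule.span_induction with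
  | mem x hx =>
    obtain ⟨w', rfl⟩ := hx
    have hu : u ∈ Submodule.span ℂ (Set.range C.vec) := C.span_vec ▸ Submodule.mem_top
    induction hu using Submodule.span_induction with
    | mem x hx => obtain ⟨w, rfl⟩ := hx; exact h w w'
    | zero => rw [inner_zero_left, inner_zero_left]
    | add x y _ _ hx hy => rw [inner_add_left, inner_add_left, hx, hy]
    | smul c x _ hx => rw [inner_smul_left, inner_smul_left, hx]
  | zero => rw [map_zero, map_zero]
  | add x y _ _ hx hy => rw [map_add, map_add, inner_add_right, inner_add_right, hx, hy]
  | smul c x _ hx => rw [map_smul, map_smul, inner_smul_right, inner_smul_right, hx]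

theorem inner_sum_consLin (i j : Fin n) (u v : C.PreHaar) :
    inner ℂ u (∑ p, C.consLin p i (C.consLin p j v)) = if i = j then inner ℂ u v else 0 := by
  have h := C.inner_eq_of_vec (f := ∑ p, (C.consLin p i).comp (C.consLin p j))
    (g := if i = j then LinearMap.id else 0) (fun w w' => by
      simp only [LinearMap.sum_apply, LinearMap.comp_apply, consLin_vec, inner_sum, inner_vec]
      refine (C.kernel_cup_left w.2.1 w.2.2 i j w'.2.1 w'.2.2).trans ?_
      split_ifs
      · exact (C.inner_vec w w').symm
      · exact (inner_zero_right _).symm) u v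
  simp only [LinearMap.sum_apply, LinearMap.comp_apply] at h
  rw [h]
  split_ifs
  · rfl
  · exact inner_zero_right _

theorem norm_consLin_le (i j : Fin n) (a : C.PreHaar) : ‖C.consLin i j a‖ ≤ 1 * ‖a‖ := by
  rw [one_mul, ← sq_le_sq₀ (norm_nonneg _) (norm_nonneg _)]
  have h := C.inner_sum_consLin j j a a
  rw [if_pos rfl, inner_sum] at h
  simp_rw [← fun p => C.inner_consLin p j a (C.consLin p j a)] at h
  have h' := congrArg Complex.re h
  rw [Complex.re_sum] at h'
  have hsq (x : C.PreHaar) : (inner ℂ x x : ℂ).re = ‖x‖ ^ 2 := inner_self_eq_norm_sq (𝕜 := ℂ) x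
  simp_rw [hsq] at h'
  rw [← h']
  exact Finset.single_le_sum (f := fun p => ‖C.consLin p j a‖ ^ 2) (fun _ _ => sq_nonneg _)
    (Finset.mem_univ i)

/-- Left multiplication by `u_ij`, as a bounded operator. -/
def op (i j : Fin n) : C.Haar →L[ℂ] C.Haar :=
  ((C.consLin i j).mkContinuous 1 (C.norm_consLin_le i j)).completion

theorem op_coe (i j : Fin n) (a : C.PreHaar) : C.op i j a = (C.consLin i j a : C.PreHaar) := by
  simp [op]

theorem op_vec (i j : Fin n) (w : WordPair n) :
    C.op i j (C.vec w) = (C.vec (w.cons i j) : C.PreHaar) := by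
  rw [op_coe, consLin_vec]

theorem star_op (i j : Fin n) : star (C.op i j) = C.op i j := by
  rw [ContinuousLinearMap.star_eq_adjoint]
  refine Eq.symm ((ContinuousLinearMap.eq_adjoint_iff _ _).mpr fun x y => ?_)
  induction x, y using UniformSpace.Completion.induction_on₂ with
  | hp => apply isClosed_eq <;> fun_prop
  | ih x y =>
    rw [op_coe, op_coe, UniformSpace.Completion.inner_coe, UniformSpace.Completion.inner_coe,
      inner_consLin]

theorem coe_sum {ι : Type} (s : Finset ι) (f : ι → C.PreHaar) :
    ((∑ i ∈ s, f i : C.PreHaar) : C.Haar) = ∑ i ∈ s, (f i : C.Haar) :=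
  map_sum (UniformSpace.Completion.toComplL (𝕜 := ℂ) (E := C.PreHaar)) f s

theorem clm_mul_apply (S T : C.Haar →L[ℂ] C.Haar) (v : C.Haar) : (S * T) v = S (T v) := rfl

theorem ite_one_zero_coe (P : Prop) [Decidable P] (v : C.PreHaar) :
    (if P then (1 : C.Haar →L[ℂ] C.Haar) else 0) v =
      ((if P then v else 0 : C.PreHaar) : C.Haar) := by
  split_ifs
  · rfl
  · exact UniformSpace.Completion.coe_zero.symm

theorem inner_vec_ite (P : Prop) [Decidable P] (w w' : WordPair n) :
    inner ℂ (C.vec w) (if P then C.vec w' else 0) = if P then C.pairKernel w w' else 0 := by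
  split_ifs
  · exact C.inner_vec w w'
  · exact inner_zero_right _

theorem sum_op_mul_op_right (i j : Fin n) :
    ∑ p, C.op i p * C.op j p = if i = j then 1 else 0 := by
  refine C.clm_ext fun w => ?_
  simp only [sum_apply, clm_mul_apply, op_vec]
  rw [← coe_sum, ite_one_zero_coe]
  refine C.coe_eq_coe_of_inner_vec fun w' => ?_
  rw [inner_vec_ite, inner_sum]
  simp only [inner_vec]
  exact C.kernel_cup_right w'.2.1 w'.2.2 i j w.2.1 w.2.2

theorem sum_op_mul_op_left (i j : Fin n) :
    ∑ p, C.op p i * C.op p j = if i = j then 1 else 0 := by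
  refine C.clm_ext fun w => ?_
  simp only [sum_apply, clm_mul_apply, op_vec]
  rw [← coe_sum, ite_one_zero_coe]
  refine C.coe_eq_coe_of_inner_vec fun w' => ?_
  rw [inner_vec_ite, inner_sum]
  simp only [inner_vec]
  exact C.kernel_cup_left w'.2.1 w'.2.2 i j w.2.1 w.2.2

/-- The family of the operators of left multiplication by the coefficients `u_ij`. -/
def ops (p : Fin n × Fin n) : C.Haar →L[ℂ] C.Haar := C.op p.1 p.2

theorem oRel_ops : oRel n (C.Haar →L[ℂ] C.Haar) C.ops := by
  rw [oRel_iff, isUnitaryMatrix_iff]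
  refine ⟨fun i j => C.star_op i j, fun i j => ?_, fun i j => ?_⟩
  · simp only [toMatrix, Matrix.of_apply, ops, star_op]
    exact C.sum_op_mul_op_right i j
  · simp only [toMatrix, Matrix.of_apply, ops, star_op]
    exact C.sum_op_mul_op_left i j

theorem exists_sumsTo_ops (hC : ∀ r, sumMatrix n r ∈ C.Hom (r + 1) (r + 1)) :
    ∃ z, SumsTo (toMatrix C.ops) z := by
  rw [exists_sumsTo_iff]
  intro i j
  refine C.clm_ext fun w => ?_
  simp only [toMatrix, Matrix.of_apply, ops, sum_apply, op_vec]
  rw [← coe_sum, ← coe_sum]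
  refine C.coe_eq_coe_of_inner_vec fun w' => ?_
  simp only [inner_sum, inner_vec]
  exact C.kernel_sum hC w'.2.1 w'.2.2 i j w.2.1 w.2.2

theorem op_mul_op_eq_zero (hC : ∀ r, diagMatrix n r ∈ C.Hom (r + 2) (r + 2)) (i : Fin n)
    {p q : Fin n} (hpq : p ≠ q) : C.op i p * C.op i q = 0 := by
  refine C.clm_ext fun w => ?_
  simp only [clm_mul_apply, op_vec]
  rw [zero_apply, ← UniformSpace.Completion.coe_zero]
  refine C.coe_eq_coe_of_inner_vec fun w' => ?_
  rw [inner_vec, inner_zero_right]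
  exact C.kernel_diag hC w'.2.1 w'.2.2 i hpq w.2.1 w.2.2

theorem entriesPartialIsometries_ops (hC : ∀ r, diagMatrix n r ∈ C.Hom (r + 2) (r + 2)) :
    EntriesPartialIsometries (toMatrix C.ops) := by
  intro i j
  have h : ∑ p, C.op i p * C.op i p * C.op i j = C.op i j := by
    rw [← Finset.sum_mul, sum_op_mul_op_right, if_pos rfl, one_mul]
  rw [Finset.sum_eq_single j (fun p _ hp => by
    rw [mul_assoc, C.op_mul_op_eq_zero hC i hp, mul_zero]) (by simp)] at h
  simp only [toMatrix, Matrix.of_apply, ops, star_op]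
  exact h

/-- The tensor powers of the fundamental matrix map the empty word to the matrix coefficients. -/
theorem wordPower_ops_vec {k : ℕ} (w : Fin k → Bool) (x y : Word n k) :
    wordPower (toMatrix C.ops) w x y (C.vec ⟨0, Fin.elim0, Fin.elim0⟩) =
      (C.vec ⟨k, x, y⟩ : C.PreHaar) := by
  have hconj : conj (toMatrix C.ops) = toMatrix C.ops := C.oRel_ops.1
  simp only [wordPower, Matrix.of_apply, hconj, ite_self]
  induction k with
  | zero =>
    rw [List.ofFn_zero, List.prod_nil, one_apply_eq_self]
    congr 3
    exact Prod.ext (Subsingleton.elim _ _) (Subsingleton.elim _ _)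
  | succ k ih =>
    rw [List.ofFn_succ, List.prod_cons]
    change C.op (x 0) (y 0) ((List.ofFn fun i => toMatrix C.ops (Fin.tail x i)
      (Fin.tail y i)).prod _) = _
    rw [ih (Fin.tail w) (Fin.tail x) (Fin.tail y), op_vec]
    congr 2
    simp only [WordPair.cons, Fin.cons_self_tail]

/-- All intertwiners between tensor powers of the reconstructed fundamental matrix belong to the
given family. -/
theorem intertwiners_ops_le {k l : ℕ} (w : Fin k → Bool) (w' : Fin l → Bool) :
    Intertwiners (wordPower (toMatrix C.ops) w) (wordPower (toMatrix C.ops) w') ≤ C.Hom k l := by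
  intro T hT
  have hT' : scalarMatrix _ T * wordPower (toMatrix C.ops) w =
    wordPower (toMatrix C.ops) w' * scalarMatrix _ T := hT
  -- pair the intertwiner relation, applied to the empty word, with matrix coefficients
  have h1 (x : Word n l) (y₀ : Word n l) (y' : Word n k) :
      ∑ x', T x x' * C.kernel x y₀ x' y' = ∑ y, T y y' * C.kernel x y₀ x y := by
    have hent : ∑ x', algebraMap ℂ (C.Haar →L[ℂ] C.Haar) (T x x') *
        wordPower (toMatrix C.ops) w x' y' = ∑ y, wordPower (toMatrix C.ops) w' x y *
          algebraMap ℂ (C.Haar →L[ℂ] C.Haar) (T y y') := congrFun (congrFun hT' x) y'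
    have hc (c : ℂ) (v : C.Haar) : (algebraMap ℂ (C.Haar →L[ℂ] C.Haar) c) v = c • v := by
      rw [Algebra.algebraMap_eq_smul_one]; rfl
    have hc' (c : ℂ) (X : C.Haar →L[ℂ] C.Haar) :
        X * algebraMap ℂ (C.Haar →L[ℂ] C.Haar) c = c • X := by
      rw [← Algebra.commutes, ← Algebra.smul_def]
    have h := congrArg (fun X : C.Haar →L[ℂ] C.Haar => X (C.vec ⟨0, Fin.elim0, Fin.elim0⟩)) hent
    simp only [sum_apply, clm_mul_apply, hc, hc', smul_apply, wordPower_ops_vec] at h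
    have h' := congrArg (fun v => inner ℂ ((C.vec ⟨l, x, y₀⟩ : C.PreHaar) : C.Haar) v) h
    simp only [inner_sum, inner_smul_right, UniformSpace.Completion.inner_coe, inner_vec] at h'
    exact h'
  have hframe := C.isFrame_frame k l
  have hone := C.isFrame_frame l l
  -- summing over the diagonal recovers `T` on the right-hand side and the frame expansion of the
  -- projection of `T` onto the given space on the left-hand side
  have h2 : T = ∑ α, hs (C.frame k l α) T • C.frame k l α := by
    ext y₀ y'
    have hsum := Finset.sum_congr (rfl : (Finset.univ : Finset (Word n l)) = _)
      fun x _ => h1 x y₀ y'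
    have hR : ∑ x, ∑ y, T y y' * C.kernel x y₀ x y = T y₀ y' := by
      rw [Finset.sum_comm]
      have : ∀ y, ∑ x, T y y' * C.kernel x y₀ x y =
          T y y' * (1 : Matrix (Word n l) (Word n l) ℂ) y₀ y := by
        intro y
        rw [← Finset.mul_sum]
        congr 1
        conv_rhs => rw [hone.2 1 (C.one_mem l)]
        simp only [kernel, Matrix.sum_apply, Matrix.smul_apply, smul_eq_mul, hs_eq_trace,
          Matrix.mul_one, Matrix.trace, Matrix.diag_apply, Matrix.conjTranspose_apply,
          Finset.sum_mul]
        exact Finset.sum_comm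
      simp_rw [this, Matrix.one_apply]
      simp
    have hL : ∑ x, ∑ x', T x x' * C.kernel x y₀ x' y' =
        (∑ α, hs (C.frame k l α) T • C.frame k l α) y₀ y' := by
      simp only [kernel, hs, Matrix.sum_apply, Matrix.smul_apply, smul_eq_mul, Finset.mul_sum,
        Finset.sum_mul]
      conv_lhs => enter [2, x]; rw [Finset.sum_comm]
      rw [Finset.sum_comm]
      refine Finset.sum_congr rfl fun α _ => Finset.sum_congr rfl fun x _ =>
        Finset.sum_congr rfl fun x' _ => ?_
      ring
    rw [← hL, hsum, hR]
  rw [h2]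
  exact Submodule.sum_mem _ fun α _ => Submodule.smul_mem _ _ (hframe.1 α)

end IntertwinerFamily

/-! ### Linear maps given by partitions -/

/-- The indices `f` are constant on the blocks of the partition `P`. -/
def IsConstantOn {α β : Type} (P : Setoid α) (f : α → β) : Prop := ∀ a b, P a b → f a = f b

theorem isConstantOn_comap {α α' β : Type} (P : Setoid α) {e : α' → α}
    (he : Function.Surjective e) (f : α → β) :
    IsConstantOn (P.comap e) (f ∘ e) ↔ IsConstantOn P f := by
  constructor
  · intro h a b hab
    obtain ⟨a, rfl⟩ := he a
    obtain ⟨b, rfl⟩ := he b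
    exact h a b hab
  · exact fun h a b hab => h _ _ hab

theorem isConstantOn_ker {α β γ : Type} {f : α → γ} (g : γ → β) :
    IsConstantOn (Setoid.ker f) (g ∘ f) := fun _ _ h => congrArg g h

open scoped Classical in
theorem partitionMap_apply {n k l : ℕ} (P : Setoid (Fin k ⊕ Fin l)) (y : Word n l)
    (x : Word n k) :
    partitionMap n P y x = if IsConstantOn P (Sum.elim x y) then 1 else 0 := by
  rw [partitionMap, Matrix.of_apply]
  exact if_congr Iff.rfl rfl rfl

theorem partitionMap_eq_ite {n k l : ℕ} (P : Setoid (Fin k ⊕ Fin l)) (y : Word n l)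
    (x : Word n k) (p : Prop) [Decidable p] (h : IsConstantOn P (Sum.elim x y) ↔ p) :
    partitionMap n P y x = if p then 1 else 0 := by
  classical
  rw [partitionMap_apply]
  exact if_congr h rfl rfl

theorem partitionMap_conjTranspose {n k l : ℕ} (P : Setoid (Fin k ⊕ Fin l)) :
    (partitionMap n P).conjTranspose = partitionMap n (P.comap Sum.swap) := by
  classical
  ext y x
  rw [Matrix.conjTranspose_apply, partitionMap_apply, partitionMap_eq_ite (P.comap Sum.swap) y x
    (IsConstantOn P (Sum.elim y x)), apply_ite star, star_one, star_zero]
  rw [← isConstantOn_comap P (e := Sum.swap) fun a => ⟨a.swap, Sum.swap_swap a⟩]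
  rw [show Sum.elim y x ∘ Sum.swap = Sum.elim x y from by ext (a | a) <;> rfl]

/-- The relabeling of points that belongs to the Frobenius rotation. -/
def rotatePoint (k l : ℕ) : Fin (k + 1) ⊕ Fin l → Fin k ⊕ Fin (l + 1) :=
  Sum.elim (Fin.cases (Sum.inr 0) Sum.inl) (fun b => Sum.inr b.succ)

theorem rotatePoint_surjective (k l : ℕ) : Function.Surjective (rotatePoint k l) := by
  rintro (a | b)
  · exact ⟨Sum.inl a.succ, rfl⟩
  · refine Fin.cases ⟨Sum.inl 0, rfl⟩ (fun b => ⟨Sum.inr b, rfl⟩) b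

theorem rotate_partitionMap {n k l : ℕ} (P : Setoid (Fin k ⊕ Fin (l + 1))) :
    rotate (partitionMap n P) = partitionMap n (P.comap (rotatePoint k l)) := by
  classical
  ext y x
  rw [rotate, Matrix.of_apply, partitionMap_apply]
  refine (partitionMap_eq_ite _ _ _ _ ?_).symm
  rw [← isConstantOn_comap P (rotatePoint_surjective k l)]
  have h : Sum.elim (Fin.tail x) (Fin.cons (x 0) y : Word n (l + 1)) ∘ rotatePoint k l =
      Sum.elim x y := by
    ext1 c
    rcases c with a | b
    · refine Fin.cases rfl (fun a => rfl) a
    · rfl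
  rw [h]

theorem partitionMap_one (n k : ℕ) :
    partitionMap n (Setoid.ker (Sum.elim id id : Fin k ⊕ Fin k → Fin k)) = 1 := by
  ext y x
  rw [Matrix.one_apply]
  refine partitionMap_eq_ite _ _ _ _ ⟨fun h => ?_, ?_⟩
  · ext1 a
    exact (h (Sum.inl a) (Sum.inr a) rfl).symm
  · rintro rfl
    rw [show Sum.elim y y = y ∘ Sum.elim id id from by ext (a | a) <;> rfl]
    exact isConstantOn_ker _

/-- The map that identifies the first two of `r + 2` points. -/
def mergeFirst (r : ℕ) : Fin (r + 2) → Option (Fin r) := Fin.cases none (Fin.cases none some)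

theorem partitionMap_cup (n r : ℕ) :
    partitionMap n (Setoid.ker (Sum.elim some (mergeFirst r) : Fin r ⊕ Fin (r + 2) → _)) =
      cupMatrix n r := by
  ext y x
  rw [cupMatrix, Matrix.of_apply]
  refine partitionMap_eq_ite _ _ _ _ ⟨fun h => ⟨h (Sum.inr 0) (Sum.inr 1) rfl, ?_⟩, ?_⟩
  · ext1 a
    exact h (Sum.inr a.succ.succ) (Sum.inl a) rfl
  · rintro ⟨h, rfl⟩
    have : Sum.elim (Fin.tail (Fin.tail y)) y =
        (fun o : Option (Fin r) => o.elim (y 0) (Fin.tail (Fin.tail y))) ∘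
          Sum.elim some (mergeFirst r) := by
      ext1 c
      rcases c with a | b
      · rfl
      · exact Fin.cases rfl (fun b => Fin.cases h.symm (fun b => rfl) b) b
    rw [this]
    exact isConstantOn_ker _

theorem partitionMap_diag (n r : ℕ) :
    partitionMap n (Setoid.ker (Sum.elim (mergeFirst r) (mergeFirst r) :
      Fin (r + 2) ⊕ Fin (r + 2) → _)) = diagMatrix n r := by
  ext y x
  rw [diagMatrix, Matrix.of_apply]
  refine partitionMap_eq_ite _ _ _ _ ⟨fun h => ⟨h (Sum.inr 0) (Sum.inr 1) rfl, ?_⟩, ?_⟩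
  · ext1 a
    exact h (Sum.inr a) (Sum.inl a) rfl
  · rintro ⟨h, rfl⟩
    have hy (b : Fin (r + 2)) : y b = (mergeFirst r b).elim (y 0) (Fin.tail (Fin.tail y)) :=
      Fin.cases rfl (fun b => Fin.cases h.symm (fun b => rfl) b) b
    have : Sum.elim y y = (fun o : Option (Fin r) => o.elim (y 0) (Fin.tail (Fin.tail y))) ∘
        Sum.elim (mergeFirst r) (mergeFirst r) := by
      ext1 c
      rcases c with a | b
      exacts [hy a, hy b]
    rw [this]
    exact isConstantOn_ker _

theorem partitionMap_sum (n r : ℕ) :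
    partitionMap n (Setoid.ker (Sum.elim (Fin.cases (Sum.inl true) Sum.inr)
      (Fin.cases (Sum.inl false) Sum.inr) : Fin (r + 1) ⊕ Fin (r + 1) → Bool ⊕ Fin r)) =
      sumMatrix n r := by
  ext y x
  rw [sumMatrix, Matrix.of_apply]
  refine partitionMap_eq_ite _ _ _ _ ⟨fun h => ?_, fun h => ?_⟩
  · ext1 a
    exact h (Sum.inr a.succ) (Sum.inl a.succ) rfl
  · have : Sum.elim x y = Sum.elim (fun b : Bool => if b then x 0 else y 0) (Fin.tail x) ∘
        Sum.elim (Fin.cases (Sum.inl true) Sum.inr) (Fin.cases (Sum.inl false) Sum.inr) := by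
      ext1 c
      rcases c with a | b
      · exact Fin.cases rfl (fun a => rfl) a
      · exact Fin.cases rfl (fun b => congrFun h b) b
    rw [this]
    exact isConstantOn_ker _

/-- The number of ways to extend indices of outer points to inner points, such that they are
constant on the blocks of a partition, does not depend on the outer indices, as long as there is
such an extension. -/
theorem exists_card_extensions {O I : Type} [Finite O] [Finite I] (Q : Setoid (O ⊕ I)) {n : ℕ}
    (hn : 1 ≤ n) : ∃ N : ℕ, N ≠ 0 ∧ ∀ f : O → Fin n, IsConstantOn (Q.comap Sum.inl) f →
      Nat.card {y : I → Fin n // IsConstantOn Q (Sum.elim f y)} = N := by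
  classical
  have : Nonempty (Fin n) := ⟨⟨0, hn⟩⟩
  let s : Set (Quotient Q) := Set.range fun o : O => Quotient.mk Q (Sum.inl o)
  refine ⟨Nat.card ({q // q ∉ s} → Fin n), Nat.card_pos.ne', fun f hf => ?_⟩
  refine Nat.card_congr (Equiv.ofBijective
    (fun y q => Quotient.lift (Sum.elim f y.1) y.2 q.1) ⟨fun y y' h => ?_, fun g => ?_⟩)
  · refine Subtype.ext (funext fun i => ?_)
    by_cases hi : Quotient.mk Q (Sum.inr i) ∈ s
    · obtain ⟨o, ho⟩ := hi
      have ho' : Q (Sum.inl o) (Sum.inr i) := Quotient.exact ho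
      exact (y.2 _ _ ho').symm.trans (y'.2 _ _ ho')
    · exact congrFun h ⟨_, hi⟩
  · let c : Quotient Q → Fin n := fun q => if h : q ∈ s then f h.choose else g ⟨q, h⟩
    have hc : ∀ a, Sum.elim f (fun i => c (Quotient.mk Q (Sum.inr i))) a = c (Quotient.mk Q a) := by
      rintro (o | i)
      · have ho : Quotient.mk Q (Sum.inl o) ∈ s := ⟨o, rfl⟩
        have h : Q (Sum.inl ho.choose) (Sum.inl o) := Quotient.exact ho.choose_spec
        simp only [Sum.elim_inl, c]
        rw [dif_pos ho]
        exact (hf _ _ h).symm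
      · rfl
    refine ⟨⟨fun i => c (Quotient.mk Q (Sum.inr i)), fun a b hab => ?_⟩, ?_⟩
    · rw [hc, hc]
      exact congrArg c (Quotient.sound hab)
    · funext ⟨q, hq⟩
      induction q using Quotient.inductionOn with
      | h a => exact (hc a).trans (dif_neg hq)

/-- The composition of two partition maps is a nonzero multiple of a partition map. -/
theorem exists_partitionMap_mul {n k l m : ℕ} (hn : 1 ≤ n) (P : Setoid (Fin l ⊕ Fin m))
    (Q : Setoid (Fin k ⊕ Fin l)) : ∃ (N : ℕ) (R : Setoid (Fin k ⊕ Fin m)), N ≠ 0 ∧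
      partitionMap n P * partitionMap n Q = (N : ℂ) • partitionMap n R := by
  classical
  let φ : Fin l ⊕ Fin m → (Fin k ⊕ Fin m) ⊕ Fin l := Sum.elim Sum.inr (Sum.inl ∘ Sum.inr)
  let ψ : Fin k ⊕ Fin l → (Fin k ⊕ Fin m) ⊕ Fin l := Sum.elim (Sum.inl ∘ Sum.inl) Sum.inr
  let S : Setoid ((Fin k ⊕ Fin m) ⊕ Fin l) := Relation.EqvGen.setoid fun a b =>
    (∃ c d, P c d ∧ φ c = a ∧ φ d = b) ∨ (∃ c d, Q c d ∧ ψ c = a ∧ ψ d = b)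
  have hS (f : (Fin k ⊕ Fin m) ⊕ Fin l → Fin n) : IsConstantOn S f ↔
      IsConstantOn P (f ∘ φ) ∧ IsConstantOn Q (f ∘ ψ) := by
    constructor
    · intro h
      exact ⟨fun c d hcd => h _ _ (.rel _ _ (.inl ⟨c, d, hcd, rfl, rfl⟩)),
        fun c d hcd => h _ _ (.rel _ _ (.inr ⟨c, d, hcd, rfl, rfl⟩))⟩
    · rintro ⟨h1, h2⟩ a b hab
      have hle : S ≤ Setoid.ker f := by
        refine Setoid.eqvGen_le ?_
        rintro _ _ (⟨c, d, hcd, rfl, rfl⟩ | ⟨c, d, hcd, rfl, rfl⟩)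
        exacts [h1 c d hcd, h2 c d hcd]
      exact hle hab
  obtain ⟨N, hN0, hN⟩ := exists_card_extensions S hn
  refine ⟨N, S.comap Sum.inl, hN0, ?_⟩
  ext z x
  have hterm (y : Word n l) : partitionMap n P z y * partitionMap n Q y x =
      if IsConstantOn S (Sum.elim (Sum.elim x z) y) then 1 else 0 := by
    have h1 : Sum.elim (Sum.elim x z) y ∘ φ = Sum.elim y z := by ext (a | a) <;> rfl
    have h2 : Sum.elim (Sum.elim x z) y ∘ ψ = Sum.elim x y := by ext (a | a) <;> rfl
    rw [partitionMap_apply, partitionMap_apply, ite_zero_mul_ite_zero, one_mul]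
    exact if_congr (by rw [hS, h1, h2]) rfl rfl
  rw [Matrix.mul_apply, Matrix.smul_apply, partitionMap_apply]
  simp_rw [hterm]
  rw [Finset.sum_boole, smul_eq_mul]
  split_ifs with h
  · rw [mul_one, ← hN _ h, Nat.card_eq_fintype_card, Fintype.card_subtype]
  · rw [mul_zero, Finset.filter_eq_empty_iff.mpr, Finset.card_empty, Nat.cast_zero]
    intro y _ hy
    exact h fun a b hab => hy _ _ hab

namespace IntertwinerFamily

variable {n : ℕ} (C : IntertwinerFamily n)

/-- The partitions whose linear maps belong to the family. -/
def partitions (k l : ℕ) : Set (Setoid (Fin k ⊕ Fin l)) := {P | partitionMap n P ∈ C.Hom k l}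

theorem span_partitions_le (k l : ℕ) :
    Submodule.span ℂ (partitionMap n '' C.partitions k l) ≤ C.Hom k l :=
  Submodule.span_le.mpr (by rintro _ ⟨P, hP, rfl⟩; exact hP)

variable {C} in
theorem mem_span_partitions {k l : ℕ} {P : Setoid (Fin k ⊕ Fin l)}
    {T : Matrix (Word n l) (Word n k) ℂ} (h : partitionMap n P = T) (hT : T ∈ C.Hom k l) :
    T ∈ Submodule.span ℂ (partitionMap n '' C.partitions k l) :=
  Submodule.subset_span ⟨P, (h ▸ hT : partitionMap n P ∈ C.Hom k l), h⟩

/-- The subfamily spanned by partition maps: it has the same closure properties, since the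
operations turn partition maps into multiples of partition maps. -/
def partitionPart (hn : 1 ≤ n) : IntertwinerFamily n where
  Hom k l := Submodule.span ℂ (partitionMap n '' C.partitions k l)
  one_mem k := mem_span_partitions (partitionMap_one n k) (C.one_mem k)
  mul_mem {k l m S T} hS hT := by
    induction hS using Submodule.span_induction with
    | mem S hS =>
      obtain ⟨P, hP, rfl⟩ := hS
      induction hT using Submodule.span_induction with
      | mem T hT =>
        obtain ⟨Q, hQ, rfl⟩ := hT
        obtain ⟨N, R, hN, hR⟩ := exists_partitionMap_mul hn P Q
        have hmem : (N : ℂ) • partitionMap n R ∈ C.Hom k m := hR ▸ C.mul_mem hP hQ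
        have hN' : (N : ℂ) ≠ 0 := Nat.cast_ne_zero.mpr hN
        rw [hR]
        exact Submodule.smul_mem _ _ (Submodule.subset_span
          ⟨R, (Submodule.smul_mem_iff _ hN').mp hmem, rfl⟩)
      | zero => rw [Matrix.mul_zero]; exact Submodule.zero_mem _
      | add T T' _ _ h h' => rw [Matrix.mul_add]; exact Submodule.add_mem _ h h'
      | smul c T _ h => rw [Matrix.mul_smul]; exact Submodule.smul_mem _ c h
    | zero => rw [Matrix.zero_mul]; exact Submodule.zero_mem _
    | add S S' _ _ h h' => rw [Matrix.add_mul]; exact Submodule.add_mem _ h h'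
    | smul c S _ h => rw [Matrix.smul_mul]; exact Submodule.smul_mem _ c h
  star_mem {k l T} hT := by
    induction hT using Submodule.span_induction with
    | mem T hT =>
      obtain ⟨P, hP, rfl⟩ := hT
      exact mem_span_partitions (partitionMap_conjTranspose P).symm (C.star_mem hP)
    | zero => rw [Matrix.conjTranspose_zero]; exact Submodule.zero_mem _
    | add T T' _ _ h h' => rw [Matrix.conjTranspose_add]; exact Submodule.add_mem _ h h'
    | smul c T _ h => rw [Matrix.conjTranspose_smul]; exact Submodule.smul_mem _ _ h
  rotate_mem {k l T} hT := by
    induction hT using Submodule.span_induction with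
    | mem T hT =>
      obtain ⟨P, hP, rfl⟩ := hT
      exact mem_span_partitions (rotate_partitionMap P).symm (C.rotate_mem hP)
    | zero => exact Submodule.zero_mem _
    | add T T' _ _ h h' => exact Submodule.add_mem _ h h'
    | smul c T _ h => exact Submodule.smul_mem _ c h
  cup_mem r := mem_span_partitions (partitionMap_cup n r) (C.cup_mem r)

end IntertwinerFamily

/-! ### Intertwiners of a self-conjugate unitary matrix -/

section TensorPower

variable {n : ℕ} {A : Type} [CStarAlgebra A] {U : Matrix (Fin n) (Fin n) A}

/-- The `k`-th tensor power of the matrix `U`. -/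
def tensorPower (U : Matrix (Fin n) (Fin n) A) (k : ℕ) : Matrix (Word n k) (Word n k) A :=
  Matrix.of fun x y => (List.ofFn fun a => U (x a) (y a)).prod

theorem wordPower_eq_tensorPower (hs : ∀ i j, star (U i j) = U i j) {k : ℕ} (w : Fin k → Bool) :
    wordPower U w = tensorPower U k := by
  have hconj : conj U = U := Matrix.ext hs
  simp only [wordPower, tensorPower, hconj, ite_self]

theorem tensorPower_zero (x y : Word n 0) : tensorPower U 0 x y = 1 := by
  rw [tensorPower, Matrix.of_apply, List.ofFn_zero, List.prod_nil]

theorem tensorPower_cons {k : ℕ} (i j : Fin n) (x y : Word n k) :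
    tensorPower U (k + 1) (Fin.cons i x) (Fin.cons j y) = U i j * tensorPower U k x y := by
  rw [tensorPower, Matrix.of_apply, List.ofFn_succ, List.prod_cons]
  rfl

theorem isUnitaryMatrix_tensorPower (hU : IsUnitaryMatrix U) (k : ℕ) :
    IsUnitaryMatrix (tensorPower U k) := by
  induction k with
  | zero =>
    rw [isUnitaryMatrix_iff]
    constructor <;> intro x y <;>
    simp [tensorPower_zero, Subsingleton.elim x y]
  | succ k ih =>
    rw [isUnitaryMatrix_iff] at ih hU ⊢
    constructor
    · intro x y
      induction x using Fin.consCases with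
      | cons i x =>
      induction y using Fin.consCases with
      | cons j y =>
      have h (p : Fin n) (z : Word n k) :
          tensorPower U (k + 1) (Fin.cons i x) (Fin.cons p z) *
            star (tensorPower U (k + 1) (Fin.cons j y) (Fin.cons p z)) =
          U i p * (tensorPower U k x z * star (tensorPower U k y z)) * star (U j p) := by
        rw [tensorPower_cons, tensorPower_cons, star_mul]
        simp only [mul_assoc]
      rw [IntertwinerFamily.sum_word_succ]
      simp_rw [h, ← Finset.sum_mul, ← Finset.mul_sum, ih.1, mul_ite, mul_one, mul_zero, ite_mul,
        zero_mul, Fin.cons_inj]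
      by_cases hxy : x = y
      · simp [hxy, hU.1]
      · simp [hxy]
    · intro x y
      induction x using Fin.consCases with
      | cons i x =>
      induction y using Fin.consCases with
      | cons j y =>
      have h (p : Fin n) (z : Word n k) :
          star (tensorPower U (k + 1) (Fin.cons p z) (Fin.cons i x)) *
            tensorPower U (k + 1) (Fin.cons p z) (Fin.cons j y) =
          star (tensorPower U k z x) * (star (U p i) * U p j) * tensorPower U k z y := by
        rw [tensorPower_cons, tensorPower_cons, star_mul]
        simp only [mul_assoc]
      rw [IntertwinerFamily.sum_word_succ, Finset.sum_comm]
      simp_rw [h, ← Finset.sum_mul, ← Finset.mul_sum, hU.2, mul_ite, mul_one, mul_zero, ite_mul,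
        zero_mul, Fin.cons_inj]
      by_cases hij : i = j
      · simp [hij, ih.2]
      · simp [hij]

theorem mem_intertwiners_iff {m m' : Type} [Fintype m] [Fintype m'] [DecidableEq m]
    [DecidableEq m'] {V : Matrix m m A} {W : Matrix m' m' A} {T : Matrix m' m ℂ} :
    T ∈ Intertwiners V W ↔ ∀ y x, ∑ s, T y s • V s x = ∑ t, T t x • W y t := by
  change scalarMatrix A T * V = W * scalarMatrix A T ↔ _
  rw [← Matrix.ext_iff]
  refine forall₂_congr fun y x => ?_
  simp only [Matrix.mul_apply, scalarMatrix, Matrix.map_apply, Algebra.smul_def,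
    ← Algebra.commutes]

theorem conjTranspose_mem_intertwiners {m m' : Type} [Fintype m] [Fintype m'] [DecidableEq m]
    [DecidableEq m'] {V : Matrix m m A} {W : Matrix m' m' A} (hV : IsUnitaryMatrix V)
    (hW : IsUnitaryMatrix W) {T : Matrix m' m ℂ} (hT : T ∈ Intertwiners V W) :
    T.conjTranspose ∈ Intertwiners W V := by
  change scalarMatrix A T * V = W * scalarMatrix A T at hT
  change scalarMatrix A T.conjTranspose * W = V * scalarMatrix A T.conjTranspose
  have h := congrArg Matrix.conjTranspose hT
  rw [Matrix.conjTranspose_mul, Matrix.conjTranspose_mul, scalarMatrix_conjTranspose] at h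
  calc scalarMatrix A T.conjTranspose * W
      = V * (V.conjTranspose * scalarMatrix A T.conjTranspose) * W := by
        rw [← Matrix.mul_assoc V, hV.1, Matrix.one_mul]
    _ = V * scalarMatrix A T.conjTranspose := by
        rw [h, Matrix.mul_assoc, Matrix.mul_assoc, hW.2, Matrix.mul_one]

theorem rotate_mem_intertwiners (hL : ∀ i j, ∑ p, U p i * U p j = if i = j then 1 else 0)
    {k l : ℕ} {T : Matrix (Word n (l + 1)) (Word n k) ℂ}
    (hT : T ∈ Intertwiners (tensorPower U k) (tensorPower U (l + 1))) :
    rotate T ∈ Intertwiners (tensorPower U (k + 1)) (tensorPower U l) := by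
  rw [mem_intertwiners_iff] at hT ⊢
  intro y x
  induction x using Fin.consCases with
  | cons c x =>
  rw [IntertwinerFamily.sum_word_succ]
  calc ∑ b, ∑ s, rotate T y (Fin.cons b s) • tensorPower U (k + 1) (Fin.cons b s) (Fin.cons c x)
      = ∑ b, U b c * ∑ s, T (Fin.cons b y) s • tensorPower U k s x := by
        simp_rw [Finset.mul_sum, tensorPower_cons, mul_smul_comm]
        rfl
    _ = ∑ b, ∑ p, ∑ t, T (Fin.cons p t) x • (U b c * U b p * tensorPower U l y t) := by
        refine Finset.sum_congr rfl fun b _ => ?_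
        rw [hT, IntertwinerFamily.sum_word_succ]
        simp_rw [Finset.mul_sum, tensorPower_cons, mul_smul_comm, mul_assoc]
    _ = ∑ p, ∑ t, T (Fin.cons p t) x • ((if c = p then 1 else 0) * tensorPower U l y t) := by
        rw [Finset.sum_comm]
        refine Finset.sum_congr rfl fun p _ => ?_
        rw [Finset.sum_comm]
        refine Finset.sum_congr rfl fun t _ => ?_
        rw [← Finset.smul_sum, ← Finset.sum_mul, hL]
    _ = ∑ t, T (Fin.cons c t) x • tensorPower U l y t := by
        rw [Finset.sum_comm]
        refine Finset.sum_congr rfl fun t _ => ?_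
        simp only [ite_mul, one_mul, zero_mul, smul_ite, smul_zero, Finset.sum_ite_eq,
          Finset.mem_univ, if_true]

theorem cupMatrix_mem_intertwiners (hR : ∀ i j, ∑ p, U i p * U j p = if i = j then 1 else 0)
    (r : ℕ) : cupMatrix n r ∈ Intertwiners (tensorPower U r) (tensorPower U (r + 2)) := by
  rw [mem_intertwiners_iff]
  intro y x
  induction y using Fin.consCases with
  | cons i y =>
  induction y using Fin.consCases with
  | cons j y =>
  have h (p q : Fin n) (t : Word n r) :
      cupMatrix n r (Fin.cons p (Fin.cons q t : Word n (r + 1))) x •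
        tensorPower U (r + 2) (Fin.cons i (Fin.cons j y : Word n (r + 1)))
          (Fin.cons p (Fin.cons q t : Word n (r + 1))) =
      if t = x then if p = q then U i p * U j q * tensorPower U r y t else 0 else 0 := by
    rw [IntertwinerFamily.cupMatrix_cons, tensorPower_cons, tensorPower_cons, ← mul_assoc,
      ← ite_and, ite_smul, one_smul, zero_smul]
    exact if_congr and_comm rfl rfl
  have h' (t : Word n r) :
      cupMatrix n r (Fin.cons i (Fin.cons j y : Word n (r + 1))) t • tensorPower U r t x =
      if y = t then if i = j then tensorPower U r t x else 0 else 0 := by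
    rw [IntertwinerFamily.cupMatrix_cons, ← ite_and, ite_smul, one_smul, zero_smul]
    exact if_congr and_comm rfl rfl
  have hleft : ∑ t, (if y = t then if i = j then tensorPower U r t x else 0 else 0) =
      if i = j then tensorPower U r y x else 0 := by
    rw [Finset.sum_ite_eq, if_pos (Finset.mem_univ _)]
  have hright (p q : Fin n) : ∑ t, (if t = x then if p = q then
      U i p * U j q * tensorPower U r y t else 0 else 0) =
      if p = q then U i p * U j q * tensorPower U r y x else 0 := by
    rw [Finset.sum_ite_eq', if_pos (Finset.mem_univ _)]
  refine (Finset.sum_congr rfl fun t _ => h' t).trans (hleft.trans ?_)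
  rw [IntertwinerFamily.sum_word_succ]
  simp_rw [IntertwinerFamily.sum_word_succ, h]
  refine Eq.trans ?_ (Finset.sum_congr rfl fun p _ => Finset.sum_congr rfl fun q _ =>
    (hright p q).symm)
  obtain ⟨c, hc⟩ : ∃ c, c = tensorPower U r y x := ⟨_, rfl⟩
  rw [← hc]
  simp only [Finset.sum_ite_eq, Finset.mem_univ, if_true, ← Finset.sum_mul, hR, ite_mul, one_mul,
    zero_mul]

theorem sumMatrix_mem_intertwiners {z : A} (hz : SumsTo U z) (r : ℕ) :
    sumMatrix n r ∈ Intertwiners (tensorPower U (r + 1)) (tensorPower U (r + 1)) := by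
  rw [mem_intertwiners_iff]
  intro y x
  induction y using Fin.consCases with
  | cons i y =>
  induction x using Fin.consCases with
  | cons j x =>
  have h0 (p q : Fin n) (t u : Word n r) : sumMatrix n r (Fin.cons p t) (Fin.cons q u) =
      if t = u then 1 else 0 := rfl
  simp_rw [IntertwinerFamily.sum_word_succ, h0, tensorPower_cons, ite_smul, one_smul, zero_smul,
    Finset.sum_ite_eq, Finset.sum_ite_eq', Finset.mem_univ, if_true, ← Finset.sum_mul, hz.1, hz.2]

theorem diagMatrix_mem_intertwiners (hR : ∀ i j k, j ≠ k → U i j * U i k = 0)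
    (hL : ∀ i j k, j ≠ k → U j i * U k i = 0) (r : ℕ) :
    diagMatrix n r ∈ Intertwiners (tensorPower U (r + 2)) (tensorPower U (r + 2)) := by
  rw [mem_intertwiners_iff]
  intro y x
  have h0 (s t : Word n (r + 2)) : diagMatrix n r s t =
      if s = t then if s 0 = s 1 then 1 else 0 else 0 := by
    rw [diagMatrix, Matrix.of_apply, ← ite_and]
    exact if_congr and_comm rfl rfl
  simp_rw [h0, ite_smul, zero_smul, Finset.sum_ite_eq, Finset.sum_ite_eq', Finset.mem_univ,
    if_true, one_smul]
  induction y using Fin.consCases with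
  | cons i y =>
  induction y using Fin.consCases with
  | cons j y =>
  induction x using Fin.consCases with
  | cons p x =>
  induction x using Fin.consCases with
  | cons q x =>
  rw [tensorPower_cons, tensorPower_cons, ← mul_assoc]
  change (if i = j then _ else _) = if p = q then _ else _
  by_cases hij : i = j <;> by_cases hpq : p = q
  · rw [if_pos hij, if_pos hpq]
  · rw [if_pos hij, if_neg hpq, ← hij, hR _ _ _ hpq, zero_mul]
  · rw [if_neg hij, if_pos hpq, ← hpq, hL _ _ _ hij, zero_mul]
  · rw [if_neg hij, if_neg hpq]

/-- The intertwiners between the tensor powers of a self-conjugate unitary matrix. -/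
def intertwinerFamily (hs : ∀ i j, star (U i j) = U i j) (hU : IsUnitaryMatrix U) :
    IntertwinerFamily n where
  Hom k l := Intertwiners (tensorPower U k) (tensorPower U l)
  one_mem k := by
    change scalarMatrix A 1 * _ = _ * scalarMatrix A 1
    rw [scalarMatrix_one, Matrix.one_mul, Matrix.mul_one]
  mul_mem {k l m S T} hS hT := by
    change scalarMatrix A _ * _ = _ * scalarMatrix A _ at hS hT ⊢
    rw [scalarMatrix_mul, Matrix.mul_assoc, hT, ← Matrix.mul_assoc, hS, Matrix.mul_assoc]
  star_mem hT := conjTranspose_mem_intertwiners (isUnitaryMatrix_tensorPower hU _)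
    (isUnitaryMatrix_tensorPower hU _) hT
  rotate_mem hT := rotate_mem_intertwiners
    (fun i j => by simpa only [hs] using (isUnitaryMatrix_iff.mp hU).2 i j) hT
  cup_mem r := cupMatrix_mem_intertwiners
    (fun i j => by simpa only [hs] using (isUnitaryMatrix_iff.mp hU).1 i j) r

end TensorPower

/-! ### Orthogonal free quantum groups defined by relations -/

theorem map_wordPower {A B : Type} [CStarAlgebra A] [CStarAlgebra B] {m : Type} [Fintype m]
    [DecidableEq m] (f : A →⋆ₐ[ℂ] B) (U : Matrix m m A) {k : ℕ} (w : Fin k → Bool) :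
    (wordPower U w).map f = wordPower (U.map f) w := by
  ext x y
  simp only [wordPower, Matrix.map_apply, Matrix.of_apply, map_list_prod, List.map_ofFn]
  congr 2
  funext a
  simp only [Function.comp_apply, conj]
  split_ifs <;> simp [map_star]

theorem map_mem_intertwiners {A B : Type} [CStarAlgebra A] [CStarAlgebra B] {m m' : Type}
    [Fintype m] [DecidableEq m] [Fintype m'] [DecidableEq m'] (f : A →⋆ₐ[ℂ] B)
    {V : Matrix m m A} {W : Matrix m' m' A} {T : Matrix m' m ℂ} (hT : T ∈ Intertwiners V W) :
    T ∈ Intertwiners (V.map f) (W.map f) := by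
  change scalarMatrix A T * V = W * scalarMatrix A T at hT
  change scalarMatrix B T * V.map f = W.map f * scalarMatrix B T
  rw [← scalarMatrix_map f, ← map_mul_starAlgHom, ← map_mul_starAlgHom, hT]

theorem Relations.IsQuantum.star_gen {n : ℕ} {P : Relations (Fin n × Fin n)} (hQ : P.IsQuantum)
    (hP : P.Bounded) (i j : Fin n) :
    star ((universalPair P hP).U i j) = (universalPair P hP).U i j :=
  (oRel_iff.mp (hQ.isOrthogonal _ _ (hQ.gen hP))).1 i j

/-- The intertwiners between the tensor powers of the fundamental matrix of a universal
C*-algebra. -/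
def universalFamily {n : ℕ} {P : Relations (Fin n × Fin n)} (hP : P.Bounded) (hQ : P.IsQuantum) :
    IntertwinerFamily n :=
  intertwinerFamily (hQ.star_gen hP) (hQ.isOrthogonal _ _ (hQ.gen hP)).2

/-- If the relations `P` lie between those of `A_o(n)` and `A_s(n)`, and if they hold in the quantum
group that is reconstructed from the partition maps among the intertwiners, then this quantum group
is a quotient of the universal one, and all intertwiners of the latter are spanned by partition
maps. -/
theorem isOrthogonalFree_universalCMQG {n : ℕ} (hn : 1 ≤ n) {P : Relations (Fin n × Fin n)}
    (hP : P.Bounded) (hQ : P.IsQuantum)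
    (hs : ∀ (B : Type) [CStarAlgebra B] (v : Fin n × Fin n → B), sRel n B v → P B v)
    (hops : P (((universalFamily hP hQ).partitionPart hn).Haar →L[ℂ]
      ((universalFamily hP hQ).partitionPart hn).Haar)
      ((universalFamily hP hQ).partitionPart hn).ops) :
    (universalCMQG P hP hQ).IsOrthogonalFree := by
  refine ⟨⟨UniversalCStar.lift (oRel n) _ _ (hQ.isOrthogonal _ _ (hQ.gen hP)), fun i j =>
    UniversalCStar.lift_gen _ _ _ _ _⟩, ⟨UniversalCStar.lift P hP _
      (hs _ _ ((sRel_isQuantum n).gen _)), fun i j => UniversalCStar.lift_gen _ _ _ _ _⟩,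
    fun k l w w' => ⟨(universalFamily hP hQ).partitions k l, le_antisymm ?_ ?_⟩⟩
  · intro T hT
    obtain ⟨π, hπ⟩ : ∃ π : (universalCMQG P hP hQ).carrier →⋆ₐ[ℂ]
        (((universalFamily hP hQ).partitionPart hn).Haar →L[ℂ]
          ((universalFamily hP hQ).partitionPart hn).Haar),
        (universalCMQG P hP hQ).U.map π =
          toMatrix ((universalFamily hP hQ).partitionPart hn).ops :=
      ⟨UniversalCStar.lift P hP _ hops,
        Matrix.ext fun i j => UniversalCStar.lift_gen P hP _ hops (i, j)⟩
    have h := map_mem_intertwiners π hT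
    rw [map_wordPower, map_wordPower, hπ] at h
    exact ((universalFamily hP hQ).partitionPart hn).intertwiners_ops_le w w' h
  · have h := (universalFamily hP hQ).span_partitions_le k l
    have e {k : ℕ} (w : Fin k → Bool) : wordPower (universalCMQG P hP hQ).U w =
        tensorPower (universalPair P hP).U k := wordPower_eq_tensorPower (hQ.star_gen hP) w
    rw [e w, e w']
    exact h

theorem sumMatrix_mem_partitionPart {n : ℕ} (hn : 1 ≤ n) {P : Relations (Fin n × Fin n)}
    (hP : P.Bounded) (hQ : P.IsQuantum) (hz : ∃ z, SumsTo (universalPair P hP).U z) (r : ℕ) :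
    sumMatrix n r ∈ ((universalFamily hP hQ).partitionPart hn).Hom (r + 1) (r + 1) :=
  IntertwinerFamily.mem_span_partitions (partitionMap_sum n r)
    (hz.elim fun _ hz => sumMatrix_mem_intertwiners hz r)

theorem diagMatrix_mem_partitionPart {n : ℕ} (hn : 1 ≤ n) {P : Relations (Fin n × Fin n)}
    (hP : P.Bounded) (hQ : P.IsQuantum) (hp : EntriesPartialIsometries (universalPair P hP).U)
    (r : ℕ) : diagMatrix n r ∈ ((universalFamily hP hQ).partitionPart hn).Hom (r + 2) (r + 2) := by
  have hs := hQ.star_gen hP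
  have hU : IsUnitaryMatrix (universalPair P hP).U := (hQ.isOrthogonal _ _ (hQ.gen hP)).2
  refine IntertwinerFamily.mem_span_partitions (partitionMap_diag n r)
    (diagMatrix_mem_intertwiners (fun i j k hjk => row_mul_eq_zero hs hU hp i hjk)
      (fun i j k hjk => ?_) r)
  refine row_mul_eq_zero (u := (universalPair P hP).U.transpose) (fun i j => hs j i) ?_
    (fun i j => hp j i) i hjk
  -- the transpose of a unitary matrix with self-adjoint entries is unitary
  have hU' := isUnitaryMatrix_iff.mp hU
  refine isUnitaryMatrix_iff.mpr ⟨fun i j => ?_, fun i j => ?_⟩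
  · simpa only [hs, Matrix.transpose_apply] using hU'.2 i j
  · simpa only [hs, Matrix.transpose_apply] using hU'.1 i j

theorem isOrthogonalFree_bPrime {n : ℕ} (hn : 1 ≤ n) (hP : (bPrimeRel n).Bounded) :
    (universalCMQG (bPrimeRel n) hP (bPrimeRel_isQuantum n)).IsOrthogonalFree :=
  isOrthogonalFree_universalCMQG hn hP _ (fun _ _ _ h => ⟨h.1, 1, h.2.2⟩)
    ⟨IntertwinerFamily.oRel_ops _, IntertwinerFamily.exists_sumsTo_ops _
      (sumMatrix_mem_partitionPart hn hP _ ((bPrimeRel_isQuantum n).gen hP).2)⟩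

theorem isOrthogonalFree_sPrime {n : ℕ} (hn : 1 ≤ n) (hP : (sPrimeRel n).Bounded) :
    (universalCMQG (sPrimeRel n) hP (sPrimeRel_isQuantum n)).IsOrthogonalFree :=
  isOrthogonalFree_universalCMQG hn hP _ (fun _ _ _ h => ⟨h.1, h.2.1, 1, h.2.2⟩)
    ⟨IntertwinerFamily.oRel_ops _,
      IntertwinerFamily.entriesPartialIsometries_ops _
        (diagMatrix_mem_partitionPart hn hP _ ((sPrimeRel_isQuantum n).gen hP).2.1),
      IntertwinerFamily.exists_sumsTo_ops _
        (sumMatrix_mem_partitionPart hn hP _ ((sPrimeRel_isQuantum n).gen hP).2.2)⟩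

/-! ### The one-dimensional subcorepresentation -/

/-- If all rows and columns of the fundamental matrix sum up to `z`, and if `z` is nontrivial under
some character, then `z` is a nontrivial invertible direct summand of it. -/
theorem CMQG.exists_contains_invertible {n : ℕ} (hn : 1 ≤ n) (G : CMQG n) {z : G.carrier}
    (hz : SumsTo G.U z) {χ : G.carrier →⋆ₐ[ℂ] ℂ} (hχ : χ z ≠ 1) :
    G.IsCorep (Matrix.of fun _ _ : Fin 1 => z) ∧
      G.Contains G.U (Matrix.of fun _ _ : Fin 1 => z) ∧
      ¬ Equivalent (Matrix.of fun _ _ : Fin 1 => z) (1 : Matrix (Fin 1) (Fin 1) G.carrier) ∧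
      Equivalent (tensor (Matrix.of fun _ _ : Fin 1 => z)
        (conj (Matrix.of fun _ _ : Fin 1 => z))) (1 : Matrix (Fin 1) (Fin 1) G.carrier) := by
  refine ⟨G.isCorep_of_sumsTo hn hz, G.contains_of_sumsTo hn hz, fun h => hχ ?_,
    equivalent_of_entry (0, 0) 0 ?_⟩
  · rw [CMQG.eq_one_of_equivalent_one h, map_one]
  · rw [Matrix.one_apply_eq]
    exact (G.unitary_of_sumsTo hn hz).2

/-- The relations of `A_s'(n)` hold for the scalar matrices `1` and `-1`. -/
theorem sPrimeRel_scalar (n : ℕ) {c : ℂ} (hc : c = 1 ∨ c = -1) :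
    sPrimeRel n ℂ (fun p => if p.1 = p.2 then c else 0) ∧
      SumsTo (toMatrix fun p : Fin n × Fin n => if p.1 = p.2 then c else 0) c := by
  have hsum : SumsTo (toMatrix fun p : Fin n × Fin n => if p.1 = p.2 then c else 0) c := by
    constructor <;> simp [toMatrix]
  have hstar : star c = c := by rcases hc with rfl | rfl <;> simp
  have hsq : c * c = 1 := by rcases hc with rfl | rfl <;> simp
  refine ⟨⟨oRel_iff.mpr ⟨fun i j => ?_, isUnitaryMatrix_iff.mpr ⟨fun i j => ?_, fun i j => ?_⟩⟩,
    fun i j => ?_, c, hsum⟩, hsum⟩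
  · simp only [apply_ite star, star_zero, hstar]
  all_goals simp only [toMatrix, Matrix.of_apply, apply_ite star, star_zero, hstar]
  · simp [hsq]
  · simp [hsq, eq_comm]
  · split_ifs <;> simp [hsq]

theorem sRel_scalar (n : ℕ) : sRel n ℂ (fun p => if p.1 = p.2 then 1 else 0) :=
  have h := sPrimeRel_scalar n (Or.inl rfl)
  ⟨h.1.1, h.1.2.1, h.2⟩

/-- Scalars that satisfy the relations define a character of the universal C*-algebra. -/
theorem exists_character {n : ℕ} {P : Relations (Fin n × Fin n)} (hP : P.Bounded)
    {v : Fin n × Fin n → ℂ} (hv : P ℂ v) :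
    ∃ χ : (universalPair P hP).carrier →⋆ₐ[ℂ] ℂ,
      ∀ i j, χ ((universalPair P hP).U i j) = v (i, j) :=
  ⟨UniversalCStar.lift P hP v hv, fun i j => UniversalCStar.lift_gen P hP v hv (i, j)⟩

theorem SumsTo.apply_eq {n : ℕ} (hn : 1 ≤ n) {A : Type} [CStarAlgebra A]
    {U : Matrix (Fin n) (Fin n) A} {z : A} (hz : SumsTo U z) {χ : A →⋆ₐ[ℂ] ℂ} {c : ℂ}
    {v : Fin n × Fin n → ℂ} (hv : SumsTo (toMatrix v) c) (hχ : ∀ i j, χ (U i j) = v (i, j)) :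
    χ z = c := by
  rw [← hz.1 ⟨0, hn⟩, ← hv.1 ⟨0, hn⟩, map_sum]
  exact Finset.sum_congr rfl fun j _ => hχ _ _

/-- If the relations imply that all row and column sums agree, and if they hold for the scalar
matrices `1` and `-1`, then these two characters separate the row sum from `1` and `-1`. -/
theorem universalCMQG_invertible_and_not_free {n : ℕ} (hn : 1 ≤ n)
    {P : Relations (Fin n × Fin n)} (hP : P.Bounded)
    (hQ : P.IsQuantum) (hz : ∃ z, SumsTo (universalPair P hP).U z)
    (hs : ∀ v : Fin n × Fin n → ℂ, sPrimeRel n ℂ v → P ℂ v) :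
    (∃ z : Matrix (Fin 1) (Fin 1) (universalCMQG P hP hQ).carrier,
      (universalCMQG P hP hQ).IsCorep z ∧
      (universalCMQG P hP hQ).Contains (universalCMQG P hP hQ).U z ∧
      ¬ Equivalent z (1 : Matrix (Fin 1) (Fin 1) (universalCMQG P hP hQ).carrier) ∧
      Equivalent (tensor z (conj z)) (1 : Matrix (Fin 1) (Fin 1) (universalCMQG P hP hQ).carrier) ∧
      Equivalent z (conj z)) ∧
    ¬ (universalCMQG P hP hQ).HasFreeFusionRing := by
  obtain ⟨z, hz⟩ := hz
  have h1 := sPrimeRel_scalar n (Or.inl rfl)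
  have h2 := sPrimeRel_scalar n (Or.inr rfl)
  obtain ⟨χ₁, hχ₁⟩ := exists_character hP (hs _ h1.1)
  obtain ⟨χ₂, hχ₂⟩ := exists_character hP (hs _ h2.1)
  replace hχ₁ := hz.apply_eq hn h1.2 hχ₁
  replace hχ₂ := hz.apply_eq hn h2.2 hχ₂
  have hne : (-1 : ℂ) ≠ 1 := by norm_num
  obtain ⟨ha, hb, hc, hd⟩ := CMQG.exists_contains_invertible hn (universalCMQG P hP hQ) hz
    (χ := χ₂) (hχ₂.trans_ne hne)
  refine ⟨⟨_, ha, hb, hc, hd, ?_⟩, CMQG.not_hasFreeFusionRing ha (χ₁ := χ₂) (χ₂ := χ₁)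
    (hχ₂.trans_ne hne) (hχ₁.trans_ne hne.symm)⟩
  have hstar : star z = z := by
    rw [← hz.1 ⟨0, hn⟩, star_sum]
    exact Finset.sum_congr rfl fun j _ => hQ.star_gen hP _ _
  exact CMQG.equivalent_of_entry 0 0 hstar.symm

/-- In a free complexification, the row sum is `id_{S¹}`, which takes the value `I ≠ ±1` under some
character. -/
theorem complexCMQG_invertible_and_not_free {n : ℕ} (hn : 1 ≤ n)
    {P : Relations (Fin n × Fin n)} (hP : P.Bounded)
    (hsum : SumsTo (universalPair P hP).U 1)
    (hs : P ℂ (fun p => if p.1 = p.2 then 1 else 0)) (G : CMQG n)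
    (hG : G.toMatrixPair = freeComplexification (universalPair P hP)) :
    (∃ z : Matrix (Fin 1) (Fin 1) G.carrier,
      G.IsCorep z ∧
      G.Contains G.U z ∧
      ¬ Equivalent z (1 : Matrix (Fin 1) (Fin 1) G.carrier) ∧
      Equivalent (tensor z (conj z)) (1 : Matrix (Fin 1) (Fin 1) G.carrier)) ∧
    ¬ G.HasFreeFusionRing := by
  obtain ⟨z, χ, hz, hχ⟩ : ∃ (z : G.carrier) (χ : G.carrier →⋆ₐ[ℂ] ℂ),
      SumsTo G.U z ∧ χ z = Complex.I := by
    rw [hG]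
    have hI : star Complex.I * Complex.I = 1 := by simp
    have hI' : Complex.I * star Complex.I = 1 := by simp
    obtain ⟨ψ, hψ⟩ := exists_circle_hom hI hI'
    obtain ⟨ε, -⟩ := exists_character hP hs
    obtain ⟨z, hz, hsumz⟩ := exists_sumsTo_freeComplexification (universalPair P hP) hn hsum
    refine ⟨z, (FreeProduct.lift ε ψ).comp (StarSubalgebra.subtype _), hsumz, ?_⟩
    refine (congrArg (FreeProduct.lift ε ψ) hz).trans ?_
    rw [FreeProduct.lift_inr, hψ]
  have hI1 : Complex.I ≠ 1 := fun h => by simpa using congrArg Complex.re h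
  have hI2 : Complex.I ≠ -1 := fun h => by simpa using congrArg Complex.re h
  obtain ⟨ha, hb, hc, hd⟩ := CMQG.exists_contains_invertible hn G hz (χ := χ) (hχ.trans_ne hI1)
  exact ⟨⟨_, ha, hb, hc, hd⟩, CMQG.not_hasFreeFusionRing ha (χ₁ := χ) (χ₂ := χ)
    (hχ.trans_ne hI1) (hχ.trans_ne hI2)⟩

end FreeQG

end

theorem mainTheorem4 :
    (∀ (n : ℕ) (_hn : 1 ≤ n) (t : FreeQG.Index),
      ∃ G : FreeQG.CMQG n, G.toMatrixPair = t.pair n ∧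
        (∃ z : Matrix (Fin 1) (Fin 1) G.carrier,
          G.IsCorep z ∧
          G.Contains G.U z ∧
          ¬ FreeQG.Equivalent z (1 : Matrix (Fin 1) (Fin 1) G.carrier) ∧
          FreeQG.Equivalent (FreeQG.tensor z (FreeQG.conj z))
            (1 : Matrix (Fin 1) (Fin 1) G.carrier) ∧
          (t = .bPrime ∨ t = .sPrime → FreeQG.Equivalent z (FreeQG.conj z))) ∧
        ¬ G.HasFreeFusionRing ∧
        (4 ≤ n → t = .bPrime ∨ t = .sPrime → G.IsOrthogonalFree)) ∧
    (∀ (F : FreeQG.FusionSet) (a : F.ZM), a ≠ 1 → a ≠ -1 → a * star a ≠ 1) ∧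
    ¬ (∀ (n : ℕ) (_hn : 4 ≤ n) (G : FreeQG.CMQG n), G.IsOrthogonalFree → G.HasFreeFusionRing) := by
  refine ⟨fun n hn t => ?_, fun F a h1 h2 h => ?_, fun h => ?_⟩
  · cases t with
    | bPrime =>
      have hP := FreeQG.bounded_of_oRel (P := FreeQG.bPrimeRel n) fun _ _ _ h => h.1
      have hQ := FreeQG.bPrimeRel_isQuantum n
      obtain ⟨⟨z, ha, hb, hc, hd, he⟩, hf⟩ :=
        FreeQG.universalCMQG_invertible_and_not_free hn hP hQ (hQ.gen hP).2
        fun _ h => ⟨h.1, h.2.2⟩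
      exact ⟨FreeQG.universalCMQG _ hP hQ, rfl, ⟨z, ha, hb, hc, hd, fun _ => he⟩, hf,
        fun _ _ => FreeQG.isOrthogonalFree_bPrime hn hP⟩
    | sPrime =>
      have hP := FreeQG.bounded_of_oRel (P := FreeQG.sPrimeRel n) fun _ _ _ h => h.1
      have hQ := FreeQG.sPrimeRel_isQuantum n
      obtain ⟨⟨z, ha, hb, hc, hd, he⟩, hf⟩ :=
        FreeQG.universalCMQG_invertible_and_not_free hn hP hQ (hQ.gen hP).2.2
        fun _ h => h
      exact ⟨FreeQG.universalCMQG _ hP hQ, rfl, ⟨z, ha, hb, hc, hd, fun _ => he⟩, hf,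
        fun _ _ => FreeQG.isOrthogonalFree_sPrime hn hP⟩
    | c =>
      have hP := FreeQG.bounded_of_oRel (P := FreeQG.bRel n) fun _ _ _ h => h.1
      have hQ := FreeQG.bRel_isQuantum n
      have hs := FreeQG.sRel_scalar n
      obtain ⟨G, hG⟩ := FreeQG.exists_complexCMQG_universalPair hn _ hP hQ fun _ _ _ h => h.2
      obtain ⟨⟨z, ha, hb, hc, hd⟩, hf⟩ :=
        FreeQG.complexCMQG_invertible_and_not_free hn hP (hQ.gen hP).2
        ⟨hs.1, hs.2.2⟩ G hG
      exact ⟨G, hG, ⟨z, ha, hb, hc, hd, by simp⟩, hf, by simp⟩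
    | p =>
      have hP := FreeQG.bounded_of_oRel (P := FreeQG.sRel n) fun _ _ _ h => h.1
      have hQ := FreeQG.sRel_isQuantum n
      obtain ⟨G, hG⟩ := FreeQG.exists_complexCMQG_universalPair hn _ hP hQ fun _ _ _ h => h.2.2
      obtain ⟨⟨z, ha, hb, hc, hd⟩, hf⟩ :=
        FreeQG.complexCMQG_invertible_and_not_free hn hP (hQ.gen hP).2.2
        (FreeQG.sRel_scalar n) G hG
      exact ⟨G, hG, ⟨z, ha, hb, hc, hd, by simp⟩, hf, by simp⟩
  · exact (F.eq_one_or_neg_one_of_mul_star a h).elim h1 h2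
  · have hP := FreeQG.bounded_of_oRel (P := FreeQG.bPrimeRel 4) fun _ _ _ h => h.1
    have hQ := FreeQG.bPrimeRel_isQuantum 4
    have hn : 1 ≤ 4 := by norm_num
    exact (FreeQG.universalCMQG_invertible_and_not_free hn hP hQ (hQ.gen hP).2
      fun _ h => ⟨h.1, h.2.2⟩).2 (h 4 le_rfl _ (FreeQG.isOrthogonalFree_bPrime hn hP))
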